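/- Let $k$ be an algebraically closed field of characteristic zero. A toric log del Pezzo surface is a complete toric surface over $k$ (the toric variety of a complete fan in $\mathbb{Z}^2$) whose anticanonical divisor is $\mathbb{Q}$-Cartier and ample. For such a surface $S$ of Picard number one let $f : S' \to S$ be its minimal resolution, let $L$ be the number of irreducible $f$-exceptional curves $D_i$, and let $tr(S) = -\sum_i D_i^2$, the sum running over these curves. A one-step cascade from $S$ to $\bar S$, both toric log del Pezzo surfaces of Picard number one with minimal resolutions $S'$ and $\bar S'$, is a toric blow-down $S' \to \bar S'$ of a single $(-1)$-curve of $S'$. The surface $S$ is called basic if every torus-invariant curve $D$ on $S'$ meeting a $(-1)$-curve of $S'$ satisfies $D^2 \ge -2$. A cascade is a finite sequence $S = S_t, S_{t-1}, \dots, S_0$ ($t \ge 0$) of toric log del Pezzo surfaces of Picard number one, with minimal resolutions $S'_i \to S_i$, together with toric blow-downs $S'_{i} \to S'_{i-1}$ of a $(-1)$-curve ($1 \le i \le t$), such that $S_0$ is basic. Then: 1. If there is a one-step cascade from $S$ to $\bar S$, then $S$ and $\bar S$ have the same (finite) number of singular points, and $tr(S) - 3L$ takes the same value on $S$ and $\bar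 S$. 2. If $S = S_t, \dots, S_0$ is a cascade, then all the surfaces $S_i$, $0 \le i \le t$, have the same (finite) number of singular points and the same value of $tr(S_i) - 3L_i$, where $L_i$ is the number of exceptional curves of $S'_i \to S_i$. -/

import Mathlib

/-!
Conventions.  An integral separated scheme of finite type over a field, with function field `K`,
is determined by the set of its local rings, regarded as subrings of `K` (varieties as "schemata"
in the sense of Chevalley and Zariski).  We work with such sets `X : Set (LocalSubring K)`; the
elements of `X` are the local rings of the (scheme-theoretic) points of the variety.

* The point `P` lies on the closure of the point `C` iff `O_P ⊆ O_C`.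
* The birational map `Y ⇢ X` given by the identity of `K` is a morphism iff every local ring of
  `Y` dominates a local ring of `X`; the point of `Y` is then mapped to that point of `X`.
* On a normal variety, the prime divisors (for a surface: the irreducible curves) correspond to
  the points whose local ring is a discrete valuation ring.
-/

noncomputable section

namespace ToricSurface

section Models

variable {K : Type*} [Field K]

/-- The local rings of `Spec A`, for a subring `A` of the field `K`. -/
def specModel (A : Subring K) : Set (LocalSubring K) :=
  {R | ∃ (p : Ideal A) (_ : p.IsPrime), R = LocalSubring.ofPrime A p}

/-- `C` is (the generic point of) a prime divisor of `X`. -/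
def IsPrimeDivisor (X : Set (LocalSubring K)) (C : LocalSubring K) : Prop :=
  C ∈ X ∧ IsDiscreteValuationRing C.toSubring

/-- The rational function `f` (nonzero) has order `n` along the prime divisor with local ring `C`:
`f = u * ϖ ^ n` with `u` a unit and `ϖ` a uniformizer of `C`. -/
def HasOrd (C : LocalSubring K) (f : K) (n : ℤ) : Prop :=
  ∃ ϖ u : C.toSubring, Irreducible ϖ ∧ IsUnit u ∧ f = (u : K) * (ϖ : K) ^ n

open Classical in
/-- The order of the nonzero rational function `f` along `C`. -/
def ordAt (C : LocalSubring K) (f : K) : ℤ :=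
  if h : ∃ n, HasOrd C f n then h.choose else 0

/-- The points of `X` whose local ring is not regular. -/
def singularPoints (X : Set (LocalSubring K)) : Set (LocalSubring K) :=
  {P | P ∈ X ∧ ¬ IsRegularLocalRing P.toSubring}

/-- `X` is regular (equivalently smooth, the ground field being perfect). -/
def IsRegularModel (X : Set (LocalSubring K)) : Prop :=
  ∀ P ∈ X, IsRegularLocalRing P.toSubring

/-- The identity of the function field induces a (birational) morphism `Y → X`. -/
def Dominates (Y X : Set (LocalSubring K)) : Prop :=
  ∀ Q ∈ Y, ∃ P ∈ X, P ≤ Q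

/-- The exceptional curves of the birational morphism `Y → X` of surfaces: the curves in `Y` whose
image is not a curve. -/
def exceptionalCurves (Y X : Set (LocalSubring K)) : Set (LocalSubring K) :=
  {E | IsPrimeDivisor Y E ∧ ∀ P ∈ X, P ≤ E → ¬ IsPrimeDivisor X P}

/-- The ideal, in the local ring at `P`, of the curve `C` passing through `P`. -/
def curveIdeal {P C : LocalSubring K} (h : P.toSubring ≤ C.toSubring) : Ideal P.toSubring :=
  (IsLocalRing.maximalIdeal C.toSubring).comap (Subring.inclusion h)

/-- The intersection number `C · D` of two distinct curves on the regular surface `X`: the sum, over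
the points `P` lying on both curves, of the length of `O_P / (I_C + I_D)`.
(Over an algebraically closed field the length is the dimension over that field.) -/
def intersectionNumber (X : Set (LocalSubring K)) (C D : LocalSubring K) : ℕ :=
  ∑ᶠ (P : LocalSubring K) (h : P ∈ X ∧ P.toSubring ≤ C.toSubring ∧ P.toSubring ≤ D.toSubring),
    (Module.length P.toSubring (P.toSubring ⧸ (curveIdeal h.2.1 ⊔ curveIdeal h.2.2))).toNat

theorem HasOrd.mul {C : LocalSubring K} [IsDiscreteValuationRing C.toSubring] {f g : K} {m n : ℤ}
    (hf : HasOrd C f m) (hg : HasOrd C g n) : HasOrd C (f * g) (m + n) := by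
  obtain ⟨ϖ, u, hϖ, hu, rfl⟩ := hf
  obtain ⟨ϖ', u', hϖ', hu', rfl⟩ := hg
  obtain ⟨w, hw⟩ := IsDiscreteValuationRing.associated_of_irreducible _ hϖ hϖ'
  have hne : (ϖ : K) ≠ 0 := by
    intro h
    exact hϖ.ne_zero (Subtype.ext h)
  obtain ⟨v, rfl⟩ := hu
  obtain ⟨v', rfl⟩ := hu'
  have hwz : (((w ^ n : (C.toSubring)ˣ) : C.toSubring) : K) = ((w : C.toSubring) : K) ^ n := by
    have := (Units.map (C.toSubring.subtype : C.toSubring →* K)).map_zpow w n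
    have h2 := congrArg (fun x : Kˣ => (x : K)) this
    simp only [Units.val_zpow_eq_zpow_val] at h2
    exact h2
  refine ⟨ϖ, (v * v' * w ^ n : (C.toSubring)ˣ), hϖ, Units.isUnit _, ?_⟩
  rw [← hw]
  push_cast
  rw [hwz, mul_zpow, zpow_add₀ hne]
  ring

theorem HasOrd.inv {C : LocalSubring K} {f : K} {m : ℤ}
    (hf : HasOrd C f m) : HasOrd C f⁻¹ (-m) := by
  obtain ⟨ϖ, u, hϖ, ⟨v, rfl⟩, rfl⟩ := hf
  refine ⟨ϖ, (v⁻¹ : (C.toSubring)ˣ), hϖ, Units.isUnit _, ?_⟩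
  have h : (((v⁻¹ : (C.toSubring)ˣ) : C.toSubring) : K) = ((v : C.toSubring) : K)⁻¹ := by
    apply eq_inv_of_mul_eq_one_left
    have := congrArg (fun x : C.toSubring => (x : K)) v.inv_mul
    exact this
  rw [h, mul_inv, zpow_neg]

theorem HasOrd.one (C : LocalSubring K) [IsDiscreteValuationRing C.toSubring] :
    HasOrd C 1 0 := by
  obtain ⟨ϖ, hϖ⟩ := IsDiscreteValuationRing.exists_irreducible C.toSubring
  exact ⟨ϖ, 1, hϖ, isUnit_one, by simp⟩

/-- The group of Weil divisors of `X`. -/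
abbrev WeilDivisor (X : Set (LocalSubring K)) : Type _ :=
  {C : LocalSubring K // IsPrimeDivisor X C} →₀ ℤ

/-- The principal divisors `div f`, `f` a nonzero rational function. -/
def principalDivisors (X : Set (LocalSubring K)) : AddSubgroup (WeilDivisor X) where
  carrier := {D | ∃ f : K, ∀ C, HasOrd C.1 f (D C)}
  zero_mem' := ⟨1, fun C => by
    have := C.2.2
    exact HasOrd.one C.1⟩
  add_mem' := by
    rintro D D' ⟨f, hf⟩ ⟨g, hg⟩
    refine ⟨f * g, fun C => ?_⟩
    have := C.2.2
    exact (hf C).mul (hg C)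
  neg_mem' := by
    rintro D ⟨f, hf⟩
    exact ⟨f⁻¹, fun C => (hf C).inv⟩

/-- The Cartier divisors of the normal variety `X`: the Weil divisors which are principal
locally at each point. -/
def cartierDivisors (X : Set (LocalSubring K)) : AddSubgroup (WeilDivisor X) where
  carrier := {D | ∀ P ∈ X, ∃ f : K, ∀ C, P.toSubring ≤ C.1.toSubring → HasOrd C.1 f (D C)}
  zero_mem' := fun P _ => ⟨1, fun C _ => by
    have := C.2.2
    exact HasOrd.one C.1⟩
  add_mem' := by
    intro D D' hD hD' P hP
    obtain ⟨f, hf⟩ := hD P hP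
    obtain ⟨g, hg⟩ := hD' P hP
    refine ⟨f * g, fun C hC => ?_⟩
    have := C.2.2
    exact (hf C hC).mul (hg C hC)
  neg_mem' := by
    intro D hD P hP
    obtain ⟨f, hf⟩ := hD P hP
    exact ⟨f⁻¹, fun C hC => (hf C hC).inv⟩

/-- The Picard group: Cartier divisors modulo principal divisors. -/
abbrev PicardGroup (X : Set (LocalSubring K)) : Type _ :=
  cartierDivisors X ⧸ (principalDivisors X).addSubgroupOf (cartierDivisors X)

/-- The Picard number of a complete toric (more generally, rational) surface: the rank of the
Picard group.  (Algebraic, numerical and linear equivalence of Cartier divisors on such a surface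
agree up to torsion.) -/
def picardNumber (X : Set (LocalSubring K)) : ℕ := Module.finrank ℤ (PicardGroup X)

/-- The nonvanishing locus `X_s` of `s`, regarded as a section of `O_X(D)`, `D` a Cartier divisor:
the points at which `div s + D` is trivial. -/
def nonvanishing (X : Set (LocalSubring K)) (D : WeilDivisor X) (s : K) : Set (LocalSubring K) :=
  {P | P ∈ X ∧ ∀ C, P.toSubring ≤ C.1.toSubring → HasOrd C.1 s (-D C)}

/-- `D` is an ample Cartier divisor on the complete normal variety `X`: the affine nonvanishing loci
of global sections of the positive multiples of `D` cover `X`. -/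
def IsAmple (X : Set (LocalSubring K)) (D : WeilDivisor X) : Prop :=
  D ∈ cartierDivisors X ∧ ∀ P ∈ X, ∃ n : ℕ, 0 < n ∧ ∃ s : K,
    (∀ C, ∃ e : ℤ, HasOrd C.1 s e ∧ 0 ≤ e + (n • D) C) ∧
    P ∈ nonvanishing X (n • D) s ∧
    ∃ A : Subring K, nonvanishing X (n • D) s = specModel A

end Models

/-- The function field `k(x, y)` of the two-dimensional torus over `k`. -/
abbrev FunField (k : Type*) [Field k] : Type _ := FractionRing (MvPolynomial (Fin 2) k)

/-- A variety over `k` with function field `k(x, y)`, given by its local rings. -/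
abbrev Model (k : Type*) [Field k] : Type _ := Set (LocalSubring (FunField k))

/-- The coordinate functions `x` and `y` on the torus. -/
def coord (k : Type*) [Field k] (i : Fin 2) : FunField k :=
  algebraMap (MvPolynomial (Fin 2) k) (FunField k) (MvPolynomial.X i)

/-- The character `x ^ m₁ * y ^ m₂` of the torus. -/
def character (k : Type*) [Field k] (m : ℤ × ℤ) : FunField k :=
  coord k 0 ^ m.1 * coord k 1 ^ m.2

/-- The determinant of two vectors of the lattice `N = ℤ²`. -/
def det (u v : ℤ × ℤ) : ℤ := u.1 * v.2 - u.2 * v.1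

/-- The pairing of `M = ℤ²` with `N = ℤ²`. -/
def pairing (m u : ℤ × ℤ) : ℤ := m.1 * u.1 + m.2 * u.2

/-- A complete fan in the plane, given by the primitive generators of its rays; completeness says
that every vector lies in a strongly convex cone spanned by two rays. -/
structure CompleteFan where
  rays : Finset (ℤ × ℤ)
  primitive : ∀ u ∈ rays, IsCoprime u.1 u.2
  complete : ∀ w : ℤ × ℤ, ∃ u ∈ rays, ∃ v ∈ rays, 0 < det u v ∧ 0 ≤ det u w ∧ 0 ≤ det w v

/-- The cone spanned by `u` and `v` is a two-dimensional cone of the fan: `u` and `v` are two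
consecutive rays, in counterclockwise order. -/
def CompleteFan.IsMaxCone (F : CompleteFan) (u v : ℤ × ℤ) : Prop :=
  u ∈ F.rays ∧ v ∈ F.rays ∧ 0 < det u v ∧ ∀ w ∈ F.rays, ¬ (0 < det u w ∧ 0 < det w v)

/-- The coordinate ring `k[σ^∨ ∩ M]` of the affine toric chart of the cone `σ` spanned by
`u` and `v`. -/
def chartRing (k : Type*) [Field k] (u v : ℤ × ℤ) : Subalgebra k (FunField k) :=
  Algebra.adjoin k {f | ∃ m : ℤ × ℤ, 0 ≤ pairing m u ∧ 0 ≤ pairing m v ∧ f = character k m}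

/-- The toric surface of a complete fan: the union of its affine charts. -/
def toricModel (k : Type*) [Field k] (F : CompleteFan) : Model k :=
  {R | ∃ u v, F.IsMaxCone u v ∧ R ∈ specModel (chartRing k u v).toSubring}

section Surfaces

variable {k : Type*} [Field k]

/-- `X` is a complete (normal) toric surface, with torus `Spec k[x, x⁻¹, y, y⁻¹]`. -/
def IsToricSurface (X : Model k) : Prop := ∃ F : CompleteFan, X = toricModel k F

/-- `C` is a torus-invariant curve: it lies in the complement of the torus, that is, some
character has a zero or a pole along it. -/
def IsInvariantCurve (X : Model k) (C : LocalSubring (FunField k)) : Prop :=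
  IsPrimeDivisor X C ∧ ∃ m, ordAt C (character k m) ≠ 0

open Classical in
/-- The self-intersection number of a torus-invariant curve `C` on the complete regular toric
surface `X`.  Choose a character `χ` of order one along `C`; then `C` is linearly equivalent to
`C - div χ`, which does not contain `C`, and `C² = C · (C - div χ) = -∑ ord_D(χ) (D · C)`, the sum
being over the curves `D ≠ C`. -/
def selfIntersection (X : Model k) (C : LocalSubring (FunField k)) : ℤ :=
  if h : ∃ m, ordAt C (character k m) = 1 then
    - ∑ᶠ (D : LocalSubring (FunField k)) (_ : IsPrimeDivisor X D ∧ D ≠ C),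
        ordAt D (character k h.choose) * (intersectionNumber X D C : ℤ)
  else 0

/-- `C` is a `(-1)`-curve on the complete regular toric surface `X`.  (A curve with negative
self-intersection number on `X` is torus-invariant, and torus-invariant curves are smooth and
rational.) -/
def IsMinusOneCurve (X : Model k) (C : LocalSubring (FunField k)) : Prop :=
  IsInvariantCurve X C ∧ selfIntersection X C = -1

/-- The differential form `da ∧ db`. -/
def wedge (a b : FunField k) : ⋀[FunField k]^2 (Ω[FunField k⁄k]) :=
  exteriorPower.ιMulti (FunField k) 2
    ![KaehlerDifferential.D k (FunField k) a, KaehlerDifferential.D k (FunField k) b]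

/-- `D` is the canonical divisor `div (dx ∧ dy)` of `X`: along each curve `C`, the module over `O_C`
generated by the forms `da ∧ db` with `a, b ∈ O_C` is free on `g⁻¹ dx ∧ dy`, where `g` is of order
`D C` along `C`. -/
def IsCanonicalDivisor (X : Model k) (D : WeilDivisor X) : Prop :=
  ∀ C, ∃ g : FunField k, HasOrd C.1 g (D C) ∧
    (∃ a ∈ C.1.toSubring, ∃ b ∈ C.1.toSubring,
      wedge a b = g⁻¹ • wedge (coord k 0) (coord k 1)) ∧
    ∀ a ∈ C.1.toSubring, ∀ b ∈ C.1.toSubring, ∃ c ∈ C.1.toSubring,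
      wedge a b = (c * g⁻¹) • wedge (coord k 0) (coord k 1)

/-- `X` is a toric log del Pezzo surface: a complete toric surface with `-K_X` ample, i.e. a
positive multiple of `-K_X` is an ample Cartier divisor.  (The singularities of a toric surface
are cyclic quotient singularities, hence log terminal.) -/
def IsToricLogDelPezzo (X : Model k) : Prop :=
  IsToricSurface X ∧ ∃ D : WeilDivisor X, IsCanonicalDivisor X D ∧
    ∃ n : ℕ, 0 < n ∧ IsAmple X (n • (-D))

/-- `X` is a toric log del Pezzo surface of Picard number one. -/
def IsToricLogDelPezzoOne (X : Model k) : Prop :=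
  IsToricLogDelPezzo X ∧ picardNumber X = 1

/-- `Y → X` is the minimal resolution of the toric surface `X`: `Y` is regular and no exceptional
curve is a `(-1)`-curve. -/
def IsMinimalResolution (Y X : Model k) : Prop :=
  IsToricSurface Y ∧ IsRegularModel Y ∧ Dominates Y X ∧
    ∀ E ∈ exceptionalCurves Y X, ¬ IsMinusOneCurve Y E

/-- `Y → Z` is a toric blow-down between regular complete toric surfaces, contracting exactly
one curve, which is a `(-1)`-curve. -/
def IsBlowDown (Y Z : Model k) : Prop :=
  IsToricSurface Y ∧ IsRegularModel Y ∧ IsToricSurface Z ∧ IsRegularModel Z ∧ Dominates Y Z ∧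
    ∃ E, IsMinusOneCurve Y E ∧ exceptionalCurves Y Z = {E}

/-- The surface with minimal resolution `Y` is basic: every torus-invariant curve on `Y` meeting a
`(-1)`-curve has self-intersection number at least `-2`. -/
def IsBasic (Y : Model k) : Prop :=
  ∀ C, IsMinusOneCurve Y C → ∀ D, IsInvariantCurve Y D →
    (∃ P ∈ Y, P.toSubring ≤ C.toSubring ∧ P.toSubring ≤ D.toSubring) →
    -2 ≤ selfIntersection Y D

/-- The trace of the surface `X` with minimal resolution `Y`: minus the sum of the
self-intersection numbers of the exceptional curves. -/
def trace (Y X : Model k) : ℤ :=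
  - ∑ᶠ (E : LocalSubring (FunField k)) (_ : E ∈ exceptionalCurves Y X), selfIntersection Y E

/-- The number `L` of exceptional curves of the minimal resolution `Y → X`. -/
def exceptionalCount (Y X : Model k) : ℕ := (exceptionalCurves Y X).ncard

/-- A one-step cascade from `S` to `T`, where `S'` and `T'` are the minimal resolutions of `S`
and `T`. -/
structure IsOneStepCascade (S' S T' T : Model k) : Prop where
  logDelPezzo_source : IsToricLogDelPezzoOne S
  logDelPezzo_target : IsToricLogDelPezzoOne T
  minimalResolution_source : IsMinimalResolution S' S
  minimalResolution_target : IsMinimalResolution T' T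
  blowDown : IsBlowDown S' T'

/-- A cascade of length `t` from `S t` to the basic surface `S 0`, where `S' i` is the minimal
resolution of `S i` (the terms with index greater than `t` play no role). -/
structure IsCascade (t : ℕ) (S' S : ℕ → Model k) : Prop where
  logDelPezzo : ∀ i ≤ t, IsToricLogDelPezzoOne (S i)
  minimalResolution : ∀ i ≤ t, IsMinimalResolution (S' i) (S i)
  blowDown : ∀ i < t, IsBlowDown (S' (i + 1)) (S' i)
  basic : IsBasic (S' 0)

end Surfaces

end ToricSurface

end

open ToricSurface

/-! The geometry is first translated into fans. For a fan `F`, the invariant curves of its surface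
are the discrete valuation rings `weightRing k r` of the monomial valuations attached to the rays
`r`. Every other prime divisor meets the torus and is common to all toric models. Hence the
exceptional curves of a resolution `G` of `F` are the rays of `G` outside `F`
(`exceptionalCurves_fanModel`). The singular points are the fixed points of cones of determinant
different from one (`singularPoints_fanModel`). On a smooth fan, three consecutive rays satisfy
`prev r + next r = weight r • r`, and the curve of `r` has self-intersection `-weight r`
(`sum_ordAt_mul_intersectionNumber`). Picard number one forces exactly three rays, because a
function without zeros or poles on the torus is a constant times a character
(`card_rays_of_picardNumber_eq_one`). A minimal resolution is then a smooth fan containing the three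
rays in which all other rays have weight at least two. A blow-down omits one ray of weight one and
lowers the weights of its two neighbours by one.

What remains is plane combinatorics. Call the three rays marked. If three consecutive rays satisfy
`n r + p r = a r • r` with `a r ≥ 2`, a linear form that has started to grow along the sequence
keeps growing. As the set of rays is finite, such a walk must run into a marked ray
(`exists_of_walk`). It follows that every marked ray has weight at most one. A marked ray of weight
one is adjacent to neither of the other two and has determinant at least two with both.

Now let `e` be the contracted ray. Having weight one, it is marked; let `a`, `b` be the other marked
rays. They are not neighbours of `e`, so their weights, at most one, survive the blow-down and both
are marked below as well. The third marked ray `c` below has weight at most one there but at least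
two above. So it is a neighbour of `e`, and its weight drops from two to one.

Both triangles `e, a, b` and `c, a, b` have two singular cones at the weight-one vertex and share
the cone of `a` and `b`, so the numbers of singular points agree. In `tr - 3L`, the sum of `weight -
3` over exceptional rays, the surface above has the extra term `2 - 3 = -1` from `c`. This is
cancelled by the other neighbour of `e`, whose weight is larger by one above. Cascades follow by
induction along the chain. -/

set_option linter.unusedSectionVars false

noncomputable section

namespace ToricSurface

open scoped HahnSeries

variable {k K : Type*} [Field k] [Field K] [Algebra k K] [Algebra (MvPolynomial (Fin 2) k) K]
  [IsScalarTower k (MvPolynomial (Fin 2) k) K] [IsFractionRing (MvPolynomial (Fin 2) k) K]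

/-- The Laurent monomial `x ^ m₁ * y ^ m₂` in a function field `K` of the torus. -/
def laurentMonomial (k K : Type*) [Field k] [Field K] [Algebra (MvPolynomial (Fin 2) k) K]
    (m : ℤ × ℤ) : K :=
  algebraMap (MvPolynomial (Fin 2) k) K (MvPolynomial.X 0) ^ m.1 *
    algebraMap (MvPolynomial (Fin 2) k) K (MvPolynomial.X 1) ^ m.2

local notation "χ" => laurentMonomial k K

/-! ### Laurent monomials and their spans. -/

section Monomials

theorem algebraMap_X_ne_zero (k K : Type*) [Field k] [Field K]
    [Algebra (MvPolynomial (Fin 2) k) K] [IsFractionRing (MvPolynomial (Fin 2) k) K] (i : Fin 2) :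
    algebraMap (MvPolynomial (Fin 2) k) K (MvPolynomial.X i) ≠ 0 := by
  rw [Ne, FaithfulSMul.algebraMap_eq_zero_iff]
  exact MvPolynomial.X_ne_zero i

@[simp] theorem laurentMonomial_zero : χ 0 = 1 := by simp [laurentMonomial]

theorem laurentMonomial_ne_zero (m : ℤ × ℤ) : χ m ≠ 0 :=
  mul_ne_zero (zpow_ne_zero _ (algebraMap_X_ne_zero k K 0))
    (zpow_ne_zero _ (algebraMap_X_ne_zero k K 1))

theorem laurentMonomial_add (m n : ℤ × ℤ) : χ (m + n) = χ m * χ n := by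
  simp only [laurentMonomial, Prod.fst_add, Prod.snd_add, zpow_add₀ (algebraMap_X_ne_zero k K _)]
  ring

theorem laurentMonomial_neg (m : ℤ × ℤ) : χ (-m) = (χ m)⁻¹ := by
  simp only [laurentMonomial, Prod.fst_neg, Prod.snd_neg, zpow_neg]
  rw [mul_inv]

theorem laurentMonomial_zsmul (n : ℤ) (m : ℤ × ℤ) : χ (n • m) = χ m ^ n := by
  simp only [laurentMonomial, Prod.smul_fst, Prod.smul_snd, smul_eq_mul, mul_zpow]
  rw [mul_comm n, mul_comm n, zpow_mul, zpow_mul]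

theorem laurentMonomial_nsmul (n : ℕ) (m : ℤ × ℤ) : χ (n • m) = χ m ^ n := by
  simpa using laurentMonomial_zsmul (k := k) (K := K) n m

theorem laurentMonomial_natCast (s : Fin 2 →₀ ℕ) : χ ((s 0 : ℤ), (s 1 : ℤ)) =
    algebraMap (MvPolynomial (Fin 2) k) K (MvPolynomial.monomial s 1) := by
  rw [MvPolynomial.monomial_eq, Finsupp.prod_fintype _ _ (by simp)]
  simp [laurentMonomial, Fin.prod_univ_two]

theorem linearIndependent_laurentMonomial_natCast :
    LinearIndependent k (fun s : Fin 2 →₀ ℕ => χ ((s 0 : ℤ), (s 1 : ℤ))) := by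
  have h := (MvPolynomial.basisMonomials (Fin 2) k).linearIndependent.map'
    (IsScalarTower.toAlgHom k (MvPolynomial (Fin 2) k) K).toLinearMap
    (LinearMap.ker_eq_bot.mpr (by
      intro a b hab
      exact IsFractionRing.injective (MvPolynomial (Fin 2) k) K hab))
  have heq : (fun s : Fin 2 →₀ ℕ => χ ((s 0 : ℤ), (s 1 : ℤ))) =
      (IsScalarTower.toAlgHom k (MvPolynomial (Fin 2) k) K).toLinearMap ∘
        MvPolynomial.basisMonomials (Fin 2) k := by
    funext s
    simp [laurentMonomial_natCast]
  rw [heq]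
  exact h

theorem exists_add_nonneg (s : Finset (ℤ × ℤ)) :
    ∃ N : ℤ, ∀ m ∈ s, 0 ≤ m.1 + N ∧ 0 ≤ m.2 + N := by
  refine ⟨∑ m ∈ s, (|m.1| + |m.2|), fun m hm => ?_⟩
  have h : |m.1| + |m.2| ≤ ∑ m ∈ s, (|m.1| + |m.2|) :=
    Finset.single_le_sum (f := fun m : ℤ × ℤ => |m.1| + |m.2|) (fun i _ => by positivity) hm
  have h1 := neg_abs_le m.1
  have h2 := neg_abs_le m.2
  have h3 := abs_nonneg m.1
  have h4 := abs_nonneg m.2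
  constructor <;> linarith

/-- A relation involves finitely many exponents. Multiplying it by a high power of `x * y` makes all
of them nonnegative, and polynomial monomials are independent. -/
theorem linearIndependent_laurentMonomial : LinearIndependent k χ := by
  rw [linearIndependent_iff_finset_linearIndependent]
  intro s
  obtain ⟨N, hN⟩ := exists_add_nonneg s
  let e : s → (Fin 2 →₀ ℕ) := fun m =>
    Finsupp.equivFunOnFinite.symm ![(m.1.1 + N).toNat, (m.1.2 + N).toNat]
  have e0 : ∀ m, e m 0 = (m.1.1 + N).toNat := fun m => rfl
  have e1 : ∀ m, e m 1 = (m.1.2 + N).toNat := fun m => rfl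
  have he : Function.Injective e := by
    intro a b hab
    have h0 := DFunLike.congr_fun hab 0
    have h1 := DFunLike.congr_fun hab 1
    rw [e0, e0] at h0
    rw [e1, e1] at h1
    have ha := hN a a.2
    have hb := hN b b.2
    ext <;> lia
  have h := (linearIndependent_laurentMonomial_natCast (k := k) (K := K)).comp e he
  refine LinearIndependent.of_comp (LinearMap.mulLeft k (χ (N, N))) ?_
  have heq : (LinearMap.mulLeft k (χ (N, N)) ∘ fun m : s => χ m) =
      (fun s : Fin 2 →₀ ℕ => χ ((s 0 : ℤ), (s 1 : ℤ))) ∘ e := by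
    funext m
    have := hN m m.2
    simp only [Function.comp_apply, LinearMap.mulLeft_apply, ← laurentMonomial_add, e0, e1]
    congr 1
    ext <;> simp <;> lia
  rw [← heq] at h
  exact h

/-- The span of the Laurent monomials with exponents in `S`. -/
def monomialSpan (k K : Type*) [Field k] [Field K] [Algebra k K]
    [Algebra (MvPolynomial (Fin 2) k) K] (S : Set (ℤ × ℤ)) : Submodule k K :=
  Submodule.span k (laurentMonomial k K '' S)

theorem laurentMonomial_mem_monomialSpan {S : Set (ℤ × ℤ)} {m : ℤ × ℤ} (h : m ∈ S) :
    χ m ∈ monomialSpan k K S :=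
  Submodule.subset_span ⟨m, h, rfl⟩

theorem monomialSpan_mono {S T : Set (ℤ × ℤ)} (h : S ⊆ T) :
    monomialSpan k K S ≤ monomialSpan k K T :=
  Submodule.span_mono (Set.image_mono h)

theorem monomialSpan_induction {S : Set (ℤ × ℤ)} {p : K → Prop}
    (hchar : ∀ m ∈ S, p (χ m)) (hzero : p 0) (hadd : ∀ x y, p x → p y → p (x + y))
    (hsmul : ∀ (c : k) x, p x → p (c • x)) {x : K} (hx : x ∈ monomialSpan k K S) : p x := by
  refine Submodule.span_induction (p := fun x _ => p x) ?_ hzero (fun x y _ _ => hadd x y)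
    (fun c x _ => hsmul c x) hx
  rintro _ ⟨m, hm, rfl⟩
  exact hchar m hm

theorem mul_mem_monomialSpan {S T U : Set (ℤ × ℤ)} (h : ∀ m ∈ S, ∀ n ∈ T, m + n ∈ U)
    {x y : K} (hx : x ∈ monomialSpan k K S) (hy : y ∈ monomialSpan k K T) :
    x * y ∈ monomialSpan k K U := by
  refine monomialSpan_induction (p := fun x => x * y ∈ monomialSpan k K U) (fun m hm => ?_)
    (by simp) (fun a b ha hb => by rw [add_mul]; exact add_mem ha hb)
    (fun c a ha => by rw [smul_mul_assoc]; exact Submodule.smul_mem _ c ha) hx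
  refine monomialSpan_induction (p := fun y => χ m * y ∈ monomialSpan k K U) (fun n hn => ?_)
    (by simp) (fun a b ha hb => by rw [mul_add]; exact add_mem ha hb)
    (fun c a ha => by rw [mul_smul_comm]; exact Submodule.smul_mem _ c ha) hy
  rw [← laurentMonomial_add]
  exact laurentMonomial_mem_monomialSpan (h m hm n hn)

theorem mem_monomialSpan_iff {S : Set (ℤ × ℤ)} {x : K} :
    x ∈ monomialSpan k K S ↔ ∃ f : ℤ × ℤ →₀ k, (f.support : Set (ℤ × ℤ)) ⊆ S ∧
      Finsupp.linearCombination k χ f = x := by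
  rw [monomialSpan, Finsupp.mem_span_image_iff_linearCombination]
  rfl

theorem algebraMap_mem_monomialSpan (p : MvPolynomial (Fin 2) k) :
    algebraMap _ K p ∈ monomialSpan k K {m | 0 ≤ m.1 ∧ 0 ≤ m.2} := by
  induction p using MvPolynomial.induction_on' with
  | monomial s c =>
    have : MvPolynomial.monomial s c = c • MvPolynomial.monomial s (1 : k) := by
      simp [MvPolynomial.smul_monomial]
    rw [this, ← IsScalarTower.coe_toAlgHom' k, map_smul, IsScalarTower.coe_toAlgHom',
      ← laurentMonomial_natCast]
    exact Submodule.smul_mem _ _ (laurentMonomial_mem_monomialSpan (by simp))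
  | add p q hp hq => rw [map_add]; exact add_mem hp hq

theorem exists_div_monomialSpan (k : Type*) {K : Type*} [Field k] [Field K] [Algebra k K]
    [Algebra (MvPolynomial (Fin 2) k) K] [IsScalarTower k (MvPolynomial (Fin 2) k) K]
    [IsFractionRing (MvPolynomial (Fin 2) k) K] (x : K) :
    ∃ g ∈ monomialSpan k K Set.univ, ∃ h ∈ monomialSpan k K Set.univ, h ≠ 0 ∧ x = g / h := by
  obtain ⟨p, q, hq, rfl⟩ := IsFractionRing.div_surjective (A := MvPolynomial (Fin 2) k) x
  exact ⟨_, monomialSpan_mono (Set.subset_univ _) (algebraMap_mem_monomialSpan p), _,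
    monomialSpan_mono (Set.subset_univ _) (algebraMap_mem_monomialSpan q), by
    rw [Ne, FaithfulSMul.algebraMap_eq_zero_iff]; exact nonZeroDivisors.ne_zero hq, rfl⟩

end Monomials

/-! ### Monomial valuations, through substitution into Hahn series. -/

section Valuation

theorem pairing_add_left (m n w : ℤ × ℤ) : pairing (m + n) w = pairing m w + pairing n w := by
  simp only [pairing, Prod.fst_add, Prod.snd_add]; ring

theorem single_zpow (a n : ℤ) (r : K) :
    HahnSeries.single a r ^ n = HahnSeries.single (n * a) (r ^ n) := by
  cases n with
  | ofNat n => simp [HahnSeries.single_pow]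
  | negSucc n =>
    rw [zpow_negSucc, zpow_negSucc, HahnSeries.single_pow, HahnSeries.inv_single]
    congr 1
    rw [Int.negSucc_eq, nsmul_eq_mul, neg_mul]
    simp

theorem coeff_sum_single {ι : Type*} (s : Finset ι) (e : ι → ℤ) (c : ι → K) (j : ℤ) :
    (∑ i ∈ s, HahnSeries.single (e i) (c i)).coeff j = ∑ i ∈ s with e i = j, c i := by
  rw [HahnSeries.coeff_sum, Finset.sum_filter]
  refine Finset.sum_congr rfl fun i _ => ?_
  split_ifs with h
  · rw [← h, HahnSeries.coeff_single_same]
  · exact HahnSeries.coeff_single_of_ne (Ne.symm h)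

/-- The homomorphism `f ↦ f (t ^ w₁ x, t ^ w₂ y)` on polynomials. -/
def weightMap (k K : Type*) [Field k] [Field K] [Algebra k K] [Algebra (MvPolynomial (Fin 2) k) K]
    (w : ℤ × ℤ) : MvPolynomial (Fin 2) k →+* HahnSeries ℤ K :=
  MvPolynomial.eval₂Hom (HahnSeries.C.comp (algebraMap k K))
    ![HahnSeries.single w.1 (algebraMap (MvPolynomial (Fin 2) k) K (MvPolynomial.X 0)),
      HahnSeries.single w.2 (algebraMap (MvPolynomial (Fin 2) k) K (MvPolynomial.X 1))]

theorem weightMap_monomial (w : ℤ × ℤ) (s : Fin 2 →₀ ℕ) (c : k) :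
    weightMap k K w (MvPolynomial.monomial s c) =
      HahnSeries.single (pairing ((s 0 : ℤ), (s 1 : ℤ)) w) (c • χ ((s 0 : ℤ), (s 1 : ℤ))) := by
  rw [weightMap, MvPolynomial.coe_eval₂Hom, MvPolynomial.eval₂_monomial,
    Finsupp.prod_fintype _ _ (by simp)]
  simp only [Fin.prod_univ_two, Matrix.cons_val_zero, Matrix.cons_val_one, RingHom.comp_apply,
    HahnSeries.single_pow, HahnSeries.single_mul_single, HahnSeries.C_apply]
  simp [pairing, laurentMonomial, Algebra.smul_def]

/-- The coefficient of each power of `t` is a partial sum of distinct monomials of the polynomial,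
so it vanishes only if all of them have coefficient zero. -/
theorem weightMap_injective (w : ℤ × ℤ) : Function.Injective (weightMap k K w) := by
  rw [injective_iff_map_eq_zero]
  intro p hp
  ext s
  rw [MvPolynomial.coeff_zero]
  by_contra hs
  rw [p.as_sum, map_sum, Finset.sum_congr rfl fun s _ => weightMap_monomial w s _] at hp
  have h := coeff_sum_single p.support (fun x => pairing ((x 0 : ℤ), (x 1 : ℤ)) w)
    (fun x => MvPolynomial.coeff x p • χ ((x 0 : ℤ), (x 1 : ℤ))) (pairing ((s 0 : ℤ), (s 1 : ℤ)) w)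
  rw [hp, HahnSeries.coeff_zero] at h
  exact hs (linearIndependent_iff'.mp (linearIndependent_laurentMonomial_natCast (K := K)) _
    (fun x => MvPolynomial.coeff x p) h.symm s
    (Finset.mem_filter.mpr ⟨MvPolynomial.mem_support_iff.mpr hs, rfl⟩))

/-- The embedding `f ↦ f (t ^ w₁ x, t ^ w₂ y)` of the function field into a field of series. -/
def weightEmbedding (k : Type*) {K : Type*} [Field k] [Field K] [Algebra k K]
    [Algebra (MvPolynomial (Fin 2) k) K] [IsScalarTower k (MvPolynomial (Fin 2) k) K]
    [IsFractionRing (MvPolynomial (Fin 2) k) K] (w : ℤ × ℤ) : K →+* HahnSeries ℤ K :=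
  IsFractionRing.lift (g := weightMap k K w) (weightMap_injective w)

theorem weightEmbedding_algebraMap (w : ℤ × ℤ) (p : MvPolynomial (Fin 2) k) :
    weightEmbedding k w (algebraMap _ K p) = weightMap k K w p :=
  IsFractionRing.lift_algebraMap _ p

theorem weightEmbedding_laurentMonomial (w m : ℤ × ℤ) :
    weightEmbedding k w (χ m) = HahnSeries.single (pairing m w) (χ m) := by
  have h0 : weightEmbedding k w (algebraMap (MvPolynomial (Fin 2) k) K (MvPolynomial.X 0)) =
      HahnSeries.single w.1 (algebraMap (MvPolynomial (Fin 2) k) K (MvPolynomial.X 0)) := by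
    rw [weightEmbedding_algebraMap, weightMap, MvPolynomial.eval₂Hom_X']; rfl
  have h1 : weightEmbedding k w (algebraMap (MvPolynomial (Fin 2) k) K (MvPolynomial.X 1)) =
      HahnSeries.single w.2 (algebraMap (MvPolynomial (Fin 2) k) K (MvPolynomial.X 1)) := by
    rw [weightEmbedding_algebraMap, weightMap, MvPolynomial.eval₂Hom_X']; rfl
  rw [laurentMonomial, map_mul, map_zpow₀, map_zpow₀, h0, h1, single_zpow, single_zpow,
    HahnSeries.single_mul_single]
  simp [pairing]

theorem weightEmbedding_smul (w : ℤ × ℤ) (c : k) (x : K) :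
    weightEmbedding k w (c • x) = algebraMap k K c • weightEmbedding k w x := by
  rw [Algebra.smul_def, map_mul, IsScalarTower.algebraMap_apply k (MvPolynomial (Fin 2) k) K,
    weightEmbedding_algebraMap, MvPolynomial.algebraMap_eq, weightMap, MvPolynomial.eval₂Hom_C,
    RingHom.comp_apply, HahnSeries.C_mul_eq_smul, ← MvPolynomial.algebraMap_eq,
    ← IsScalarTower.algebraMap_apply]

/-- The monomial valuation of weight `w`, with value `pairing m w` on the monomial of exponent
`m`. -/
def weightVal (k : Type*) {K : Type*} [Field k] [Field K] [Algebra k K]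
    [Algebra (MvPolynomial (Fin 2) k) K] [IsScalarTower k (MvPolynomial (Fin 2) k) K]
    [IsFractionRing (MvPolynomial (Fin 2) k) K] (w : ℤ × ℤ) : AddValuation K (WithTop ℤ) :=
  (HahnSeries.addVal ℤ K).comap (weightEmbedding k w)

theorem weightVal_apply (w : ℤ × ℤ) (x : K) :
    weightVal k w x = (weightEmbedding k w x).orderTop := rfl

theorem weightVal_laurentMonomial (w m : ℤ × ℤ) : weightVal k w (χ m) = (pairing m w : ℤ) := by
  rw [weightVal_apply, weightEmbedding_laurentMonomial,
    HahnSeries.orderTop_single (laurentMonomial_ne_zero m)]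

theorem weightVal_smul_ge (w : ℤ × ℤ) (c : k) (x : K) : weightVal k w x ≤ weightVal k w (c • x) := by
  rw [weightVal_apply, weightVal_apply, weightEmbedding_smul]
  exact HahnSeries.orderTop_le_orderTop_smul (algebraMap k K c) (weightEmbedding k w x)

theorem le_weightVal {w : ℤ × ℤ} {j : ℤ} {S : Set (ℤ × ℤ)} (hS : ∀ m ∈ S, j ≤ pairing m w) {x : K}
    (hx : x ∈ monomialSpan k K S) : (j : WithTop ℤ) ≤ weightVal k w x := by
  refine monomialSpan_induction (p := fun x => (j : WithTop ℤ) ≤ weightVal k w x) (fun m hm => ?_)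
    (by simp) (fun x y hx hy => le_trans (le_min hx hy) (AddValuation.map_add _ _ _))
    (fun c x hx => hx.trans (weightVal_smul_ge w c x)) hx
  rw [weightVal_laurentMonomial]
  exact_mod_cast hS m hm

/-- Monomials do not cancel under the substitution: the coefficient of each power of `t` is again a
combination of independent monomials. So the valuation of a Laurent polynomial is the minimum over
its exponents, and a bound on it bounds every exponent separately. -/
theorem mem_monomialSpan_of_le_weightVal {w : ℤ × ℤ} {j : ℤ} {S : Set (ℤ × ℤ)} {x : K}
    (hx : x ∈ monomialSpan k K S) (hj : (j : WithTop ℤ) ≤ weightVal k w x) :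
    x ∈ monomialSpan k K {m | m ∈ S ∧ j ≤ pairing m w} := by
  obtain ⟨f, hf, rfl⟩ := mem_monomialSpan_iff.mp hx
  refine mem_monomialSpan_iff.mpr ⟨f, fun m hm => ⟨hf hm, ?_⟩, rfl⟩
  by_contra hlt
  rw [weightVal_apply] at hj
  have h := HahnSeries.coeff_eq_zero_of_lt_orderTop (i := pairing m w)
    (lt_of_lt_of_le (by exact_mod_cast not_le.mp hlt) hj)
  have hsum : weightEmbedding k w (Finsupp.linearCombination k χ f) =
      ∑ x ∈ f.support, HahnSeries.single (pairing x w) (f x • χ x) := by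
    rw [Finsupp.linearCombination_apply, Finsupp.sum, map_sum]
    refine Finset.sum_congr rfl fun x _ => ?_
    rw [weightEmbedding_smul, weightEmbedding_laurentMonomial, ← HahnSeries.C_mul_eq_smul,
      HahnSeries.C_apply, HahnSeries.single_mul_single, zero_add, Algebra.smul_def]
  rw [hsum, coeff_sum_single] at h
  exact Finsupp.mem_support_iff.mp hm (linearIndependent_iff'.mp
    (linearIndependent_laurentMonomial (K := K)) _ f h m (Finset.mem_filter.mpr ⟨hm, rfl⟩))

theorem weightVal_eq_top_iff {w : ℤ × ℤ} {x : K} : weightVal k w x = ⊤ ↔ x = 0 :=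
  AddValuation.top_iff _

theorem exists_weightVal_eq {w : ℤ × ℤ} {x : K} (hx : x ≠ 0) : ∃ n : ℤ, weightVal k w x = n := by
  have := WithTop.ne_top_iff_exists.mp (mt (weightVal_eq_top_iff (k := k) (w := w)).mp hx)
  obtain ⟨n, hn⟩ := this
  exact ⟨n, hn.symm⟩

theorem weightVal_inv {w : ℤ × ℤ} {x : K} {n : ℤ} (hn : weightVal k w x = n) :
    weightVal k w x⁻¹ = (-n : ℤ) := by
  have hx : x ≠ 0 := by
    rintro rfl
    simp at hn
  obtain ⟨j, hj⟩ := exists_weightVal_eq (k := k) (w := w) (inv_ne_zero hx)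
  have h := AddValuation.map_mul (weightVal k w) x x⁻¹
  rw [mul_inv_cancel₀ hx, AddValuation.map_one, hn, hj] at h
  have h : (0 : ℤ) = n + j := by exact_mod_cast h
  rw [hj]
  congr 1
  lia

theorem weightVal_mul {w : ℤ × ℤ} {x y : K} {m n : ℤ} (hm : weightVal k w x = m)
    (hn : weightVal k w y = n) : weightVal k w (x * y) = (m + n : ℤ) := by
  rw [AddValuation.map_mul, hm, hn]; rfl

end Valuation

end ToricSurface

end

noncomputable section

namespace ToricSurface

open IsLocalRing

/-! ### Local subrings of a field, points of affine models, and orders. -/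

section LocalSubrings

variable {K : Type*} [Field K]

theorem mem_ofPrime_iff {A : Subring K} {p : Ideal A} [p.IsPrime] {x : K} :
    x ∈ (LocalSubring.ofPrime A p).toSubring ↔ ∃ g h : A, h ∉ p ∧ x = g / h := by
  constructor
  · intro hx
    obtain ⟨⟨g, h⟩, hgh⟩ := IsLocalization.surj p.primeCompl
      (⟨x, hx⟩ : (LocalSubring.ofPrime A p).toSubring)
    refine ⟨g, h, h.2, ?_⟩
    have h0 : ((h : A) : K) ≠ 0 := fun h0 => h.2 (by
      have : (h : A) = 0 := Subtype.ext h0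
      rw [this]
      exact p.zero_mem)
    rw [eq_div_iff h0]
    exact congrArg (fun z : (LocalSubring.ofPrime A p).toSubring => (z : K)) hgh
  · rintro ⟨g, h, hh, rfl⟩
    have hu := IsLocalization.map_units (LocalSubring.ofPrime A p).toSubring
      (⟨h, hh⟩ : p.primeCompl)
    obtain ⟨w, hw⟩ := hu
    have hw' : ((w : (LocalSubring.ofPrime A p).toSubring) : K) = h :=
      congrArg (fun z : (LocalSubring.ofPrime A p).toSubring => (z : K)) hw
    have hinv : ((w⁻¹ : (LocalSubring.ofPrime A p).toSubringˣ) :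
        (LocalSubring.ofPrime A p).toSubring).1 = (h : K)⁻¹ := by
      rw [← hw']
      apply eq_inv_of_mul_eq_one_left
      exact congrArg (fun z : (LocalSubring.ofPrime A p).toSubring => (z : K)) w.inv_mul
    rw [div_eq_mul_inv, ← hinv]
    exact mul_mem (LocalSubring.le_ofPrime A p g.2) (Subtype.property _)

theorem isUnit_iff_inv_mem {A : Subring K} {x : A} :
    IsUnit x ↔ (x : K) ≠ 0 ∧ (x : K)⁻¹ ∈ A := by
  constructor
  · rintro ⟨u, rfl⟩
    have h : ((u : A) : K) * ((u⁻¹ : Aˣ) : A) = 1 :=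
      congrArg (fun z : A => (z : K)) u.mul_inv
    refine ⟨left_ne_zero_of_mul_eq_one h, ?_⟩
    rw [← eq_inv_of_mul_eq_one_right h]
    exact Subtype.property _
  · rintro ⟨h0, h⟩
    exact IsUnit.of_mul_eq_one ⟨_, h⟩ (Subtype.ext (mul_inv_cancel₀ h0))

theorem mem_maximalIdeal_iff {P : LocalSubring K} {x : P.toSubring} :
    x ∈ maximalIdeal P.toSubring ↔ (x : K) = 0 ∨ (x : K)⁻¹ ∉ P.toSubring := by
  rw [mem_maximalIdeal, mem_nonunits_iff, isUnit_iff_inv_mem]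
  tauto

/-- The prime can only be the trace on `A` of the maximal ideal of `P`. Eliminating it leaves a
criterion in terms of fractions, which is the form in which membership in a chart is checked. -/
theorem mem_specModel_iff {A : Subring K} {P : LocalSubring K} :
    P ∈ specModel A ↔ A ≤ P.toSubring ∧ ∀ x ∈ P.toSubring, ∃ g ∈ A, ∃ h ∈ A,
      h ≠ 0 ∧ h⁻¹ ∈ P.toSubring ∧ x = g / h := by
  constructor
  · rintro ⟨p, hp, rfl⟩
    refine ⟨LocalSubring.le_ofPrime A p, fun x hx => ?_⟩
    obtain ⟨g, h, hh, rfl⟩ := mem_ofPrime_iff.mp hx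
    refine ⟨g, g.2, h, h.2, fun h0 => hh ?_, mem_ofPrime_iff.mpr ⟨1, h, hh, by simp⟩, rfl⟩
    rw [show h = 0 from Subtype.ext h0]
    exact p.zero_mem
  · rintro ⟨hA, hP⟩
    refine ⟨(maximalIdeal P.toSubring).comap (Subring.inclusion hA), inferInstance,
      LocalSubring.toSubring_injective (SetLike.ext fun x => ?_)⟩
    rw [mem_ofPrime_iff]
    constructor
    · intro hx
      obtain ⟨g, hg, h, hh, h0, hinv, rfl⟩ := hP x hx
      refine ⟨⟨g, hg⟩, ⟨h, hh⟩, ?_, rfl⟩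
      rw [Ideal.mem_comap, mem_maximalIdeal_iff]
      simpa [h0] using! hinv
    · rintro ⟨g, h, hh, rfl⟩
      rw [Ideal.mem_comap, mem_maximalIdeal_iff] at hh
      push Not at hh
      rw [div_eq_mul_inv]
      exact mul_mem (hA g.2) hh.2

theorem le_of_mem_specModel {A : Subring K} {P Q : LocalSubring K} (hP : P ∈ specModel A)
    (hA : A ≤ Q.toSubring) (h : ∀ x ∈ A, x ≠ 0 → x⁻¹ ∈ P.toSubring → x⁻¹ ∈ Q.toSubring) :
    P.toSubring ≤ Q.toSubring := by
  intro x hx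
  obtain ⟨g, hg, y, hy, h0, hinv, rfl⟩ := (mem_specModel_iff.mp hP).2 x hx
  rw [div_eq_mul_inv]
  exact mul_mem (hA hg) (h y hy h0 hinv)

theorem dvr_ne_top {P : LocalSubring K} [IsDiscreteValuationRing P.toSubring] :
    P.toSubring ≠ ⊤ := by
  intro h
  obtain ⟨ϖ, hϖ⟩ := IsDiscreteValuationRing.exists_irreducible P.toSubring
  refine hϖ.not_isUnit (isUnit_iff_inv_mem.mpr ⟨fun h0 => hϖ.ne_zero (Subtype.ext h0), ?_⟩)
  exact (SetLike.ext_iff.mp h _).mpr trivial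

theorem exists_unit_mul_zpow {P : LocalSubring K} [IsDiscreteValuationRing P.toSubring]
    {ϖ : P.toSubring} (hϖ : Irreducible ϖ) {x : K} (hx : x ∈ P.toSubring) (h0 : x ≠ 0) :
    ∃ (n : ℕ) (u : P.toSubring), IsUnit u ∧ x = u * (ϖ : K) ^ n := by
  obtain ⟨n, u, hu⟩ := IsDiscreteValuationRing.eq_unit_mul_pow_irreducible
    (x := (⟨x, hx⟩ : P.toSubring)) (fun h => h0 (congrArg Subtype.val h)) hϖ
  exact ⟨n, u, u.isUnit, congrArg (fun z : P.toSubring => (z : K)) hu⟩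

/-- The function field is the field of fractions of the local ring `P`. -/
def HasFractions (P : LocalSubring K) : Prop :=
  ∀ x : K, ∃ g ∈ P.toSubring, ∃ h ∈ P.toSubring, h ≠ 0 ∧ x = g / h

theorem HasFractions.exists_hasOrd {P : LocalSubring K} [IsDiscreteValuationRing P.toSubring]
    (hP : HasFractions P) {x : K} (hx : x ≠ 0) : ∃ n, HasOrd P x n := by
  obtain ⟨ϖ, hϖ⟩ := IsDiscreteValuationRing.exists_irreducible P.toSubring
  obtain ⟨g, hg, h, hh, h0, rfl⟩ := hP x
  have hg0 : g ≠ 0 := by rintro rfl; simp at hx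
  obtain ⟨m, u, hu, hgu⟩ := exists_unit_mul_zpow hϖ hg hg0
  obtain ⟨n, v, hv, hhv⟩ := exists_unit_mul_zpow hϖ hh h0
  have h1 : HasOrd P g m := ⟨ϖ, u, hϖ, hu, by rw [hgu]; simp⟩
  have h2 : HasOrd P h n := ⟨ϖ, v, hϖ, hv, by rw [hhv]; simp⟩
  exact ⟨_, by rw [div_eq_mul_inv]; exact h1.mul h2.inv⟩

/-- A discrete valuation ring is a maximal proper subring of its fraction field: an element outside
it has negative order, so adjoining it makes the uniformizer invertible. This identifies a divisor
from a mere inclusion of local rings. -/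
theorem eq_of_dvr_le {P Q : LocalSubring K} [IsDiscreteValuationRing P.toSubring]
    (hfrac : HasFractions P) (hPQ : P.toSubring ≤ Q.toSubring) (hQ : Q.toSubring ≠ ⊤) :
    P = Q := by
  refine LocalSubring.toSubring_injective (le_antisymm hPQ fun x hx => ?_)
  by_contra hxP
  have h0 : x ≠ 0 := by rintro rfl; exact hxP (zero_mem _)
  obtain ⟨n, ϖ, u, hϖ, hu, rfl⟩ := hfrac.exists_hasOrd h0
  obtain ⟨hu0, huinv⟩ := isUnit_iff_inv_mem.mp hu
  have hϖ0 : (ϖ : K) ≠ 0 := fun h => hϖ.ne_zero (Subtype.ext h)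
  have hn : n < 0 := by
    by_contra hn
    lift n to ℕ using not_lt.mp hn
    rw [zpow_natCast] at hxP
    exact hxP (mul_mem u.2 (pow_mem ϖ.2 n))
  obtain ⟨j, rfl⟩ : ∃ j : ℕ, n = -((j : ℤ) + 1) := ⟨(-n - 1).toNat, by lia⟩
  have hinv : (ϖ : K)⁻¹ ∈ Q.toSubring := by
    have h1 : (ϖ : K)⁻¹ = (u : K)⁻¹ * (ϖ : K) ^ j * (u * (ϖ : K) ^ (-((j : ℤ) + 1))) := by
      rw [zpow_neg, zpow_add₀ hϖ0, zpow_natCast, zpow_one]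
      field_simp
    rw [h1]
    exact mul_mem (hPQ (mul_mem huinv (pow_mem ϖ.2 j))) hx
  apply hQ
  rw [eq_top_iff]
  intro y _
  by_cases hy : y = 0
  · rw [hy]; exact zero_mem _
  obtain ⟨i, ϖ', v, hϖ', hv, rfl⟩ := hfrac.exists_hasOrd hy
  obtain ⟨w, hw⟩ := IsDiscreteValuationRing.associated_of_irreducible _ hϖ hϖ'
  have hinv' : (ϖ' : K)⁻¹ ∈ Q.toSubring := by
    rw [← hw]
    push_cast
    rw [mul_inv]
    exact mul_mem hinv (hPQ (isUnit_iff_inv_mem.mp w.isUnit).2)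
  refine mul_mem (hPQ v.2) ?_
  cases i with
  | ofNat i => simpa using! pow_mem (hPQ ϖ'.2) i
  | negSucc i =>
    rw [zpow_negSucc, ← inv_pow]
    exact pow_mem hinv' _

theorem hasOrd_zero_of_unit {P : LocalSubring K} [IsDiscreteValuationRing P.toSubring] {x : K}
    (h0 : x ≠ 0) (hx : x ∈ P.toSubring) (hinv : x⁻¹ ∈ P.toSubring) : HasOrd P x 0 := by
  obtain ⟨ϖ, hϖ⟩ := IsDiscreteValuationRing.exists_irreducible P.toSubring
  exact ⟨ϖ, ⟨x, hx⟩, hϖ, isUnit_iff_inv_mem.mpr ⟨h0, hinv⟩, by simp⟩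

theorem hasOrd_one_eq_zero {P : LocalSubring K} {n : ℤ} (h : HasOrd P 1 n) : n = 0 := by
  obtain ⟨ϖ, u, hϖ, hu, h1⟩ := h
  by_contra hn
  have hϖ0 : (ϖ : K) ≠ 0 := fun h => hϖ.ne_zero (Subtype.ext h)
  obtain ⟨hu0, huinv⟩ := isUnit_iff_inv_mem.mp hu
  have hpow : (ϖ : K) ^ n = (u : K)⁻¹ := eq_inv_of_mul_eq_one_right h1.symm
  apply hϖ.not_isUnit
  refine isUnit_iff_inv_mem.mpr ⟨hϖ0, ?_⟩
  rcases lt_or_gt_of_ne hn with hlt | hgt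
  · obtain ⟨j, rfl⟩ : ∃ j : ℕ, n = -((j : ℤ) + 1) := ⟨(-n - 1).toNat, by lia⟩
    have h2 : (ϖ : K)⁻¹ = (ϖ : K) ^ (-((j : ℤ) + 1)) * (ϖ : K) ^ j := by
      rw [zpow_neg, zpow_add₀ hϖ0, zpow_natCast, zpow_one]
      field_simp
    rw [h2, hpow]
    exact mul_mem huinv (pow_mem ϖ.2 j)
  · obtain ⟨j, rfl⟩ : ∃ j : ℕ, n = (j : ℤ) + 1 := ⟨(n - 1).toNat, by lia⟩
    have h2 : (ϖ : K)⁻¹ = u * (ϖ : K) ^ j := by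
      rw [zpow_add₀ hϖ0, zpow_natCast, zpow_one] at h1
      rw [eq_comm]
      apply eq_inv_of_mul_eq_one_left
      rw [h1, mul_assoc]
    rw [h2]
    exact mul_mem u.2 (pow_mem ϖ.2 j)

theorem HasOrd.ne_zero {P : LocalSubring K} {x : K} {n : ℤ} (h : HasOrd P x n) : x ≠ 0 := by
  obtain ⟨ϖ, u, hϖ, hu, rfl⟩ := h
  exact mul_ne_zero (isUnit_iff_inv_mem.mp hu).1
    (zpow_ne_zero _ fun h => hϖ.ne_zero (Subtype.ext h))

theorem HasOrd.unique {P : LocalSubring K} [IsDiscreteValuationRing P.toSubring] {x : K} {m n : ℤ}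
    (hm : HasOrd P x m) (hn : HasOrd P x n) : m = n := by
  have h := hm.mul hn.inv
  rw [mul_inv_cancel₀ hm.ne_zero] at h
  linarith [hasOrd_one_eq_zero h]

theorem HasOrd.ordAt_eq {P : LocalSubring K} [IsDiscreteValuationRing P.toSubring] {x : K} {n : ℤ}
    (h : HasOrd P x n) : ordAt P x = n := by
  have hex : ∃ n, HasOrd P x n := ⟨n, h⟩
  rw [ordAt, dif_pos hex]
  exact hex.choose_spec.unique h

theorem isRegularLocalRing_of_mem_specModel {A : Subring K} [IsRegularRing A] {P : LocalSubring K}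
    (hP : P ∈ specModel A) : IsRegularLocalRing P.toSubring := by
  obtain ⟨p, hp, rfl⟩ := hP
  exact IsRegularLocalRing.of_ringEquiv (LocalSubring.ofPrimeEquiv A p).toRingEquiv

end LocalSubrings

end ToricSurface

end

noncomputable section

namespace ToricSurface

open IsLocalRing

/-! ### Lattice vectors, determinants and dual cones. -/

section Lattice

/-- The exponent `m` with `pairing m x = det u x`. -/
def perp (u : ℤ × ℤ) : ℤ × ℤ := (-u.2, u.1)

theorem pairing_perp (u x : ℤ × ℤ) : pairing (perp u) x = det u x := by
  simp only [pairing, perp, det]; ring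

theorem pairing_neg_perp (u x : ℤ × ℤ) : pairing (-perp u) x = det x u := by
  simp only [pairing, perp, det, Prod.fst_neg, Prod.snd_neg]; ring

theorem pairing_neg_left (m x : ℤ × ℤ) : pairing (-m) x = -pairing m x := by
  simp only [pairing, Prod.fst_neg, Prod.snd_neg]; ring

theorem pairing_nsmul_left (n : ℕ) (m x : ℤ × ℤ) : pairing (n • m) x = n * pairing m x := by
  simp only [pairing, nsmul_eq_mul, Prod.fst_mul, Prod.snd_mul,
    Prod.fst_natCast, Prod.snd_natCast]; ring

theorem pairing_zsmul_left (n : ℤ) (m x : ℤ × ℤ) : pairing (n • m) x = n * pairing m x := by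
  simp only [pairing, Prod.smul_fst, Prod.smul_snd, smul_eq_mul]; ring

theorem pairing_add_right (m u v : ℤ × ℤ) : pairing m (u + v) = pairing m u + pairing m v := by
  simp only [pairing, Prod.fst_add, Prod.snd_add]; ring

theorem pairing_zero_left (u : ℤ × ℤ) : pairing 0 u = 0 := by simp [pairing]

theorem det_self (u : ℤ × ℤ) : det u u = 0 := by simp only [det]; ring

theorem det_swap (u v : ℤ × ℤ) : det v u = -det u v := by simp only [det]; ring

theorem exists_pairing_eq_one {u : ℤ × ℤ} (hu : IsCoprime u.1 u.2) : ∃ m, pairing m u = 1 := by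
  obtain ⟨a, b, h⟩ := hu
  exact ⟨(a, b), h⟩

theorem eq_zero_of_pairing_eq_zero {m u v : ℤ × ℤ} (huv : det u v ≠ 0) (hu : pairing m u = 0)
    (hv : pairing m v = 0) : m = 0 := by
  have h1 : m.1 * det u v = 0 := by
    have : m.1 * det u v = v.2 * pairing m u - u.2 * pairing m v := by
      simp only [det, pairing]; ring
    rw [this, hu, hv]; ring
  have h2 : m.2 * det u v = 0 := by
    have : m.2 * det u v = u.1 * pairing m v - v.1 * pairing m u := by
      simp only [det, pairing]; ring
    rw [this, hu, hv]; ring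
  exact Prod.ext ((mul_eq_zero.mp h1).resolve_right huv) ((mul_eq_zero.mp h2).resolve_right huv)

theorem eq_smul_of_det_eq_zero {m u w : ℤ × ℤ} (hm : pairing m u = 1) (h : det u w = 0) :
    w = pairing m w • u := by
  have h1 : w.1 = pairing m w * u.1 := by
    have : w.1 * pairing m u - pairing m w * u.1 = -m.2 * det u w := by
      simp only [det, pairing]; ring
    rw [hm, h] at this; linarith
  have h2 : w.2 = pairing m w * u.2 := by
    have : w.2 * pairing m u - pairing m w * u.2 = m.1 * det u w := by
      simp only [det, pairing]; ring
    rw [hm, h] at this; linarith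
  exact Prod.ext h1 h2

theorem eq_or_eq_neg_of_det_eq_zero {u w : ℤ × ℤ} (hu : IsCoprime u.1 u.2)
    (hw : IsCoprime w.1 w.2) (h : det u w = 0) : w = u ∨ w = -u := by
  obtain ⟨m, hm⟩ := exists_pairing_eq_one hu
  obtain ⟨n, hn⟩ := exists_pairing_eq_one hw
  have hwu := eq_smul_of_det_eq_zero hm h
  have h1 : pairing m w * pairing n u = 1 := by
    rw [hwu] at hn
    rw [← hn]
    simp only [pairing, Prod.smul_fst, Prod.smul_snd, smul_eq_mul]; ring
  rcases Int.isUnit_iff.mp (IsUnit.of_mul_eq_one _ h1) with h | h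
  · left; rw [hwu, h, one_smul]
  · right; rw [hwu, h, neg_one_smul]

/-- The exponents of the monomials which are regular on the chart of the cone of `u` and `v`. -/
def dualCone (u v : ℤ × ℤ) : Set (ℤ × ℤ) := {m | 0 ≤ pairing m u ∧ 0 ≤ pairing m v}

theorem perp_mem_dualCone {u v : ℤ × ℤ} (h : 0 < det u v) : perp u ∈ dualCone u v := by
  simp [dualCone, pairing_perp, det_self, h.le]

theorem neg_perp_mem_dualCone {u v : ℤ × ℤ} (h : 0 < det u v) : -perp v ∈ dualCone u v := by
  simp [dualCone, pairing_neg_perp, det_self, h.le]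

theorem zero_mem_dualCone (u v : ℤ × ℤ) : 0 ∈ dualCone u v := by
  simp [dualCone, pairing_zero_left]

theorem add_mem_dualCone {u v m n : ℤ × ℤ} (hm : m ∈ dualCone u v) (hn : n ∈ dualCone u v) :
    m + n ∈ dualCone u v := by
  simp only [dualCone, Set.mem_ofPred_eq, pairing_add_left] at *
  omega

theorem pairing_add_pos {u v m : ℤ × ℤ} (huv : 0 < det u v) (hm : m ∈ dualCone u v)
    (h0 : m ≠ 0) : 1 ≤ pairing m (u + v) := by
  rw [pairing_add_right]
  by_contra h
  have h1 := hm.1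
  have h2 := hm.2
  exact h0 (eq_zero_of_pairing_eq_zero huv.ne' (by lia) (by lia))

theorem exists_nat_add_mul_nonneg (a : ℤ) {b : ℤ} (hb : 0 < b) :
    ∃ N : ℕ, ∀ n ≥ N, 0 ≤ a + (n : ℤ) * b := by
  refine ⟨a.natAbs, fun n hn => ?_⟩
  have h1 : -a ≤ (n : ℤ) := by lia
  nlinarith

end Lattice

variable {k K : Type*} [Field k] [Field K] [Algebra k K] [Algebra (MvPolynomial (Fin 2) k) K]
  [IsScalarTower k (MvPolynomial (Fin 2) k) K] [IsFractionRing (MvPolynomial (Fin 2) k) K]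

local notation "χ" => laurentMonomial k K

theorem laurentMonomial_mul_neg (m : ℤ × ℤ) : χ m * χ (-m) = 1 := by
  rw [laurentMonomial_neg, mul_inv_cancel₀ (laurentMonomial_ne_zero m)]

theorem mul_laurentMonomial_mem {S T : Set (ℤ × ℤ)} {n : ℤ × ℤ} (h : ∀ m ∈ S, m + n ∈ T) {x : K}
    (hx : x ∈ monomialSpan k K S) : x * χ n ∈ monomialSpan k K T :=
  mul_mem_monomialSpan (T := {n}) (by rintro m hm _ rfl; exact h m hm) hx
    (laurentMonomial_mem_monomialSpan rfl)

/-- The condition is asked for all large `i`, not for a single one, so that the finitely many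
monomials of `x`, and later a numerator and a denominator, can be cleared by one common power. -/
theorem exists_mul_laurentMonomial_mem {S T : Set (ℤ × ℤ)} {n : ℤ × ℤ}
    (h : ∀ m ∈ S, ∃ N : ℕ, ∀ i ≥ N, m + i • n ∈ T) {x : K} (hx : x ∈ monomialSpan k K S) :
    ∃ N : ℕ, ∀ i ≥ N, x * χ (i • n) ∈ monomialSpan k K T := by
  refine monomialSpan_induction
    (p := fun x => ∃ N : ℕ, ∀ i ≥ N, x * χ (i • n) ∈ monomialSpan k K T)
    (fun m hm => ?_) ⟨0, by simp⟩ ?_ ?_ hx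
  · obtain ⟨N, hN⟩ := h m hm
    refine ⟨N, fun i hi => ?_⟩
    rw [← laurentMonomial_add]
    exact laurentMonomial_mem_monomialSpan (hN i hi)
  · rintro x y ⟨M, hM⟩ ⟨N, hN⟩
    refine ⟨max M N, fun i hi => ?_⟩
    rw [add_mul]
    exact add_mem (hM i (le_of_max_le_left hi)) (hN i (le_of_max_le_right hi))
  · rintro c x ⟨N, hN⟩
    refine ⟨N, fun i hi => ?_⟩
    rw [smul_mul_assoc]
    exact Submodule.smul_mem _ c (hN i hi)

/-! ### The discrete valuation rings of primitive weights. -/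

section WeightRing

/-- The local ring of the monomial valuation of weight `w`; for primitive `w`, the local ring of
the invariant curve of the ray spanned by `w`. -/
def weightRing (k : Type*) {K : Type*} [Field k] [Field K] [Algebra k K]
    [Algebra (MvPolynomial (Fin 2) k) K] [IsScalarTower k (MvPolynomial (Fin 2) k) K]
    [IsFractionRing (MvPolynomial (Fin 2) k) K] (w : ℤ × ℤ) : LocalSubring K :=
  let A : Subring K :=
    { carrier := {x | 0 ≤ weightVal k w x}
      zero_mem' := by simp
      one_mem' := by simp
      add_mem' := fun {a b} ha hb => by
        rw [Set.mem_ofPred_eq] at *; exact le_trans (le_min ha hb) (AddValuation.map_add _ _ _)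
      mul_mem' := fun {a b} ha hb => by
        rw [Set.mem_ofPred_eq] at *; rw [AddValuation.map_mul]; exact add_nonneg ha hb
      neg_mem' := fun {a} ha => by rwa [Set.mem_ofPred_eq, AddValuation.map_neg] }
  { toSubring := A
    isLocalRing := by
      have hunit : ∀ x : A, weightVal k w (x : K) = 0 → IsUnit x := by
        intro x hx
        have h := weightVal_inv (n := 0) hx
        refine isUnit_iff_inv_mem.mpr ⟨fun h0 => ?_, ?_⟩
        · rw [h0, AddValuation.map_zero] at hx
          exact WithTop.top_ne_zero hx
        · change 0 ≤ weightVal k w _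
          rw [h]
          rfl
      refine IsLocalRing.of_isUnit_or_isUnit_one_sub_self fun x => ?_
      by_cases hx : weightVal k w (x : K) = 0
      · exact Or.inl (hunit x hx)
      · right
        apply hunit
        have hlt : weightVal k w (1 : K) < weightVal k w (x : K) := by
          rw [AddValuation.map_one]
          exact lt_of_le_of_ne x.2 (Ne.symm hx)
        have h := AddValuation.map_sub_eq_of_lt_left (weightVal k w) hlt
        rw [AddValuation.map_one] at h
        exact h }

theorem mem_weightRing {w : ℤ × ℤ} {x : K} :
    x ∈ (weightRing k w : LocalSubring K).toSubring ↔ 0 ≤ weightVal k w x :=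
  Set.mem_ofPred_eq ▸ Iff.rfl

theorem laurentMonomial_mem_weightRing {w m : ℤ × ℤ} :
    χ m ∈ (weightRing k w : LocalSubring K).toSubring ↔ 0 ≤ pairing m w := by
  rw [mem_weightRing, weightVal_laurentMonomial]
  exact_mod_cast Iff.rfl

theorem inv_mem_weightRing {w : ℤ × ℤ} {x : K} (h0 : x ≠ 0)
    (hx : x ∈ (weightRing k w : LocalSubring K).toSubring) :
    x⁻¹ ∈ (weightRing k w : LocalSubring K).toSubring ↔ weightVal k w x = 0 := by
  obtain ⟨n, hn⟩ := exists_weightVal_eq (k := k) (w := w) h0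
  rw [mem_weightRing, hn] at hx
  rw [mem_weightRing, weightVal_inv hn, hn]
  have hx' : 0 ≤ n := by exact_mod_cast hx
  constructor
  · intro h
    have : 0 ≤ -n := by exact_mod_cast h
    exact_mod_cast (by lia : n = 0)
  · intro h
    have : n = 0 := by exact_mod_cast h
    simp [this]

theorem isUnit_weightRing {w : ℤ × ℤ} {x : (weightRing k w : LocalSubring K).toSubring} :
    IsUnit x ↔ weightVal k w (x : K) = 0 := by
  rw [isUnit_iff_inv_mem]
  constructor
  · rintro ⟨h0, h⟩
    exact (inv_mem_weightRing h0 x.2).mp h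
  · intro h
    have h0 : (x : K) ≠ 0 := by
      intro h0
      rw [h0, AddValuation.map_zero] at h
      exact WithTop.top_ne_zero h
    exact ⟨h0, (inv_mem_weightRing h0 x.2).mpr h⟩

theorem weightVal_div_zpow {w m : ℤ × ℤ} (hm : pairing m w = 1) {x : K} {n : ℤ}
    (hn : weightVal k w x = n) : weightVal k w (x * χ (-(n • m))) = 0 := by
  rw [weightVal_mul hn (weightVal_laurentMonomial w _), pairing_neg_left, pairing_zsmul_left, hm]
  simp

theorem irreducible_laurentMonomial {w m : ℤ × ℤ} (hm : pairing m w = 1) :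
    Irreducible (⟨χ m, laurentMonomial_mem_weightRing.mpr (by lia)⟩ :
      (weightRing k w : LocalSubring K).toSubring) := by
  constructor
  · rw [isUnit_weightRing, weightVal_laurentMonomial, hm]
    exact one_ne_zero
  · intro a b hab
    have hab' : χ m = a * b := congrArg Subtype.val hab
    have h := weightVal_laurentMonomial (k := k) (K := K) w m
    have ha0 : (a : K) ≠ 0 := by
      intro h0; rw [h0, zero_mul] at hab'; exact laurentMonomial_ne_zero m hab'
    have hb0 : (b : K) ≠ 0 := by
      intro h0; rw [h0, mul_zero] at hab'; exact laurentMonomial_ne_zero m hab'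
    obtain ⟨i, hi⟩ := exists_weightVal_eq (k := k) (w := w) ha0
    obtain ⟨j, hj⟩ := exists_weightVal_eq (k := k) (w := w) hb0
    rw [hab', weightVal_mul hi hj, hm] at h
    have hij : i + j = 1 := by exact_mod_cast h
    have ha := mem_weightRing.mp a.2
    have hb := mem_weightRing.mp b.2
    rw [hi] at ha
    rw [hj] at hb
    have ha' : 0 ≤ i := by exact_mod_cast ha
    have hb' : 0 ≤ j := by exact_mod_cast hb
    rw [isUnit_weightRing, isUnit_weightRing, hi, hj]
    rcases (by lia : i = 0 ∨ j = 0) with h | h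
    · left; rw [h]; rfl
    · right; rw [h]; rfl

theorem weightRing_isDiscreteValuationRing {w : ℤ × ℤ} (hw : IsCoprime w.1 w.2) :
    IsDiscreteValuationRing (weightRing k w : LocalSubring K).toSubring := by
  obtain ⟨m, hm⟩ := exists_pairing_eq_one hw
  apply IsDiscreteValuationRing.ofHasUnitMulPowIrreducibleFactorization
  refine ⟨_, irreducible_laurentMonomial (k := k) (K := K) hm, fun {x} hx => ?_⟩
  have hx0 : (x : K) ≠ 0 := fun h => hx (Subtype.ext h)
  obtain ⟨n, hn⟩ := exists_weightVal_eq (k := k) (w := w) hx0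
  have hpos := mem_weightRing.mp x.2
  rw [hn] at hpos
  lift n to ℕ using (by exact_mod_cast hpos)
  have hu := weightVal_div_zpow hm hn
  have hmem : (x : K) * χ (-((n : ℤ) • m)) ∈ (weightRing k w : LocalSubring K).toSubring := by
    rw [mem_weightRing, hu]
  have hunit : IsUnit (⟨_, hmem⟩ : (weightRing k w : LocalSubring K).toSubring) :=
    isUnit_weightRing.mpr hu
  refine ⟨n, hunit.unit, Subtype.ext ?_⟩
  change χ m ^ n * ((x : K) * χ (-((n : ℤ) • m))) = x
  rw [natCast_zsmul, mul_left_comm, ← laurentMonomial_nsmul, laurentMonomial_mul_neg, mul_one]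

theorem hasOrd_weightRing {w : ℤ × ℤ} (hw : IsCoprime w.1 w.2) {x : K} {n : ℤ}
    (hn : weightVal k w x = n) : HasOrd (weightRing k w) x n := by
  obtain ⟨m, hm⟩ := exists_pairing_eq_one hw
  have hu := weightVal_div_zpow hm hn
  have hmem : x * χ (-(n • m)) ∈ (weightRing k w : LocalSubring K).toSubring := by
    rw [mem_weightRing, hu]
  refine ⟨_, ⟨_, hmem⟩, irreducible_laurentMonomial hm, isUnit_weightRing.mpr hu, ?_⟩
  change x = x * χ (-(n • m)) * χ m ^ n
  rw [← laurentMonomial_zsmul, mul_assoc, mul_comm (χ (-(n • m))), laurentMonomial_mul_neg,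
    mul_one]

theorem hasOrd_weightRing_laurentMonomial {w : ℤ × ℤ} (hw : IsCoprime w.1 w.2) (m : ℤ × ℤ) :
    HasOrd (weightRing k w) (χ m) (pairing m w) :=
  hasOrd_weightRing hw (weightVal_laurentMonomial w m)

/-- Testing on `perp u` and `-perp u` makes `w` collinear with `u`; testing on a monomial of value
one on `u` excludes `w = -u`. -/
theorem eq_of_weightRing_le {u w : ℤ × ℤ} (hu : IsCoprime u.1 u.2) (hw : IsCoprime w.1 w.2)
    (h : ∀ m, 0 ≤ pairing m u → 0 ≤ pairing m w) : w = u := by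
  have h1 := h (perp u) (by rw [pairing_perp, det_self])
  have h2 := h (-perp u) (by rw [pairing_neg_perp, det_self])
  rw [pairing_perp] at h1
  rw [pairing_neg_perp, det_swap] at h2
  rcases eq_or_eq_neg_of_det_eq_zero hu hw (by lia) with h' | h'
  · exact h'
  · obtain ⟨m, hm⟩ := exists_pairing_eq_one hu
    have h3 := h m (by lia)
    rw [h'] at h3
    simp only [pairing, Prod.fst_neg, Prod.snd_neg] at h3 hm
    lia

theorem weightRing_injective {u w : ℤ × ℤ} (hu : IsCoprime u.1 u.2) (hw : IsCoprime w.1 w.2)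
    (h : (weightRing k u : LocalSubring K) = weightRing k w) : w = u :=
  eq_of_weightRing_le hu hw fun m hm => by
    rw [← laurentMonomial_mem_weightRing (k := k) (K := K), ← h]
    exact laurentMonomial_mem_weightRing.mpr hm

end WeightRing

end ToricSurface

end

noncomputable section

namespace ToricSurface

open IsLocalRing

variable {k K : Type*} [Field k] [Field K] [Algebra k K] [Algebra (MvPolynomial (Fin 2) k) K]
  [IsScalarTower k (MvPolynomial (Fin 2) k) K] [IsFractionRing (MvPolynomial (Fin 2) k) K]

local notation "χ" => laurentMonomial k K

/-! ### Affine charts and their points. -/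

section Chart

/-- The coordinate ring of the chart of the cone of `u` and `v`. -/
def chartSubring (k K : Type*) [Field k] [Field K] [Algebra k K]
    [Algebra (MvPolynomial (Fin 2) k) K] [IsScalarTower k (MvPolynomial (Fin 2) k) K]
    [IsFractionRing (MvPolynomial (Fin 2) k) K] (u v : ℤ × ℤ) : Subring K where
  carrier := monomialSpan k K (dualCone u v)
  zero_mem' := zero_mem _
  one_mem' := by
    rw [← laurentMonomial_zero (k := k)]
    exact laurentMonomial_mem_monomialSpan (zero_mem_dualCone u v)
  add_mem' := add_mem
  neg_mem' := neg_mem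
  mul_mem' := mul_mem_monomialSpan fun _ hm _ hn => add_mem_dualCone hm hn

theorem laurentMonomial_mem_chartSubring {u v m : ℤ × ℤ} (hm : m ∈ dualCone u v) :
    χ m ∈ chartSubring k K u v :=
  laurentMonomial_mem_monomialSpan hm

theorem algebraMap_mem_chartSubring (u v : ℤ × ℤ) (c : k) :
    algebraMap k K c ∈ chartSubring k K u v := by
  rw [Algebra.algebraMap_eq_smul_one, ← laurentMonomial_zero (k := k)]
  exact Submodule.smul_mem _ _ (laurentMonomial_mem_monomialSpan (zero_mem_dualCone u v))

theorem chartSubring_le_weightRing {u v w : ℤ × ℤ} (hw : ∀ m ∈ dualCone u v, 0 ≤ pairing m w) :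
    chartSubring k K u v ≤ (weightRing k w : LocalSubring K).toSubring :=
  fun _ hx => mem_weightRing.mpr (le_weightVal hw hx)

theorem det_nonneg_of_chartSubring_le {u v w : ℤ × ℤ} (huv : 0 < det u v)
    (h : chartSubring k K u v ≤ (weightRing k w : LocalSubring K).toSubring) :
    0 ≤ det u w ∧ 0 ≤ det w v := by
  have h1 := laurentMonomial_mem_weightRing.mp
    (h (laurentMonomial_mem_chartSubring (perp_mem_dualCone huv)))
  have h2 := laurentMonomial_mem_weightRing.mp
    (h (laurentMonomial_mem_chartSubring (neg_perp_mem_dualCone huv)))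
  rw [pairing_perp] at h1
  rw [pairing_neg_perp] at h2
  exact ⟨h1, h2⟩

theorem pairing_left_nonneg {u v : ℤ × ℤ} : ∀ m ∈ dualCone u v, 0 ≤ pairing m u :=
  fun _ hm => hm.1

theorem pairing_right_nonneg {u v : ℤ × ℤ} : ∀ m ∈ dualCone u v, 0 ≤ pairing m v :=
  fun _ hm => hm.2

theorem pairing_add_nonneg {u v : ℤ × ℤ} : ∀ m ∈ dualCone u v, 0 ≤ pairing m (u + v) :=
  fun m hm => by rw [pairing_add_right]; exact add_nonneg hm.1 hm.2

theorem add_nsmul_perp_mem {u v m : ℤ × ℤ} (huv : 0 < det u v) (hm : 0 ≤ pairing m u) :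
    ∃ N : ℕ, ∀ i ≥ N, m + i • perp u ∈ dualCone u v := by
  obtain ⟨N, hN⟩ := exists_nat_add_mul_nonneg (pairing m v) huv
  refine ⟨N, fun i hi => ⟨?_, ?_⟩⟩
  · rwa [pairing_add_left, pairing_nsmul_left, pairing_perp, det_self, mul_zero, add_zero]
  · rw [pairing_add_left, pairing_nsmul_left, pairing_perp]
    exact hN i hi

theorem add_nsmul_neg_perp_mem {u v m : ℤ × ℤ} (huv : 0 < det u v) (hm : 0 ≤ pairing m v) :
    ∃ N : ℕ, ∀ i ≥ N, m + i • -perp v ∈ dualCone u v := by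
  obtain ⟨N, hN⟩ := exists_nat_add_mul_nonneg (pairing m u) huv
  refine ⟨N, fun i hi => ⟨?_, ?_⟩⟩
  · rw [pairing_add_left, pairing_nsmul_left, pairing_neg_perp]
    exact hN i hi
  · rwa [pairing_add_left, pairing_nsmul_left, pairing_neg_perp, det_self, mul_zero, add_zero]

theorem add_nsmul_interior_mem {u v : ℤ × ℤ} (huv : 0 < det u v) (m : ℤ × ℤ) :
    ∃ N : ℕ, ∀ i ≥ N, m + i • (perp u + -perp v) ∈ dualCone u v := by
  obtain ⟨M, hM⟩ := exists_nat_add_mul_nonneg (pairing m u) huv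
  obtain ⟨N, hN⟩ := exists_nat_add_mul_nonneg (pairing m v) huv
  refine ⟨max M N, fun i hi => ⟨?_, ?_⟩⟩
  · rw [pairing_add_left, pairing_nsmul_left, pairing_add_left, pairing_perp, pairing_neg_perp,
      det_self, zero_add]
    exact hM i (le_of_max_le_left hi)
  · rw [pairing_add_left, pairing_nsmul_left, pairing_add_left, pairing_perp, pairing_neg_perp,
      det_self, add_zero]
    exact hN i (le_of_max_le_right hi)

/-- Write an element as a quotient of Laurent polynomials and shift both by a monomial so that the
denominator has value zero. By absence of cancellation all exponents then pair nonnegatively with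
`w`. A power of the monomial `n`, a unit for the valuation, moves them into the dual cone. -/
theorem weightRing_mem_specModel {u v w n : ℤ × ℤ} (hw : IsCoprime w.1 w.2)
    (hle : ∀ m ∈ dualCone u v, 0 ≤ pairing m w) (hn : pairing n w = 0)
    (hadd : ∀ m, 0 ≤ pairing m w → ∃ N : ℕ, ∀ i ≥ N, m + i • n ∈ dualCone u v) :
    (weightRing k w : LocalSubring K) ∈ specModel (chartSubring k K u v) := by
  rw [mem_specModel_iff]
  refine ⟨chartSubring_le_weightRing hle, fun x hx => ?_⟩
  obtain ⟨m, hm⟩ := exists_pairing_eq_one hw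
  obtain ⟨g, hg, h, hh, h0, rfl⟩ := exists_div_monomialSpan k x
  obtain ⟨j, hj⟩ := exists_weightVal_eq (k := k) (w := w) h0
  have hj0 := weightVal_div_zpow hm hj
  have hx0 : g / h = g * χ (-(j • m)) / (h * χ (-(j • m))) :=
    (mul_div_mul_right _ _ (laurentMonomial_ne_zero _)).symm
  have hg' : 0 ≤ weightVal k w (g * χ (-(j • m))) := by
    have : g * χ (-(j • m)) = g / h * (h * χ (-(j • m))) := by
      field_simp
    rw [this, AddValuation.map_mul, hj0, add_zero]
    exact hx
  have hgm : g * χ (-(j • m)) ∈ monomialSpan k K {m | 0 ≤ pairing m w} :=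
    monomialSpan_mono (fun _ h => h.2) (mem_monomialSpan_of_le_weightVal (j := 0)
      (mul_laurentMonomial_mem (fun _ _ => Set.mem_univ _) hg) hg')
  have hhm : h * χ (-(j • m)) ∈ monomialSpan k K {m | 0 ≤ pairing m w} :=
    monomialSpan_mono (fun _ h => h.2) (mem_monomialSpan_of_le_weightVal (j := 0)
      (mul_laurentMonomial_mem (fun _ _ => Set.mem_univ _) hh) hj0.ge)
  obtain ⟨M, hM⟩ := exists_mul_laurentMonomial_mem hadd hgm
  obtain ⟨N, hN⟩ := exists_mul_laurentMonomial_mem hadd hhm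
  have hne : h * χ (-(j • m)) * χ (max M N • n) ≠ 0 :=
    mul_ne_zero (mul_ne_zero h0 (laurentMonomial_ne_zero _)) (laurentMonomial_ne_zero _)
  have hmem := hN (max M N) (le_max_right _ _)
  refine ⟨_, hM (max M N) (le_max_left _ _), _, hmem, hne, ?_, ?_⟩
  · rw [inv_mem_weightRing hne (chartSubring_le_weightRing hle hmem), AddValuation.map_mul, hj0,
      weightVal_laurentMonomial, pairing_nsmul_left, hn]
    simp
  · exact hx0.trans (mul_div_mul_right _ _ (laurentMonomial_ne_zero _)).symm

theorem weightRing_left_mem_specModel {u v : ℤ × ℤ} (huv : 0 < det u v)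
    (hu : IsCoprime u.1 u.2) :
    (weightRing k u : LocalSubring K) ∈ specModel (chartSubring k K u v) :=
  weightRing_mem_specModel hu pairing_left_nonneg (by rw [pairing_perp, det_self])
    fun _ hm => add_nsmul_perp_mem huv hm

theorem hasFractions_of_mem_specModel {u v : ℤ × ℤ} (huv : 0 < det u v) {P : LocalSubring K}
    (hP : P ∈ specModel (chartSubring k K u v)) : HasFractions P := by
  intro x
  obtain ⟨g, hg, h, hh, h0, rfl⟩ := exists_div_monomialSpan k x
  obtain ⟨M, hM⟩ := exists_mul_laurentMonomial_mem (fun m _ => add_nsmul_interior_mem huv m) hg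
  obtain ⟨N, hN⟩ := exists_mul_laurentMonomial_mem (fun m _ => add_nsmul_interior_mem huv m) hh
  have hle := (mem_specModel_iff.mp hP).1
  exact ⟨_, hle (hM (max M N) (le_max_left _ _)), _, hle (hN (max M N) (le_max_right _ _)),
    mul_ne_zero h0 (laurentMonomial_ne_zero _),
    (mul_div_mul_right _ _ (laurentMonomial_ne_zero _)).symm⟩

/-- Change of chart: the fractions presenting `P` over the first chart are expanded by a power of `χ
n`. The new denominator stays invertible at `P` because `χ (-n)` is regular there. -/
theorem mem_specModel_chartSubring {u v u' v' n : ℤ × ℤ} {P : LocalSubring K}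
    (hP : P ∈ specModel (chartSubring k K u v)) (hle : chartSubring k K u' v' ≤ P.toSubring)
    (hn : χ (-n) ∈ P.toSubring)
    (hadd : ∀ m ∈ dualCone u v, ∃ N : ℕ, ∀ i ≥ N, m + i • n ∈ dualCone u' v') :
    P ∈ specModel (chartSubring k K u' v') := by
  rw [mem_specModel_iff]
  refine ⟨hle, fun x hx => ?_⟩
  obtain ⟨g, hg, h, hh, h0, hinv, rfl⟩ := (mem_specModel_iff.mp hP).2 x hx
  obtain ⟨M, hM⟩ := exists_mul_laurentMonomial_mem hadd hg
  obtain ⟨N, hN⟩ := exists_mul_laurentMonomial_mem hadd hh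
  refine ⟨_, hM (max M N) (le_max_left _ _), _, hN (max M N) (le_max_right _ _),
    mul_ne_zero h0 (laurentMonomial_ne_zero _), ?_,
    (mul_div_mul_right _ _ (laurentMonomial_ne_zero _)).symm⟩
  rw [mul_inv, ← laurentMonomial_neg, ← smul_neg, laurentMonomial_nsmul]
  exact mul_mem hinv (pow_mem hn _)

end Chart

/-! ### Fixed points, and the position of an arbitrary point in a chart. -/

section FixedPoint

/-- The local ring of the torus-fixed point of the chart of the cone of `u` and `v`. -/
def fixedPoint (k K : Type*) [Field k] [Field K] [Algebra k K]
    [Algebra (MvPolynomial (Fin 2) k) K] [IsScalarTower k (MvPolynomial (Fin 2) k) K]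
    [IsFractionRing (MvPolynomial (Fin 2) k) K] (u v : ℤ × ℤ) : LocalSubring K :=
  LocalSubring.ofPrime (chartSubring k K u v)
    ((maximalIdeal (weightRing k (u + v) : LocalSubring K).toSubring).comap
      (Subring.inclusion (chartSubring_le_weightRing pairing_add_nonneg)))

theorem fixedPoint_mem_specModel (u v : ℤ × ℤ) :
    fixedPoint k K u v ∈ specModel (chartSubring k K u v) := ⟨_, inferInstance, rfl⟩

/-- The fixed point is defined as the centre on the chart of the valuation of weight `u + v`. When
`det u v` is positive this weight is positive on every nontrivial monomial of the chart, so value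
zero means nonzero constant term. -/
theorem inv_mem_fixedPoint {u v : ℤ × ℤ} {x : K} (hx : x ∈ chartSubring k K u v) (h0 : x ≠ 0) :
    x⁻¹ ∈ (fixedPoint k K u v).toSubring ↔ weightVal k (u + v) x = 0 := by
  have hle : chartSubring k K u v ≤ (weightRing k (u + v) : LocalSubring K).toSubring :=
    chartSubring_le_weightRing pairing_add_nonneg
  rw [← inv_mem_weightRing h0 (hle hx), fixedPoint, mem_ofPrime_iff]
  constructor
  · rintro ⟨g, h, hh, hgh⟩
    rw [Ideal.mem_comap, mem_maximalIdeal_iff] at hh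
    push Not at hh
    rw [hgh, div_eq_mul_inv]
    exact mul_mem (hle g.2) hh.2
  · intro hinv
    refine ⟨1, ⟨x, hx⟩, ?_, by simp⟩
    rw [Ideal.mem_comap, mem_maximalIdeal_iff]
    push Not
    exact ⟨h0, hinv⟩

/-- The exponents of the monomials vanishing at the torus-fixed point. -/
def positiveCone (u v : ℤ × ℤ) : Set (ℤ × ℤ) := {m | m ∈ dualCone u v ∧ m ≠ 0}

theorem exists_sub_const_mem {u v : ℤ × ℤ} {x : K} (hx : x ∈ chartSubring k K u v) :
    ∃ c : k, x - algebraMap k K c ∈ monomialSpan k K (positiveCone u v) := by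
  refine monomialSpan_induction
    (p := fun x => ∃ c : k, x - algebraMap k K c ∈ monomialSpan k K (positiveCone u v))
    (fun m hm => ?_) ⟨0, by simp⟩ ?_ ?_ hx
  · by_cases h0 : m = 0
    · exact ⟨1, by simp [h0]⟩
    · have hm' : m ∈ positiveCone u v := ⟨hm, h0⟩
      exact ⟨0, by simpa using laurentMonomial_mem_monomialSpan hm'⟩
  · rintro x y ⟨c, hc⟩ ⟨d, hd⟩
    refine ⟨c + d, ?_⟩
    rw [map_add, add_sub_add_comm]
    exact add_mem hc hd
  · rintro a x ⟨c, hc⟩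
    refine ⟨a * c, ?_⟩
    rw [map_mul, ← Algebra.smul_def, ← smul_sub]
    exact Submodule.smul_mem _ a hc

theorem weightVal_algebraMap (w : ℤ × ℤ) {c : k} (hc : c ≠ 0) :
    weightVal k w (algebraMap k K c) = 0 := by
  have h : ∀ c : k, 0 ≤ weightVal k w (algebraMap k K c) := fun c =>
    le_weightVal (j := 0) (S := {0}) (by rintro m rfl; rw [pairing_zero_left])
      (by
        rw [Algebra.algebraMap_eq_smul_one, ← laurentMonomial_zero (k := k)]
        exact Submodule.smul_mem _ _ (laurentMonomial_mem_monomialSpan rfl))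
  have hc' : algebraMap k K c ≠ 0 := by simpa using hc
  rw [← inv_mem_weightRing hc' (mem_weightRing.mpr (h c)), mem_weightRing, ← map_inv₀]
  exact h _

theorem one_le_weightVal {u v : ℤ × ℤ} (huv : 0 < det u v) {x : K}
    (hx : x ∈ monomialSpan k K (positiveCone u v)) : 1 ≤ weightVal k (u + v) x :=
  le_weightVal (j := 1) (fun _ hm => pairing_add_pos huv hm.1 hm.2) hx

theorem mem_positive_of_weightVal_ne_zero {u v : ℤ × ℤ} (huv : 0 < det u v) {x : K}
    (hx : x ∈ chartSubring k K u v) (h : weightVal k (u + v) x ≠ 0) :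
    x ∈ monomialSpan k K (positiveCone u v) := by
  obtain ⟨c, hc⟩ := exists_sub_const_mem hx
  by_cases h0 : c = 0
  · simpa [h0] using hc
  · exfalso
    apply h
    have h1 := one_le_weightVal huv hc
    have h2 := weightVal_algebraMap (K := K) (u + v) h0
    have hlt : weightVal k (u + v) (algebraMap k K c) <
        weightVal k (u + v) (x - algebraMap k K c) := by
      rw [h2]; exact lt_of_lt_of_le zero_lt_one h1
    have h3 := AddValuation.map_add_eq_of_lt_left _ hlt
    rwa [add_sub_cancel, h2] at h3

/-- If all nontrivial monomials vanish at a point of a chart, the point is the fixed point. -/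
theorem eq_fixedPoint {u v : ℤ × ℤ} (huv : 0 < det u v) {P : LocalSubring K}
    (hP : P ∈ specModel (chartSubring k K u v))
    (h : ∀ m ∈ positiveCone u v, χ (-m) ∉ P.toSubring) : P = fixedPoint k K u v := by
  have hle := (mem_specModel_iff.mp hP).1
  have hmax : ∀ x ∈ monomialSpan k K (positiveCone u v), ∃ hx : x ∈ P.toSubring,
      (⟨x, hx⟩ : P.toSubring) ∈ maximalIdeal P.toSubring := by
    intro x hx
    refine monomialSpan_induction (p := fun x => ∃ hx : x ∈ P.toSubring,
      (⟨x, hx⟩ : P.toSubring) ∈ maximalIdeal P.toSubring) (fun m hm => ?_)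
      ⟨zero_mem _, zero_mem _⟩ ?_ ?_ hx
    · refine ⟨hle (laurentMonomial_mem_chartSubring hm.1), ?_⟩
      rw [mem_maximalIdeal_iff]
      right
      rw [← laurentMonomial_neg]
      exact h m hm
    · rintro x y ⟨hx, hx'⟩ ⟨hy, hy'⟩
      exact ⟨add_mem hx hy, add_mem hx' hy'⟩
    · rintro c x ⟨hx, hx'⟩
      rw [Algebra.smul_def]
      have hc := hle (algebraMap_mem_chartSubring u v c)
      exact ⟨mul_mem hc hx, Ideal.mul_mem_left _ ⟨_, hc⟩ hx'⟩
  -- At either point, an element of the chart ring is invertible exactly when its constant term is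
  -- nonzero, and two localizations inverting the same elements coincide.
  have key : ∀ x ∈ chartSubring k K u v, x ≠ 0 →
      (x⁻¹ ∈ P.toSubring ↔ x⁻¹ ∈ (fixedPoint k K u v).toSubring) := by
    intro x hx h0
    rw [inv_mem_fixedPoint hx h0]
    constructor
    · intro hinv
      by_contra hv
      obtain ⟨hxP, hxm⟩ := hmax x (mem_positive_of_weightVal_ne_zero huv hx hv)
      rw [mem_maximalIdeal_iff] at hxm
      tauto
    · intro hv
      obtain ⟨c, hc⟩ := exists_sub_const_mem hx
      have hc0 : c ≠ 0 := by
        rintro rfl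
        have h1 := one_le_weightVal huv hc
        rw [map_zero, sub_zero, hv] at h1
        exact absurd h1 (not_le.mpr zero_lt_one)
      obtain ⟨hyP, hym⟩ := hmax _ hc
      by_contra hinv
      have hxm : (⟨x, hle hx⟩ : P.toSubring) ∈ maximalIdeal P.toSubring :=
        mem_maximalIdeal_iff.mpr (Or.inr hinv)
      have hcm := sub_mem hxm hym
      have hcoe : ((⟨x, hle hx⟩ - ⟨x - algebraMap k K c, hyP⟩ : P.toSubring) : K) =
          algebraMap k K c := sub_sub_cancel _ _
      rw [mem_maximalIdeal_iff, hcoe] at hcm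
      rcases hcm with hcm | hcm
      · exact hc0 (by simpa using hcm)
      · rw [← map_inv₀] at hcm
        exact hcm (hle (algebraMap_mem_chartSubring u v _))
  refine LocalSubring.toSubring_injective (le_antisymm ?_ ?_)
  · exact le_of_mem_specModel hP
      (mem_specModel_iff.mp (fixedPoint_mem_specModel u v)).1 fun x hx h0 => (key x hx h0).mp
  · exact le_of_mem_specModel (fixedPoint_mem_specModel u v) hle fun x hx h0 => (key x hx h0).mpr

/-- A point of a chart is the fixed point or lies in one of the two smaller charts of the two rays
of the cone. -/
theorem point_trichotomy {u v : ℤ × ℤ} (huv : 0 < det u v) {P : LocalSubring K}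
    (hP : P ∈ specModel (chartSubring k K u v)) : P = fixedPoint k K u v ∨
      (∀ m, 0 ≤ pairing m u → χ m ∈ P.toSubring) ∨ ∀ m, 0 ≤ pairing m v → χ m ∈ P.toSubring := by
  by_cases h : ∀ m ∈ positiveCone u v, χ (-m) ∉ P.toSubring
  · exact Or.inl (eq_fixedPoint huv hP h)
  right
  push Not at h
  obtain ⟨n, ⟨hn, hn0⟩, hnP⟩ := h
  have hle := (mem_specModel_iff.mp hP).1
  have hmem : ∀ m (N : ℕ), m + N • n ∈ dualCone u v → χ m ∈ P.toSubring := by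
    intro m N hN
    have : χ m = χ (m + N • n) * χ (-n) ^ N := by
      rw [← laurentMonomial_nsmul, ← laurentMonomial_add]
      simp
    rw [this]
    exact mul_mem (hle (laurentMonomial_mem_chartSubring hN)) (pow_mem hnP N)
  -- Inverting a monomial that is positive on `u` removes the condition at `u` and leaves only the
  -- one at `v`. If `n` vanishes on `u` it is positive on `v`, and the roles are exchanged.
  rcases hn.1.lt_or_eq with hu | hu
  · right
    intro m hm
    obtain ⟨N, hN⟩ := exists_nat_add_mul_nonneg (pairing m u) hu
    refine hmem m N ⟨?_, ?_⟩
    · rw [pairing_add_left, pairing_nsmul_left]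
      exact hN N le_rfl
    · rw [pairing_add_left, pairing_nsmul_left]
      exact add_nonneg hm (mul_nonneg (by positivity) hn.2)
  · have hv : 0 < pairing n v := lt_of_le_of_ne hn.2 fun hv =>
      hn0 (eq_zero_of_pairing_eq_zero huv.ne' hu.symm hv.symm)
    left
    intro m hm
    obtain ⟨N, hN⟩ := exists_nat_add_mul_nonneg (pairing m v) hv
    refine hmem m N ⟨?_, ?_⟩
    · rw [pairing_add_left, pairing_nsmul_left]
      exact add_nonneg hm (mul_nonneg (by positivity) hn.1)
    · rw [pairing_add_left, pairing_nsmul_left]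
      exact hN N le_rfl

/-- Let `n` have value one on `w`, so that `χ n` is an equation of the invariant curve. If `χ n` is
invertible at `P`, then `P` lies in the torus. Otherwise an `x` of positive value invertible at `P`
would be divisible by `χ n`, making `χ n` invertible; so nothing of positive value is inverted and
`P` lies on the curve. -/
theorem torus_or_le_weightRing {u v w : ℤ × ℤ} (hw : IsCoprime w.1 w.2)
    (hle : ∀ m ∈ dualCone u v, 0 ≤ pairing m w) {P : LocalSubring K}
    (hP : P ∈ specModel (chartSubring k K u v)) (hPw : ∀ m, 0 ≤ pairing m w → χ m ∈ P.toSubring) :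
    (∀ m, χ m ∈ P.toSubring) ∨ P.toSubring ≤ (weightRing k w : LocalSubring K).toSubring := by
  obtain ⟨n, hn⟩ := exists_pairing_eq_one hw
  by_cases hnP : χ (-n) ∈ P.toSubring
  · left
    intro m
    by_cases hm : 0 ≤ pairing m w
    · exact hPw m hm
    · lift -pairing m w to ℕ using (by lia) with N hN
      have : χ m = χ (m + N • n) * χ (-n) ^ N := by
        rw [← laurentMonomial_nsmul, ← laurentMonomial_add]
        simp
      rw [this]
      refine mul_mem (hPw _ ?_) (pow_mem hnP N)
      rw [pairing_add_left, pairing_nsmul_left, hn]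
      lia
  · right
    refine le_of_mem_specModel hP (chartSubring_le_weightRing hle) fun x hx h0 hinv => ?_
    have hxw := chartSubring_le_weightRing hle hx
    rw [inv_mem_weightRing h0 hxw]
    by_contra hv
    obtain ⟨j, hj⟩ := exists_weightVal_eq (k := k) (w := w) h0
    have hj1 : (1 : ℤ) ≤ j := by
      have h1 := mem_weightRing.mp hxw
      rw [hj] at h1 hv
      have h1' : 0 ≤ j := by exact_mod_cast h1
      have h2' : j ≠ 0 := by exact_mod_cast hv
      lia
    have hmem := mem_monomialSpan_of_le_weightVal (j := 1) hx (by rw [hj]; exact_mod_cast hj1)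
    have hmem' : x * χ (-n) ∈ monomialSpan k K {m | 0 ≤ pairing m w} :=
      mul_laurentMonomial_mem (fun m hm => by
        have := hm.2
        simp only [Set.mem_ofPred_eq, pairing_add_left, pairing_neg_left, hn]
        lia) hmem
    have hP' : x * χ (-n) ∈ P.toSubring := by
      refine monomialSpan_induction (p := fun x => x ∈ P.toSubring) (fun m hm => hPw m hm)
        (zero_mem _) (fun _ _ => add_mem) (fun c y hy => ?_) hmem'
      rw [Algebra.smul_def]
      exact mul_mem ((mem_specModel_iff.mp hP).1 (algebraMap_mem_chartSubring u v c)) hy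
    apply hnP
    have : χ (-n) = x⁻¹ * (x * χ (-n)) := by
      rw [inv_mul_cancel_left₀ h0]
    rw [this]
    exact mul_mem hinv hP'

theorem chartSubring_le_of_forall {u v : ℤ × ℤ} {P : LocalSubring K} {u' v' : ℤ × ℤ}
    (hP : P ∈ specModel (chartSubring k K u' v')) (h : ∀ m ∈ dualCone u v, χ m ∈ P.toSubring) :
    chartSubring k K u v ≤ P.toSubring := by
  intro x hx
  refine monomialSpan_induction (p := fun x => x ∈ P.toSubring) h
    (zero_mem _) (fun _ _ => add_mem) (fun c y hy => ?_) hx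
  rw [Algebra.smul_def]
  exact mul_mem ((mem_specModel_iff.mp hP).1 (algebraMap_mem_chartSubring _ _ c)) hy

theorem mem_specModel_of_torus {u v u' v' : ℤ × ℤ} (h' : 0 < det u' v') {P : LocalSubring K}
    (hP : P ∈ specModel (chartSubring k K u v)) (hall : ∀ m, χ m ∈ P.toSubring) :
    P ∈ specModel (chartSubring k K u' v') :=
  mem_specModel_chartSubring hP (chartSubring_le_of_forall hP fun m _ => hall m) (hall _)
    fun m _ => add_nsmul_interior_mem h' m

/-- An element of the chart ring with positive value at `w` contains no constant term, so it is not
invertible at the fixed point either. -/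
theorem fixedPoint_le_weightRing {u v w : ℤ × ℤ} (huv : 0 < det u v)
    (hle : ∀ m ∈ dualCone u v, 0 ≤ pairing m w) :
    (fixedPoint k K u v).toSubring ≤ (weightRing k w : LocalSubring K).toSubring := by
  refine le_of_mem_specModel (fixedPoint_mem_specModel u v) (chartSubring_le_weightRing hle)
    fun x hx h0 hinv => ?_
  rw [inv_mem_fixedPoint hx h0] at hinv
  rw [inv_mem_weightRing h0 (chartSubring_le_weightRing hle hx)]
  by_contra hv
  obtain ⟨j, hj⟩ := exists_weightVal_eq (k := k) (w := w) h0
  have hj1 : (1 : ℤ) ≤ j := by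
    have h1 := mem_weightRing.mp (chartSubring_le_weightRing hle hx)
    rw [hj] at h1 hv
    have h1' : 0 ≤ j := by exact_mod_cast h1
    have h2' : j ≠ 0 := by exact_mod_cast hv
    lia
  have hmem := mem_monomialSpan_of_le_weightVal (j := 1) hx (by rw [hj]; exact_mod_cast hj1)
  have h1 := one_le_weightVal huv (monomialSpan_mono (T := positiveCone u v)
    (fun m hm => ⟨hm.1, by
      rintro rfl
      have := hm.2
      rw [pairing_zero_left] at this
      lia⟩) hmem)
  rw [hinv] at h1
  exact absurd h1 (not_le.mpr zero_lt_one)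

end FixedPoint

end ToricSurface

end

noncomputable section

namespace ToricSurface

open IsLocalRing

variable {k K : Type*} [Field k] [Field K] [Algebra k K] [Algebra (MvPolynomial (Fin 2) k) K]
  [IsScalarTower k (MvPolynomial (Fin 2) k) K] [IsFractionRing (MvPolynomial (Fin 2) k) K]

local notation "χ" => laurentMonomial k K

/-! ### Regularity of smooth charts and away from fixed points. -/

section Smooth

/-- The monomial in the coordinates of the chart of a smooth cone. -/
theorem aeval_monomial_eq (p q : ℤ × ℤ) (s : Fin 2 →₀ ℕ) (c : k) :
    MvPolynomial.aeval ![χ p, χ q] (MvPolynomial.monomial s c) = c • χ (s 0 • p + s 1 • q) := by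
  rw [MvPolynomial.aeval_monomial, Finsupp.prod_fintype _ _ (by simp), Algebra.smul_def]
  simp only [Fin.prod_univ_two, Matrix.cons_val_zero, Matrix.cons_val_one]
  rw [laurentMonomial_add, laurentMonomial_nsmul, laurentMonomial_nsmul]

theorem eq_smul_add_smul {u v : ℤ × ℤ} (huv : det u v = 1) (m : ℤ × ℤ) :
    m = pairing m u • -perp v + pairing m v • perp u := by
  have h : m - (pairing m u • -perp v + pairing m v • perp u) = 0 := by
    refine eq_zero_of_pairing_eq_zero (by lia : det u v ≠ 0) ?_ ?_ <;>
    rw [sub_eq_add_neg, pairing_add_left, pairing_neg_left, pairing_add_left, pairing_zsmul_left,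
      pairing_zsmul_left, pairing_perp, pairing_neg_perp, det_self, huv] <;> ring
  exact sub_eq_zero.mp h

theorem pairing_smul_add_smul {u v : ℤ × ℤ} (huv : det u v = 1) (a b : ℕ) :
    pairing (a • -perp v + b • perp u) u = a ∧ pairing (a • -perp v + b • perp u) v = b := by
  constructor <;> rw [pairing_add_left, pairing_nsmul_left, pairing_nsmul_left, pairing_perp,
    pairing_neg_perp, det_self, huv] <;> ring

/-- When `det u v = 1`, the exponents `-perp v`, `perp u` form the basis dual to `u`, `v`. They
generate the dual cone freely, so the chart is an affine plane. -/
theorem chartSubring_isRegularRing {u v : ℤ × ℤ} (huv : det u v = 1) :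
    IsRegularRing (chartSubring k K u v) := by
  let f : MvPolynomial (Fin 2) k →ₐ[k] K := MvPolynomial.aeval ![χ (-perp v), χ (perp u)]
  have hmem : ∀ p, f.toRingHom p ∈ chartSubring k K u v := by
    intro p
    change f p ∈ monomialSpan k K (dualCone u v)
    induction p using MvPolynomial.induction_on' with
    | monomial s c =>
      rw [aeval_monomial_eq]
      refine Submodule.smul_mem _ c (laurentMonomial_mem_monomialSpan ?_)
      have h := pairing_smul_add_smul huv (s 0) (s 1)
      exact ⟨by rw [h.1]; positivity, by rw [h.2]; positivity⟩
    | add p q hp hq => rw [map_add]; exact add_mem hp hq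
  have hinj : Function.Injective f := by
    let e : (Fin 2 →₀ ℕ) → ℤ × ℤ := fun s => s 0 • -perp v + s 1 • perp u
    have he : Function.Injective e := by
      intro a b hab
      have ha := pairing_smul_add_smul huv (a 0) (a 1)
      have hb := pairing_smul_add_smul huv (b 0) (b 1)
      change e a = e b at hab
      change pairing (e a) u = _ ∧ pairing (e a) v = _ at ha
      change pairing (e b) u = _ ∧ pairing (e b) v = _ at hb
      rw [hab] at ha
      ext i
      fin_cases i
      · exact_mod_cast ha.1.symm.trans hb.1
      · exact_mod_cast ha.2.symm.trans hb.2
    have hli := (linearIndependent_laurentMonomial (k := k) (K := K)).comp e he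
    rw [injective_iff_map_eq_zero]
    intro p hp
    ext s
    rw [MvPolynomial.coeff_zero]
    by_contra hs
    rw [p.as_sum, map_sum, Finset.sum_congr rfl fun s _ => aeval_monomial_eq _ _ s _] at hp
    exact hs (linearIndependent_iff'.mp hli _ (fun x => MvPolynomial.coeff x p) hp s
      (MvPolynomial.mem_support_iff.mpr hs))
  have hsurj : ∀ x ∈ chartSubring k K u v, ∃ p, f p = x := by
    intro x hx
    refine monomialSpan_induction (p := fun x => ∃ p, f p = x) (fun m hm => ?_) ⟨0, map_zero f⟩
      ?_ ?_ hx
    · obtain ⟨a, ha⟩ := Int.eq_ofNat_of_zero_le hm.1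
      obtain ⟨b, hb⟩ := Int.eq_ofNat_of_zero_le hm.2
      refine ⟨MvPolynomial.monomial (Finsupp.equivFunOnFinite.symm ![a, b]) 1, ?_⟩
      rw [aeval_monomial_eq, one_smul]
      have h := eq_smul_add_smul huv m
      rw [ha, hb] at h
      rw [h]
      simp
    · rintro _ _ ⟨p, rfl⟩ ⟨q, rfl⟩
      exact ⟨p + q, map_add f p q⟩
    · rintro c _ ⟨p, rfl⟩
      exact ⟨c • p, map_smul f c p⟩
  refine IsRegularRing.of_ringEquiv (R := MvPolynomial (Fin 2) k)
    (RingEquiv.ofBijective (f.toRingHom.codRestrict (chartSubring k K u v) hmem) ⟨?_, ?_⟩)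
  · intro p q hpq
    exact hinj (congrArg Subtype.val hpq)
  · rintro ⟨x, hx⟩
    obtain ⟨p, hp⟩ := hsurj x hx
    exact ⟨p, Subtype.ext hp⟩

theorem isRegularLocalRing_of_det_eq_one {u v : ℤ × ℤ} (huv : det u v = 1) {P : LocalSubring K}
    (hP : P ∈ specModel (chartSubring k K u v)) : IsRegularLocalRing P.toSubring :=
  have := chartSubring_isRegularRing (k := k) (K := K) huv
  isRegularLocalRing_of_mem_specModel hP

theorem exists_det_eq_one_right {u : ℤ × ℤ} (hu : IsCoprime u.1 u.2) : ∃ v, det u v = 1 := by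
  obtain ⟨a, b, h⟩ := hu
  exact ⟨(-b, a), by simp only [det]; linarith⟩

theorem exists_det_eq_one_left {v : ℤ × ℤ} (hv : IsCoprime v.1 v.2) : ∃ u, det u v = 1 := by
  obtain ⟨a, b, h⟩ := hv
  exact ⟨(b, -a), by simp only [det]; linarith⟩

/-- A point other than the fixed point only sees one of the two rays. Completing that ray to a
lattice basis puts the point into a smooth chart. -/
theorem isRegularLocalRing_of_ne_fixedPoint {u v : ℤ × ℤ} (huv : 0 < det u v)
    (hu : IsCoprime u.1 u.2) (hv : IsCoprime v.1 v.2) {P : LocalSubring K}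
    (hP : P ∈ specModel (chartSubring k K u v)) (hne : P ≠ fixedPoint k K u v) :
    IsRegularLocalRing P.toSubring := by
  rcases point_trichotomy huv hP with h | h | h
  · exact absurd h hne
  · obtain ⟨v', hv'⟩ := exists_det_eq_one_right hu
    refine isRegularLocalRing_of_det_eq_one (k := k) hv' (mem_specModel_chartSubring hP
      (n := perp u) (chartSubring_le_of_forall hP fun m hm => h m hm.1)
      (h _ (by rw [pairing_neg_perp, det_self])) fun m hm => ?_)
    exact add_nsmul_perp_mem (by lia) hm.1
  · obtain ⟨u', hu'⟩ := exists_det_eq_one_left hv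
    refine isRegularLocalRing_of_det_eq_one (k := k) hu' (mem_specModel_chartSubring hP
      (n := -perp v) (chartSubring_le_of_forall hP fun m hm => h m hm.2)
      (h _ (by rw [neg_neg, pairing_perp, det_self])) fun m hm => ?_)
    exact add_nsmul_neg_perp_mem (by lia) hm.2

end Smooth

/-! ### Indecomposable exponents of a dual cone. -/

section Singular

theorem eq_smul_perp {m u : ℤ × ℤ} (hu : IsCoprime u.1 u.2) (h : pairing m u = 0) :
    ∃ c : ℤ, m = c • perp u := by
  obtain ⟨a, b, hab⟩ := hu
  simp only [pairing] at h
  refine ⟨a * m.2 - b * m.1, Prod.ext ?_ ?_⟩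
  · simp only [perp, Prod.smul_fst, smul_eq_mul]
    linear_combination -m.1 * hab + a * h
  · simp only [perp, Prod.smul_snd, smul_eq_mul]
    linear_combination -m.2 * hab + b * h

/-- The exponents of the monomials which are not products of nontrivial monomials on the chart. -/
def indecomposables (u v : ℤ × ℤ) : Set (ℤ × ℤ) :=
  {e | e ∈ dualCone u v ∧ e ≠ 0 ∧ ∀ m ∈ dualCone u v, ∀ n ∈ dualCone u v, m + n = e →
    m = 0 ∨ n = 0}

/-- Both summands of `perp u` must lie on the edge of the dual cone where the pairing with `u`
vanishes, and `perp u` is the primitive generator of this edge. -/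
theorem perp_mem_indecomposables {u v : ℤ × ℤ} (huv : 0 < det u v) (hu : IsCoprime u.1 u.2) :
    perp u ∈ indecomposables u v := by
  have h0 : perp u ≠ 0 := by
    intro h
    have := pairing_perp u v
    rw [h, pairing_zero_left] at this
    lia
  refine ⟨perp_mem_dualCone huv, h0, fun m hm n hn hmn => ?_⟩
  have h1 : pairing m u + pairing n u = 0 := by
    rw [← pairing_add_left, hmn, pairing_perp, det_self]
  have h2 := hm.1
  have h3 := hn.1
  obtain ⟨c, rfl⟩ := eq_smul_perp hu (by lia : pairing m u = 0)
  obtain ⟨d, rfl⟩ := eq_smul_perp hu (by lia : pairing n u = 0)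
  have h4 := hm.2
  have h5 := hn.2
  have h6 := congrArg (fun m => pairing m v) hmn
  simp only [pairing_add_left, pairing_zsmul_left, pairing_perp] at h4 h5 h6
  have hc : 0 ≤ c := nonneg_of_mul_nonneg_left h4 huv
  have hd : 0 ≤ d := nonneg_of_mul_nonneg_left h5 huv
  have hcd : c + d = 1 := by
    have : (c + d - 1) * det u v = 0 := by linarith
    have := (mul_eq_zero.mp this).resolve_right huv.ne'
    lia
  rcases (by lia : c = 0 ∨ d = 0) with h | h
  · left; rw [h, zero_smul]
  · right; rw [h, zero_smul]

theorem neg_perp_mem_indecomposables {u v : ℤ × ℤ} (huv : 0 < det u v)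
    (hv : IsCoprime v.1 v.2) : -perp v ∈ indecomposables u v := by
  have h0 : -perp v ≠ 0 := by
    intro h
    have := pairing_neg_perp v u
    rw [h, pairing_zero_left] at this
    lia
  refine ⟨neg_perp_mem_dualCone huv, h0, fun m hm n hn hmn => ?_⟩
  have h1 : pairing m v + pairing n v = 0 := by
    rw [← pairing_add_left, hmn, pairing_neg_perp, det_self]
  have h2 := hm.2
  have h3 := hn.2
  obtain ⟨c, rfl⟩ := eq_smul_perp hv (by lia : pairing m v = 0)
  obtain ⟨d, rfl⟩ := eq_smul_perp hv (by lia : pairing n v = 0)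
  have h4 := hm.1
  have h5 := hn.1
  have h6 := congrArg (fun m => pairing m u) hmn
  simp only [pairing_add_left, pairing_zsmul_left, pairing_perp, pairing_neg_perp,
    det_swap u v] at h4 h5 h6
  have hc : 0 ≤ -c := nonneg_of_mul_nonneg_left (by linarith : 0 ≤ -c * det u v) huv
  have hd : 0 ≤ -d := nonneg_of_mul_nonneg_left (by linarith : 0 ≤ -d * det u v) huv
  have hcd : c + d = -1 := by
    have : (c + d + 1) * det u v = 0 := by linarith
    have := (mul_eq_zero.mp this).resolve_right huv.ne'
    lia
  rcases (by lia : c = 0 ∨ d = 0) with h | h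
  · left; rw [h, zero_smul]
  · right; rw [h, zero_smul]

/-- Among the exponents of value one on `u`, take the one whose value on `v` is reduced modulo `det
u v`. In a decomposition one summand has value zero on `u`, hence is a multiple of `perp u`, and a
positive multiple would exceed the reduced value. When `det u v ≥ 2` this exponent differs from both
edge generators. -/
theorem exists_third_indecomposable {u v : ℤ × ℤ} (huv : 0 < det u v) (hu : IsCoprime u.1 u.2) :
    ∃ e ∈ indecomposables u v, pairing e u = 1 := by
  obtain ⟨m, hm⟩ := exists_pairing_eq_one hu
  have heu : pairing (m + (-(pairing m v / det u v)) • perp u) u = 1 := by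
    rw [pairing_add_left, pairing_zsmul_left, pairing_perp, det_self, hm]; ring
  have hev : pairing (m + (-(pairing m v / det u v)) • perp u) v = pairing m v % det u v := by
    rw [pairing_add_left, pairing_zsmul_left, pairing_perp, Int.emod_def]; ring
  generalize m + (-(pairing m v / det u v)) • perp u = e at heu hev
  have hlt := Int.emod_lt_of_pos (pairing m v) huv
  have hnn := Int.emod_nonneg (pairing m v) huv.ne'
  have key : ∀ m ∈ dualCone u v, ∀ n ∈ dualCone u v, m + n = e → pairing m u = 0 → m = 0 := by
    intro m hm n hn hmn h0
    obtain ⟨c, rfl⟩ := eq_smul_perp hu h0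
    have h1 := congrArg (fun m => pairing m v) hmn
    have h2 := hm.2
    have h3 := hn.2
    simp only [pairing_add_left, pairing_zsmul_left, pairing_perp] at h1 h2
    have hc : 0 ≤ c := nonneg_of_mul_nonneg_left h2 huv
    have hc' : c < 1 := by
      by_contra hc'
      nlinarith
    rw [(by lia : c = 0), zero_smul]
  refine ⟨e, ⟨⟨by lia, by lia⟩, ?_, fun m hm n hn hmn => ?_⟩, heu⟩
  · rintro rfl
    rw [pairing_zero_left] at heu
    lia
  · have h1 : pairing m u + pairing n u = 1 := by rw [← pairing_add_left, hmn, heu]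
    have h2 := hm.1
    have h3 := hn.1
    rcases (by lia : pairing m u = 0 ∨ pairing n u = 0) with h | h
    · exact Or.inl (key m hm n hn hmn h)
    · exact Or.inr (key n hn m hm (by rw [add_comm, hmn]) h)

/-- The coefficient functionals are extended from Laurent polynomials to all of `K` by an arbitrary
linear left inverse; only their values on Laurent polynomials carry meaning. -/
theorem exists_coefficients (k K : Type*) [Field k] [Field K] [Algebra k K]
    [Algebra (MvPolynomial (Fin 2) k) K] [IsScalarTower k (MvPolynomial (Fin 2) k) K]
    [IsFractionRing (MvPolynomial (Fin 2) k) K] :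
    ∃ c : ℤ × ℤ → K →ₗ[k] k, ∀ m n, c m (laurentMonomial k K n) = if m = n then 1 else 0 := by
  obtain ⟨L, hL⟩ := (Finsupp.linearCombination k (laurentMonomial k K)).exists_leftInverse_of_injective
    (LinearMap.ker_eq_bot.mpr linearIndependent_laurentMonomial)
  refine ⟨fun m => (Finsupp.lapply m).comp L, fun m n => ?_⟩
  have h := LinearMap.congr_fun hL (Finsupp.single n 1)
  simp only [LinearMap.comp_apply, Finsupp.linearCombination_single, one_smul,
    LinearMap.id_apply] at h
  rw [LinearMap.comp_apply, h, Finsupp.lapply_apply, Finsupp.single_apply]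
  simp only [eq_comm]

end Singular

end ToricSurface

end

noncomputable section

namespace ToricSurface

open IsLocalRing

variable {k K : Type*} [Field k] [Field K] [Algebra k K] [Algebra (MvPolynomial (Fin 2) k) K]
  [IsScalarTower k (MvPolynomial (Fin 2) k) K] [IsFractionRing (MvPolynomial (Fin 2) k) K]

local notation "χ" => laurentMonomial k K

/-! ### Lower bound for the number of generators of the maximal ideal at a fixed point. -/

section CotangentSpace

variable {c : ℤ × ℤ → K →ₗ[k] k} (hc : ∀ m n, c m (laurentMonomial k K n) = if m = n then 1 else 0)
include hc

theorem coeff_bilinear {u v : ℤ × ℤ} {φ ψ : K →ₗ[k] (K →ₗ[k] k)}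
    (h : ∀ m ∈ dualCone u v, ∀ n ∈ dualCone u v, φ (χ m) (χ n) = ψ (χ m) (χ n)) {x y : K}
    (hx : x ∈ chartSubring k K u v) (hy : y ∈ chartSubring k K u v) : φ x y = ψ x y := by
  refine monomialSpan_induction (p := fun x => φ x y = ψ x y) (fun m hm => ?_) (by simp)
    (fun a b ha hb => by simp [ha, hb]) (fun a b hb => by simp [hb]) hx
  exact monomialSpan_induction (p := fun y => φ (χ m) y = ψ (χ m) y) (fun n hn => h m hm n hn)
    (by simp) (fun a b ha hb => by rw [map_add, map_add, ha, hb])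
    (fun a b hb => by rw [map_smul, map_smul, hb]) hy

/-- The dual cone is strongly convex, so two of its exponents add up to zero only if both are zero.
The constant term is thus evaluation at the fixed point. -/
theorem coeff_zero_mul {u v : ℤ × ℤ} (huv : 0 < det u v) {x y : K}
    (hx : x ∈ chartSubring k K u v) (hy : y ∈ chartSubring k K u v) :
    c 0 (x * y) = c 0 x * c 0 y := by
  refine coeff_bilinear hc (φ := (LinearMap.mul k K).compr₂ (c 0))
    (ψ := (LinearMap.mul k k).compl₁₂ (c 0) (c 0)) (fun m hm n hn => ?_) hx hy
  change c 0 (χ m * χ n) = c 0 (χ m) * c 0 (χ n)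
  rw [← laurentMonomial_add, hc, hc, hc]
  have key : (0 = m + n) ↔ (0 = m ∧ 0 = n) := by
    constructor
    · intro h
      have h1 := pairing_add_left m n u
      have h2 := pairing_add_left m n v
      rw [← h, pairing_zero_left] at h1 h2
      have h3 := hm.1
      have h4 := hm.2
      have h5 := hn.1
      have h6 := hn.2
      exact ⟨(eq_zero_of_pairing_eq_zero huv.ne' (by lia) (by lia)).symm,
        (eq_zero_of_pairing_eq_zero huv.ne' (by lia) (by lia)).symm⟩
    · rintro ⟨h1, h2⟩
      rw [← h1, ← h2, add_zero]
  simp only [key, ite_and]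
  split_ifs <;> simp

/-- An indecomposable exponent arises in a product only as `0 + e` or `e + 0`. Its coefficient is
therefore a derivation over evaluation at the fixed point, that is, a tangent vector. -/
theorem coeff_indecomposable_mul {u v e : ℤ × ℤ} (he : e ∈ indecomposables u v) {x y : K}
    (hx : x ∈ chartSubring k K u v) (hy : y ∈ chartSubring k K u v) :
    c e (x * y) = c 0 x * c e y + c e x * c 0 y := by
  refine coeff_bilinear hc (φ := (LinearMap.mul k K).compr₂ (c e))
    (ψ := (LinearMap.mul k k).compl₁₂ (c 0) (c e) + (LinearMap.mul k k).compl₁₂ (c e) (c 0))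
    (fun m hm n hn => ?_) hx hy
  change c e (χ m * χ n) = c 0 (χ m) * c e (χ n) + c e (χ m) * c 0 (χ n)
  rw [← laurentMonomial_add, hc, hc, hc, hc, hc]
  obtain ⟨-, he0, he⟩ := he
  by_cases h : e = m + n
  · rcases he m hm n hn h.symm with rfl | rfl
    · rw [zero_add] at h
      simp [h, h ▸ he0]
    · rw [add_zero] at h
      simp [h, h ▸ he0]
  · by_cases hm0 : 0 = m
    · subst hm0
      rw [zero_add] at h
      simp [h, he0]
    · by_cases hn0 : 0 = n
      · subst hn0
        rw [add_zero] at h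
        simp [h, he0]
      · simp [h, hm0, hn0]

theorem coeff_zero_algebraMap (a : k) : c 0 (algebraMap k K a) = a := by
  rw [Algebra.algebraMap_eq_smul_one, ← laurentMonomial_zero (k := k), map_smul, hc]
  simp

theorem coeff_zero_of_positive {u v : ℤ × ℤ} {x : K}
    (hx : x ∈ monomialSpan k K (positiveCone u v)) : c 0 x = 0 :=
  monomialSpan_induction (p := fun x => c 0 x = 0) (fun m hm => by simp [hc, hm.2.symm])
    (map_zero _) (fun a b ha hb => by rw [map_add, ha, hb, add_zero])
    (fun a b hb => by rw [map_smul, hb, smul_zero]) hx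

theorem coeff_zero_ne_zero_iff {u v : ℤ × ℤ} (huv : 0 < det u v) {x : K}
    (hx : x ∈ chartSubring k K u v) :
    c 0 x ≠ 0 ↔ x ≠ 0 ∧ x⁻¹ ∈ (fixedPoint k K u v).toSubring := by
  constructor
  · intro h
    have h0 : x ≠ 0 := by rintro rfl; exact h (map_zero _)
    refine ⟨h0, (inv_mem_fixedPoint hx h0).mpr ?_⟩
    by_contra hv
    exact h (coeff_zero_of_positive hc (mem_positive_of_weightVal_ne_zero huv hx hv))
  · rintro ⟨h0, hinv⟩ h
    rw [inv_mem_fixedPoint hx h0] at hinv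
    obtain ⟨a, ha⟩ := exists_sub_const_mem hx
    have h1 := coeff_zero_of_positive hc ha
    rw [map_sub, coeff_zero_algebraMap hc, h, zero_sub, neg_eq_zero] at h1
    rw [h1, map_zero, sub_zero] at ha
    have h2 := one_le_weightVal huv ha
    rw [hinv] at h2
    exact absurd h2 (not_le.mpr zero_lt_one)

/-- The tangent vectors of distinct indecomposables are independent, being dual to the monomials
themselves, and they are determined by their values on generators of the maximal ideal. As they are
derivations on the chart ring only, denominators are cleared throughout. -/
theorem card_indecomposables_le {u v : ℤ × ℤ} (huv : 0 < det u v) {ι : Type*} [Fintype ι]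
    {e : ι → ℤ × ℤ} (he : ∀ i, e i ∈ indecomposables u v) (hinj : Function.Injective e)
    {G : Set (fixedPoint k K u v).toSubring} (hG : G.Finite)
    (hspan : Ideal.span G = maximalIdeal (fixedPoint k K u v).toSubring) :
    Fintype.card ι ≤ G.ncard := by
  classical
  let A := chartSubring k K u v
  let P := fixedPoint k K u v
  have hP : P ∈ specModel A := fixedPoint_mem_specModel u v
  have hAP : A ≤ P.toSubring := (mem_specModel_iff.mp hP).1
  let D : K → ι → k := fun x i => c (e i) x
  have hDadd : ∀ x y, D (x + y) = D x + D y := fun x y => by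
    funext i; exact map_add _ _ _
  have hDmul : ∀ x ∈ A, ∀ y ∈ A, D (x * y) = c 0 x • D y + c 0 y • D x := by
    intro x hx y hy
    funext i
    change c (e i) (x * y) = c 0 x * c (e i) y + c 0 y * c (e i) x
    rw [coeff_indecomposable_mul hc (he i) hx hy]
    ring
  have hfrac : ∀ x : P.toSubring, ∃ g ∈ A, ∃ h ∈ A, c 0 h ≠ 0 ∧ (x : K) = g / h := by
    intro x
    obtain ⟨g, hg, h, hh, h0, hinv, hx⟩ := (mem_specModel_iff.mp hP).2 x x.2
    exact ⟨g, hg, h, hh, (coeff_zero_ne_zero_iff hc huv hh).mpr ⟨h0, hinv⟩, hx⟩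
  choose num hnum den hden hden0 hdiv using hfrac
  let W : Submodule k (ι → k) := Submodule.span k ((fun x => D (num x)) '' G)
  -- Multiplication by an `h` with nonzero constant term changes the derivation of an element
  -- vanishing at the point only by a scalar. So it is harmless to allow such a factor, and the
  -- property passes to sums and multiples.
  have key : ∀ x : P.toSubring, x ∈ Ideal.span G →
      ∃ h ∈ A, c 0 h ≠ 0 ∧ h * x ∈ A ∧ c 0 (h * x) = 0 ∧ D (h * x) ∈ W := by
    intro x hx
    refine Submodule.span_induction (p := fun (x : P.toSubring) _ => ∃ h ∈ A, c 0 h ≠ 0 ∧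
      h * (x : K) ∈ A ∧ c 0 (h * x) = 0 ∧ D (h * x) ∈ W) ?_ ?_ ?_ ?_ hx
    · intro g hg
      have hdg : den g * g = num g := by
        have h0 : den g ≠ 0 := fun h => hden0 g (by rw [h, map_zero])
        rw [hdiv g, mul_div_cancel₀ _ h0]
      refine ⟨den g, hden g, hden0 g, ?_⟩
      rw [hdg]
      refine ⟨hnum g, ?_, Submodule.subset_span ⟨g, hg, rfl⟩⟩
      by_contra h0
      obtain ⟨h1, h2⟩ := (coeff_zero_ne_zero_iff hc huv (hnum g)).mp h0
      have hgm : g ∈ maximalIdeal P.toSubring := by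
        rw [← hspan]
        exact Ideal.subset_span hg
      rw [mem_maximalIdeal_iff] at hgm
      rw [← hdg] at h1 h2
      rcases hgm with hgm | hgm
      · rw [hgm, mul_zero] at h1
        exact h1 rfl
      · apply hgm
        have : (g : K)⁻¹ = den g * (den g * g)⁻¹ := by
          rw [mul_inv, mul_inv_cancel_left₀ (left_ne_zero_of_mul h1)]
        rw [this]
        exact mul_mem (hAP (hden g)) h2
    · refine ⟨1, one_mem _, ?_, ?_⟩
      · rw [← map_one (algebraMap k K), coeff_zero_algebraMap hc]
        exact one_ne_zero
      · have h0 : (1 : K) * ((0 : P.toSubring) : K) = 0 := mul_zero _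
        rw [h0]
        refine ⟨zero_mem _, map_zero _, ?_⟩
        have : D 0 = 0 := by funext i; exact map_zero _
        rw [this]
        exact zero_mem _
    · rintro x y _ _ ⟨g, hg, hg0, hgx, hgx0, hgD⟩ ⟨h, hh, hh0, hhy, hhy0, hhD⟩
      have heq : g * h * ((x + y : P.toSubring) : K) = h * (g * x) + g * (h * y) := by
        change g * h * ((x : K) + y) = _
        ring
      refine ⟨g * h, mul_mem hg hh, ?_, ?_⟩
      · rw [coeff_zero_mul hc huv hg hh]
        exact mul_ne_zero hg0 hh0
      · rw [heq]
        refine ⟨add_mem (mul_mem hh hgx) (mul_mem hg hhy), ?_, ?_⟩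
        · rw [map_add, coeff_zero_mul hc huv hh hgx, coeff_zero_mul hc huv hg hhy, hgx0, hhy0]
          simp
        · rw [hDadd, hDmul _ hh _ hgx, hDmul _ hg _ hhy, hgx0, hhy0, zero_smul, zero_smul,
            add_zero, add_zero]
          exact add_mem (Submodule.smul_mem _ _ hgD) (Submodule.smul_mem _ _ hhD)
    · rintro a x _ ⟨h, hh, hh0, hhx, hhx0, hhD⟩
      have ha0 : den a ≠ 0 := fun h => hden0 a (by rw [h, map_zero])
      have heq : den a * h * ((a • x : P.toSubring) : K) = num a * (h * x) := by
        change den a * h * ((a : K) * x) = _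
        rw [hdiv a]
        field_simp
      refine ⟨den a * h, mul_mem (hden a) hh, ?_, ?_⟩
      · rw [coeff_zero_mul hc huv (hden a) hh]
        exact mul_ne_zero (hden0 a) hh0
      · rw [heq]
        refine ⟨mul_mem (hnum a) hhx, ?_, ?_⟩
        · rw [coeff_zero_mul hc huv (hnum a) hhx, hhx0, mul_zero]
        · rw [hDmul _ (hnum a) _ hhx, hhx0, zero_smul, add_zero]
          exact Submodule.smul_mem _ _ hhD
  -- Each `χ (e i)` lies in the maximal ideal and is sent by `D` to the `i`-th basis vector.
  have hW : W = ⊤ := by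
    rw [eq_top_iff, ← (Pi.basisFun k ι).span_eq, Submodule.span_le]
    rintro _ ⟨i, rfl⟩
    have hχA : χ (e i) ∈ A := laurentMonomial_mem_chartSubring (he i).1
    have hχ0 : c 0 (χ (e i)) = 0 := by simp [hc, (he i).2.1.symm]
    have hχm : (⟨χ (e i), hAP hχA⟩ : P.toSubring) ∈ Ideal.span G := by
      rw [hspan, mem_maximalIdeal_iff]
      right
      intro hinv
      exact (coeff_zero_ne_zero_iff hc huv hχA).mpr ⟨laurentMonomial_ne_zero _, hinv⟩ hχ0
    obtain ⟨h, hh, hh0, -, -, hD⟩ := key _ hχm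
    have hDχ : D (χ (e i)) = Pi.basisFun k ι i := by
      funext j
      change c (e j) (χ (e i)) = _
      rw [hc, Pi.basisFun_apply, Pi.single_apply]
      simp [hinj.eq_iff]
    change D (h * χ (e i)) ∈ W at hD
    rw [hDmul _ hh _ hχA, hχ0, zero_smul, add_zero, hDχ] at hD
    have := Submodule.smul_mem W (c 0 h)⁻¹ hD
    rwa [inv_smul_smul₀ hh0] at this
  have h1 : Module.finrank k W = Fintype.card ι := by
    rw [hW, finrank_top, Module.finrank_fintype_fun_eq_card]
  rw [← h1]
  have hfin : ((fun x => D (num x)) '' G).Finite := hG.image _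
  calc Module.finrank k W ≤ ((fun x => D (num x)) '' G).ncard := by
        have := finrank_span_finset_le_card (R := k) hfin.toFinset
        rw [hfin.coe_toFinset] at this
        rwa [Set.ncard_eq_toFinset_card _ hfin]
    _ ≤ G.ncard := Set.ncard_image_le hG

end CotangentSpace

/-! ### Upper bound for the dimension, and non-regularity of singular fixed points. -/

theorem maximalIdeal_fixedPoint_le {u v : ℤ × ℤ} (huv : 0 < det u v)
    {J : Ideal (fixedPoint k K u v).toSubring}
    (h : ∀ m ∈ positiveCone u v, ∀ hm : χ m ∈ (fixedPoint k K u v).toSubring,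
      (⟨χ m, hm⟩ : (fixedPoint k K u v).toSubring) ∈ J) :
    maximalIdeal (fixedPoint k K u v).toSubring ≤ J := by
  have hP := fixedPoint_mem_specModel (k := k) (K := K) u v
  have hle := (mem_specModel_iff.mp hP).1
  have hspanJ : ∀ x ∈ monomialSpan k K (positiveCone u v),
      ∃ hx : x ∈ (fixedPoint k K u v).toSubring,
        (⟨x, hx⟩ : (fixedPoint k K u v).toSubring) ∈ J := by
    intro x hx
    refine monomialSpan_induction (p := fun x => ∃ hx : x ∈ (fixedPoint k K u v).toSubring,
        (⟨x, hx⟩ : (fixedPoint k K u v).toSubring) ∈ J)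
        (fun m hm => ⟨hle (laurentMonomial_mem_chartSubring hm.1), h m hm _⟩)
        ⟨zero_mem _, zero_mem J⟩ ?_ ?_ hx
    · rintro x y ⟨hx, hx'⟩ ⟨hy, hy'⟩
      exact ⟨add_mem hx hy, add_mem hx' hy'⟩
    · rintro t x ⟨hx, hx'⟩
      rw [Algebra.smul_def]
      have ht := hle (algebraMap_mem_chartSubring u v t)
      exact ⟨mul_mem ht hx, J.mul_mem_left ⟨_, ht⟩ hx'⟩
  intro x hx
  obtain ⟨g, hg, h, hh, h0, hinv, hgh⟩ := (mem_specModel_iff.mp hP).2 x x.2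
  have hgpos : g ∈ monomialSpan k K (positiveCone u v) := by
    by_cases hg0 : g = 0
    · rw [hg0]; exact zero_mem _
    refine mem_positive_of_weightVal_ne_zero huv hg fun hv => ?_
    rw [← inv_mem_fixedPoint hg hg0] at hv
    rw [mem_maximalIdeal_iff, hgh] at hx
    rcases hx with hx | hx
    · exact div_ne_zero hg0 h0 hx
    · rw [inv_div, div_eq_mul_inv] at hx
      exact hx (mul_mem (hle hh) hv)
  obtain ⟨hgP, hgJ⟩ := hspanJ g hgpos
  have hx' : x = ⟨h⁻¹, hinv⟩ * ⟨g, hgP⟩ := by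
    apply Subtype.ext
    change (x : K) = h⁻¹ * g
    rw [hgh, div_eq_inv_mul]
  rw [hx']
  exact J.mul_mem_left _ hgJ

/-- Some power of every nontrivial monomial is a product of the two edge monomials, so a prime
containing these contains all nontrivial monomials. -/
theorem maximalIdeal_mem_minimalPrimes {u v : ℤ × ℤ} (huv : 0 < det u v)
    {a b : (fixedPoint k K u v).toSubring} (ha : (a : K) = χ (perp u))
    (hb : (b : K) = χ (-perp v)) :
    maximalIdeal (fixedPoint k K u v).toSubring ∈ (Ideal.span {a, b}).minimalPrimes := by
  have hP := fixedPoint_mem_specModel (k := k) (K := K) u v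
  have hle := (mem_specModel_iff.mp hP).1
  have hmem : ∀ m (hm : m ∈ positiveCone u v), (⟨χ m, hle (laurentMonomial_mem_chartSubring hm.1)⟩ :
      (fixedPoint k K u v).toSubring) ∈ maximalIdeal (fixedPoint k K u v).toSubring := by
    intro m hm
    rw [mem_maximalIdeal_iff]
    right
    rw [inv_mem_fixedPoint (laurentMonomial_mem_chartSubring hm.1) (laurentMonomial_ne_zero m),
      weightVal_laurentMonomial]
    have := pairing_add_pos huv hm.1 hm.2
    exact_mod_cast (by lia : pairing m (u + v) ≠ 0)
  have hu0 : perp u ≠ 0 := by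
    intro h
    have := pairing_perp u v
    rw [h, pairing_zero_left] at this
    lia
  have hv0 : -perp v ≠ 0 := by
    intro h
    have := pairing_neg_perp v u
    rw [h, pairing_zero_left] at this
    lia
  refine ⟨⟨inferInstance, ?_⟩, fun J hJ hJm => ?_⟩
  · rw [Ideal.span_le]
    rintro x (rfl | rfl)
    · rw [SetLike.mem_coe, show x = ⟨_, hle (laurentMonomial_mem_chartSubring
        (perp_mem_dualCone huv))⟩ from Subtype.ext ha]
      exact hmem _ ⟨perp_mem_dualCone huv, hu0⟩
    · rw [SetLike.mem_coe, show x = ⟨_, hle (laurentMonomial_mem_chartSubring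
        (neg_perp_mem_dualCone huv))⟩ from Subtype.ext hb]
      exact hmem _ ⟨neg_perp_mem_dualCone huv, hv0⟩
  · obtain ⟨hJp, hIJ⟩ := hJ
    have haJ : a ∈ J := hIJ (Ideal.subset_span (by simp))
    have hbJ : b ∈ J := hIJ (Ideal.subset_span (by simp))
    have hχJ : ∀ m (hm : m ∈ positiveCone u v),
        (⟨χ m, hle (laurentMonomial_mem_chartSubring hm.1)⟩ :
          (fixedPoint k K u v).toSubring) ∈ J := by
      intro m hm
      obtain ⟨i, hi⟩ := Int.eq_ofNat_of_zero_le hm.1.1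
      obtain ⟨j, hj⟩ := Int.eq_ofNat_of_zero_le hm.1.2
      obtain ⟨d, hd⟩ := Int.eq_ofNat_of_zero_le huv.le
      -- Cramer's rule with `d = det u v`: the edge generators are dual to `u`, `v` up to this
      -- factor.
      have hdm : d • m = j • perp u + i • -perp v := by
        have : d • m - (j • perp u + i • -perp v) = 0 := by
          refine eq_zero_of_pairing_eq_zero huv.ne' ?_ ?_ <;>
          rw [sub_eq_add_neg, pairing_add_left, pairing_neg_left, pairing_add_left,
            pairing_nsmul_left, pairing_nsmul_left, pairing_nsmul_left, pairing_perp,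
            pairing_neg_perp, det_self, ← hd]
          · rw [hi]; ring
          · rw [hj]; ring
        exact sub_eq_zero.mp this
      have hpow : (⟨χ m, hle (laurentMonomial_mem_chartSubring hm.1)⟩ :
          (fixedPoint k K u v).toSubring) ^ d = a ^ j * b ^ i := by
        apply Subtype.ext
        change χ m ^ d = (a : K) ^ j * (b : K) ^ i
        rw [ha, hb, ← laurentMonomial_nsmul, ← laurentMonomial_nsmul, ← laurentMonomial_nsmul,
          ← laurentMonomial_add, hdm]
      apply hJp.mem_of_pow_mem d
      rw [hpow]
      have hij : i ≠ 0 ∨ j ≠ 0 := by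
        by_contra h
        push Not at h
        refine hm.2 (eq_zero_of_pairing_eq_zero huv.ne' ?_ ?_)
        · rw [hi, h.1]; rfl
        · rw [hj, h.2]; rfl
      rcases hij with h | h
      · exact J.mul_mem_left _ (J.pow_mem_of_mem hbJ i (by lia))
      · exact J.mul_mem_right _ (J.pow_mem_of_mem haJ j (by lia))
    exact maximalIdeal_fixedPoint_le huv fun m hm _ => hχJ m hm

/-- By Krull's height theorem the dimension is at most two, while the two edge generators and a
third indecomposable show that the maximal ideal needs at least three generators. -/
theorem fixedPoint_not_regular {u v : ℤ × ℤ} (huv : 2 ≤ det u v) (hu : IsCoprime u.1 u.2)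
    (hv : IsCoprime v.1 v.2) : ¬ IsRegularLocalRing (fixedPoint k K u v).toSubring := by
  intro hreg
  have hpos : 0 < det u v := by lia
  have hle := (mem_specModel_iff.mp (fixedPoint_mem_specModel (k := k) (K := K) u v)).1
  have hmin := maximalIdeal_mem_minimalPrimes (k := k) (K := K) hpos
    (a := ⟨_, hle (laurentMonomial_mem_chartSubring (perp_mem_dualCone hpos))⟩)
    (b := ⟨_, hle (laurentMonomial_mem_chartSubring (neg_perp_mem_dualCone hpos))⟩) rfl rfl
  have hht := Ideal.height_le_card_of_mem_minimalPrimes_span (Set.toFinite _) hmin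
  have hcard : ((maximalIdeal (fixedPoint k K u v).toSubring).spanFinrank : WithBot ℕ∞) ≤ 2 := by
    rw [hreg.spanFinrank_maximalIdeal, ← IsLocalRing.maximalIdeal_height_eq_ringKrullDim]
    refine WithBot.coe_le_coe.mpr (hht.trans ?_)
    refine (Nat.cast_le.mpr (Set.ncard_insert_le _ _)).trans ?_
    rw [Set.ncard_singleton]
  have hcard' : (maximalIdeal (fixedPoint k K u v).toSubring).spanFinrank ≤ 2 := by
    exact_mod_cast hcard
  have hfg : (maximalIdeal (fixedPoint k K u v).toSubring).FG := IsNoetherian.noetherian _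
  obtain ⟨c, hc⟩ := exists_coefficients k K
  obtain ⟨e, he, heu⟩ := exists_third_indecomposable hpos hu
  have h1 : pairing (perp u) u = 0 := by rw [pairing_perp, det_self]
  have h2 : pairing (-perp v) u = det u v := pairing_neg_perp v u
  have hinj : Function.Injective ![perp u, -perp v, e] := by
    have h12 : perp u ≠ -perp v := fun h => by rw [h] at h1; lia
    have h13 : perp u ≠ e := fun h => by rw [h] at h1; lia
    have h23 : -perp v ≠ e := fun h => by rw [h] at h2; lia
    intro i j hij
    fin_cases i <;> fin_cases j <;> simp_all
  have h3 := card_indecomposables_le hc hpos (e := ![perp u, -perp v, e]) (by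
    intro i
    fin_cases i
    · exact perp_mem_indecomposables hpos hu
    · exact neg_perp_mem_indecomposables hpos hv
    · exact he) hinj (Submodule.FG.finite_generators hfg) (Submodule.span_generators _)
  rw [Submodule.FG.generators_ncard hfg, Fintype.card_fin] at h3
  lia

end ToricSurface

end

noncomputable section

/-! ### Cyclic order of the rays of a complete fan, and walks along them. -/

namespace ToricSurface

theorem det_plucker (a b c d : ℤ × ℤ) :
    det a c * det b d = det a b * det c d + det a d * det b c := by
  simp only [det]; ring

theorem det_smul_eq (w u v : ℤ × ℤ) : det u v • w = det w v • u + det u w • v := by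
  refine Prod.ext ?_ ?_ <;> simp [det] <;> ring

/-- The linear form `x ↦ det u x`. -/
def detLeft (u : ℤ × ℤ) : ℤ × ℤ →+ ℤ where
  toFun x := det u x
  map_zero' := by simp [det]
  map_add' x y := by simp only [det, Prod.fst_add, Prod.snd_add]; ring

/-- The linear form `x ↦ det x u`. -/
def detRight (u : ℤ × ℤ) : ℤ × ℤ →+ ℤ where
  toFun x := det x u
  map_zero' := by simp [det]
  map_add' x y := by simp only [det, Prod.fst_add, Prod.snd_add]; ring

@[simp] theorem detLeft_apply (u x : ℤ × ℤ) : detLeft u x = det u x := rfl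

@[simp] theorem detRight_apply (u x : ℤ × ℤ) : detRight u x = det x u := rfl

namespace CompleteFan

variable (F : CompleteFan)

/-- The rays lying strictly between `u` and `v`. -/
def inside (u v : ℤ × ℤ) : Finset (ℤ × ℤ) := F.rays.filter fun x => 0 < det u x ∧ 0 < det x v

variable {F}

theorem mem_inside {u v x : ℤ × ℤ} :
    x ∈ F.inside u v ↔ x ∈ F.rays ∧ 0 < det u x ∧ 0 < det x v := Finset.mem_filter

theorem isMaxCone_of_inside_eq_empty {u v : ℤ × ℤ} (hu : u ∈ F.rays) (hv : v ∈ F.rays)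
    (huv : 0 < det u v) (h : F.inside u v = ∅) : F.IsMaxCone u v :=
  ⟨hu, hv, huv, fun x hx hx' => by
    have : x ∈ F.inside u v := mem_inside.mpr ⟨hx, hx'⟩
    simp [h] at this⟩

theorem inside_right_card_lt {u v x : ℤ × ℤ} (huv : 0 < det u v) (hx : x ∈ F.inside u v) :
    (F.inside x v).card < (F.inside u v).card := by
  obtain ⟨-, h1, h2⟩ := mem_inside.mp hx
  refine Finset.card_lt_card ⟨fun y hy => ?_, fun h => ?_⟩
  · obtain ⟨hyF, h3, h4⟩ := mem_inside.mp hy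
    refine mem_inside.mpr ⟨hyF, ?_, h4⟩
    have := det_plucker u x y v
    have h5 : 0 < det u y * det x v := by rw [this]; positivity
    exact pos_of_mul_pos_left h5 h2.le
  · have := (mem_inside.mp (h hx)).2.1
    rw [det_self] at this
    exact lt_irrefl _ this

theorem inside_left_card_lt {u v x : ℤ × ℤ} (huv : 0 < det u v) (hx : x ∈ F.inside u v) :
    (F.inside u x).card < (F.inside u v).card := by
  obtain ⟨-, h1, h2⟩ := mem_inside.mp hx
  refine Finset.card_lt_card ⟨fun y hy => ?_, fun h => ?_⟩
  · obtain ⟨hyF, h3, h4⟩ := mem_inside.mp hy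
    refine mem_inside.mpr ⟨hyF, h3, ?_⟩
    have := det_plucker u y x v
    have h5 : 0 < det u x * det y v := by rw [this]; positivity
    exact pos_of_mul_pos_right h5 h1.le
  · have := (mem_inside.mp (h hx)).2.2
    rw [det_self] at this
    exact lt_irrefl _ this

/-- Completeness provides some cone containing `w`. As long as a ray lies strictly inside, it cuts
the cone in two, and the half containing `w` has fewer rays inside. -/
theorem exists_isMaxCone_mem (w : ℤ × ℤ) :
    ∃ u v, F.IsMaxCone u v ∧ 0 ≤ det u w ∧ 0 ≤ det w v := by
  have key : ∀ (n : ℕ) (u v : ℤ × ℤ), (F.inside u v).card = n → u ∈ F.rays → v ∈ F.rays →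
      0 < det u v → 0 ≤ det u w → 0 ≤ det w v →
      ∃ u v, F.IsMaxCone u v ∧ 0 ≤ det u w ∧ 0 ≤ det w v := by
    intro n
    induction n using Nat.strong_induction_on with
    | _ n ih =>
      rintro u v rfl hu hv huv h1 h2
      rcases (F.inside u v).eq_empty_or_nonempty with h | ⟨x, hx⟩
      · exact ⟨u, v, isMaxCone_of_inside_eq_empty hu hv huv h, h1, h2⟩
      · obtain ⟨hxF, hux, hxv⟩ := mem_inside.mp hx
        rcases le_total 0 (det x w) with h3 | h3
        · exact ih _ (inside_right_card_lt huv hx) x v rfl hxF hv hxv h3 h2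
        · exact ih _ (inside_left_card_lt huv hx) u x rfl hu hxF hux h1
            (by rw [det_swap]; linarith)
  obtain ⟨u, hu, v, hv, huv, h1, h2⟩ := F.complete w
  exact key _ u v rfl hu hv huv h1 h2

theorem exists_pos_of_pos {φ : ℤ × ℤ →+ ℤ} {w : ℤ × ℤ} (hw : 0 < φ w) : ∃ x ∈ F.rays, 0 < φ x := by
  obtain ⟨a, ha, b, hb, hab, h1, h2⟩ := F.complete w
  by_contra! h
  have h3 := congrArg φ (det_smul_eq w a b)
  rw [map_add, map_zsmul, map_zsmul, map_zsmul, smul_eq_mul, smul_eq_mul, smul_eq_mul] at h3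
  have h4 := mul_pos hab hw
  have h5 := mul_nonpos_of_nonneg_of_nonpos h2 (h a ha)
  have h6 := mul_nonpos_of_nonneg_of_nonpos h1 (h b hb)
  linarith

theorem ne_zero_of_mem {u : ℤ × ℤ} (hu : u ∈ F.rays) : u.1 * u.1 + u.2 * u.2 ≠ 0 := by
  intro h
  have h1 : u.1 = 0 := by nlinarith [mul_self_nonneg u.1, mul_self_nonneg u.2]
  have h2 : u.2 = 0 := by nlinarith [mul_self_nonneg u.1, mul_self_nonneg u.2]
  have := F.primitive u hu
  rw [h1, h2] at this
  exact not_isCoprime_zero_zero this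

theorem norm_pos {u : ℤ × ℤ} (hu : u ∈ F.rays) : 0 < u.1 * u.1 + u.2 * u.2 :=
  lt_of_le_of_ne (add_nonneg (mul_self_nonneg _) (mul_self_nonneg _)) (ne_zero_of_mem hu).symm

theorem exists_isMaxCone_left {u : ℤ × ℤ} (hu : u ∈ F.rays) : ∃ v, F.IsMaxCone u v := by
  have key : ∀ (n : ℕ) (v : ℤ × ℤ), (F.inside u v).card = n → v ∈ F.rays →
      0 < det u v → ∃ v, F.IsMaxCone u v := by
    intro n
    induction n using Nat.strong_induction_on with
    | _ n ih =>
      rintro v rfl hv huv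
      rcases (F.inside u v).eq_empty_or_nonempty with h | ⟨x, hx⟩
      · exact ⟨v, isMaxCone_of_inside_eq_empty hu hv huv h⟩
      · obtain ⟨hxF, hux, hxv⟩ := mem_inside.mp hx
        exact ih _ (inside_left_card_lt huv hx) x rfl hxF hux
  -- The test vector is `u` turned by a right angle, on which `det u` is the squared length of `u`.
  obtain ⟨v, hv, huv⟩ := exists_pos_of_pos (F := F) (φ := detLeft u) (w := (-u.2, u.1)) (by
    have := norm_pos hu
    simp only [detLeft_apply, det]
    linarith)
  exact key _ v rfl hv huv

theorem exists_isMaxCone_right {v : ℤ × ℤ} (hv : v ∈ F.rays) : ∃ u, F.IsMaxCone u v := by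
  have key : ∀ (n : ℕ) (u : ℤ × ℤ), (F.inside u v).card = n → u ∈ F.rays →
      0 < det u v → ∃ u, F.IsMaxCone u v := by
    intro n
    induction n using Nat.strong_induction_on with
    | _ n ih =>
      rintro u rfl hu huv
      rcases (F.inside u v).eq_empty_or_nonempty with h | ⟨x, hx⟩
      · exact ⟨u, isMaxCone_of_inside_eq_empty hu hv huv h⟩
      · obtain ⟨hxF, hux, hxv⟩ := mem_inside.mp hx
        exact ih _ (inside_right_card_lt huv hx) x rfl hxF hxv
  obtain ⟨u, hu, huv⟩ := exists_pos_of_pos (F := F) (φ := detRight v) (w := (v.2, -v.1)) (by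
    have := norm_pos hv
    simp only [detRight_apply, det]
    linarith)
  exact key _ u rfl hu huv

theorem eq_of_det_eq_zero {φ : ℤ × ℤ →+ ℤ} {x y : ℤ × ℤ} (hx : x ∈ F.rays) (hy : y ∈ F.rays)
    (h : det x y = 0) (hφx : 0 < φ x) (hφy : 0 < φ y) : x = y := by
  rcases eq_or_eq_neg_of_det_eq_zero (F.primitive x hx) (F.primitive y hy) h with h | h
  · exact h.symm
  · rw [h, map_neg] at hφy
    linarith

theorem IsMaxCone.right_unique {u v v' : ℤ × ℤ} (h : F.IsMaxCone u v) (h' : F.IsMaxCone u v') :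
    v = v' := by
  refine eq_of_det_eq_zero (φ := detLeft u) h.2.1 h'.2.1 (le_antisymm ?_ ?_) h.2.2.1 h'.2.2.1
  · by_contra! hlt
    exact h'.2.2.2 v h.2.1 ⟨h.2.2.1, hlt⟩
  · by_contra! hlt
    exact h.2.2.2 v' h'.2.1 ⟨h'.2.2.1, by rw [det_swap]; linarith⟩

theorem IsMaxCone.left_unique {u u' v : ℤ × ℤ} (h : F.IsMaxCone u v) (h' : F.IsMaxCone u' v) :
    u = u' := by
  refine eq_of_det_eq_zero (φ := detRight v) h.1 h'.1 (le_antisymm ?_ ?_) h.2.2.1 h'.2.2.1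
  · by_contra! hlt
    exact h.2.2.2 u' h'.1 ⟨hlt, h'.2.2.1⟩
  · by_contra! hlt
    exact h'.2.2.2 u h.1 ⟨by rw [det_swap]; linarith, h.2.2.1⟩

variable (F)

open Classical in
/-- The next ray, in counterclockwise order. -/
def next (u : ℤ × ℤ) : ℤ × ℤ := if h : ∃ v, F.IsMaxCone u v then h.choose else 0

open Classical in
/-- The previous ray, in counterclockwise order. -/
def prev (v : ℤ × ℤ) : ℤ × ℤ := if h : ∃ u, F.IsMaxCone u v then h.choose else 0

variable {F}

theorem isMaxCone_next {u : ℤ × ℤ} (hu : u ∈ F.rays) : F.IsMaxCone u (F.next u) := by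
  rw [next, dif_pos (exists_isMaxCone_left hu)]
  exact (exists_isMaxCone_left hu).choose_spec

theorem isMaxCone_prev {u : ℤ × ℤ} (hu : u ∈ F.rays) : F.IsMaxCone (F.prev u) u := by
  rw [prev, dif_pos (exists_isMaxCone_right hu)]
  exact (exists_isMaxCone_right hu).choose_spec

theorem IsMaxCone.next_eq {u v : ℤ × ℤ} (h : F.IsMaxCone u v) : F.next u = v :=
  (isMaxCone_next h.1).right_unique h

theorem IsMaxCone.prev_eq {u v : ℤ × ℤ} (h : F.IsMaxCone u v) : F.prev v = u :=
  (isMaxCone_prev h.2.1).left_unique h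

theorem next_mem {u : ℤ × ℤ} (hu : u ∈ F.rays) : F.next u ∈ F.rays := (isMaxCone_next hu).2.1

theorem prev_mem {u : ℤ × ℤ} (hu : u ∈ F.rays) : F.prev u ∈ F.rays := (isMaxCone_prev hu).1

theorem prev_next {u : ℤ × ℤ} (hu : u ∈ F.rays) : F.prev (F.next u) = u :=
  (isMaxCone_next hu).prev_eq

theorem next_prev {u : ℤ × ℤ} (hu : u ∈ F.rays) : F.next (F.prev u) = u :=
  (isMaxCone_prev hu).next_eq

/-- A ray in a maximal cone is one of its two edges. -/
theorem IsMaxCone.eq_or_eq {u v w : ℤ × ℤ} (h : F.IsMaxCone u v) (hw : w ∈ F.rays)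
    (h1 : 0 ≤ det u w) (h2 : 0 ≤ det w v) : w = u ∨ w = v := by
  rcases h1.eq_or_lt with h1 | h1
  · rcases eq_or_eq_neg_of_det_eq_zero (F.primitive u h.1) (F.primitive w hw) h1.symm with h3 | h3
    · exact Or.inl h3
    · have := h.2.2.1
      have h4 : det w v = -det u v := by rw [h3]; simp [det]; ring
      lia
  · rcases h2.eq_or_lt with h2 | h2
    · rcases eq_or_eq_neg_of_det_eq_zero (F.primitive w hw) (F.primitive v h.2.1) h2.symm
        with h3 | h3
      · exact Or.inr h3.symm
      · have := h.2.2.1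
        have h4 : det u v = -det u w := by rw [h3]; simp [det]; ring
        lia
    · exact absurd ⟨h1, h2⟩ (h.2.2.2 w hw)

variable (F)

/-- All maximal cones are generated by a basis of the lattice. -/
def IsSmooth : Prop := ∀ u v, F.IsMaxCone u v → det u v = 1

/-- Minus the self-intersection number of the curve of the ray `u`. -/
def weight (u : ℤ × ℤ) : ℤ := det (F.prev u) (F.next u)

variable {F}

/-- This is Cramer's identity `det_smul_eq` for `u` with respect to its two neighbours, both
determinants with `u` being one. -/
theorem IsSmooth.next_add_prev (hF : F.IsSmooth) {u : ℤ × ℤ} (hu : u ∈ F.rays) :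
    F.next u + F.prev u = F.weight u • u := by
  have h := det_smul_eq u (F.prev u) (F.next u)
  rw [hF _ _ (isMaxCone_next hu), hF _ _ (isMaxCone_prev hu), one_smul, one_smul] at h
  rw [weight, h, add_comm]

theorem IsSmooth.prev_add_next (hF : F.IsSmooth) {u : ℤ × ℤ} (hu : u ∈ F.rays) :
    F.prev u + F.next u = F.weight u • u := by
  rw [add_comm, hF.next_add_prev hu]

end CompleteFan

/-- Walking along a sequence of lattice vectors `x, n x, n (n x), …` on which `φ` grows. -/
theorem exists_of_walk {R : Finset (ℤ × ℤ)} {n p : ℤ × ℤ → ℤ × ℤ} {a : ℤ × ℤ → ℤ}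
    (hn : ∀ r ∈ R, n r ∈ R) (hpn : ∀ r ∈ R, p (n r) = r) (ha : ∀ r ∈ R, n r + p r = a r • r)
    (φ ψ : ℤ × ℤ →+ ℤ) {x y : ℤ × ℤ} (hx : x ∈ R) (hφ : φ x < φ (n x)) (hφ0 : 0 < φ (n x))
    (hψ : ψ x ≤ ψ (n x)) (hψ0 : 0 < ψ (n x)) (h2 : ∀ r ∈ R, 0 < φ r → r ≠ y → 2 ≤ a r) :
    0 < ψ y ∧ (y = n x ∨ φ (n x) < φ y) := by
  classical
  -- The states of the walk. From `φ (n r) = a r * φ r - φ (p r)` with `a r ≥ 2`, the increments of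
  -- `φ` do not decrease while `φ` is positive, and likewise for `ψ`. So a state other than `y` is
  -- followed by another state with larger `φ`.
  let A := R.filter fun r => 0 < φ r ∧ φ (p r) < φ r ∧ ψ (p r) ≤ ψ r ∧ 0 < ψ r
  have hstep : ∀ r ∈ A, r ≠ y → n r ∈ A ∧ φ r < φ (n r) := by
    intro r hr hry
    obtain ⟨hrR, h3, h4, h5, h6⟩ := Finset.mem_filter.mp hr
    have h7 := h2 r hrR h3 hry
    have h8 := congrArg φ (ha r hrR)
    have h9 := congrArg ψ (ha r hrR)
    rw [map_add, map_zsmul, smul_eq_mul] at h8 h9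
    have h10 : φ r < φ (n r) := by nlinarith
    have h11 : ψ r ≤ ψ (n r) := by nlinarith
    refine ⟨Finset.mem_filter.mpr ⟨hn r hrR, ?_⟩, h10⟩
    rw [hpn r hrR]
    exact ⟨by linarith, h10, h11, by linarith⟩
  have hxA : n x ∈ A := Finset.mem_filter.mpr ⟨hn x hx, by
    rw [hpn x hx]
    exact ⟨hφ0, hφ, hψ, hψ0⟩⟩
  -- Finiteness ends the growth: a state with maximal `φ` has no successor state, and this can only
  -- happen at `y`.
  obtain ⟨r, hr, hmax⟩ := A.exists_max_image φ ⟨_, hxA⟩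
  have hry : r = y := by
    by_contra hry
    obtain ⟨h3, h4⟩ := hstep r hr hry
    exact absurd (hmax _ h3) (not_le.mpr h4)
  subst hry
  refine ⟨(Finset.mem_filter.mp hr).2.2.2.2, ?_⟩
  by_contra! h
  obtain ⟨h3, h4⟩ := hstep _ hxA (Ne.symm h.1)
  have := hmax _ h3
  linarith

end ToricSurface

end

noncomputable section

namespace ToricSurface

/-! ### Marked rays: weights and adjacency. -/

namespace CompleteFan

/-- `a, b, c` are rays of `G` in counterclockwise cyclic order, spanning the plane positively, and
all other rays have weight at least two. -/
structure IsMarking (G : CompleteFan) (a b c : ℤ × ℤ) : Prop where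
  smooth : G.IsSmooth
  mem₁ : a ∈ G.rays
  mem₂ : b ∈ G.rays
  mem₃ : c ∈ G.rays
  det₁₂ : 0 < det a b
  det₂₃ : 0 < det b c
  det₃₁ : 0 < det c a
  two_le : ∀ r ∈ G.rays, r ≠ a → r ≠ b → r ≠ c → 2 ≤ G.weight r

variable {G : CompleteFan} {a b c : ℤ × ℤ}

theorem IsMarking.rotate (h : G.IsMarking a b c) : G.IsMarking b c a :=
  ⟨h.smooth, h.mem₂, h.mem₃, h.mem₁, h.det₂₃, h.det₃₁, h.det₁₂,
    fun r hr h1 h2 h3 => h.two_le r hr h3 h1 h2⟩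

/-- The growing form is `det x`, which by smoothness takes the values `0` and `1` on `x` and `next
x`. The walk therefore stays in the open half-plane to the left of `x`, and only there must the
weights be at least two. -/
theorem IsMarking.walk_next (h : G.IsMarking a b c) (ψ : ℤ × ℤ →+ ℤ) {x y : ℤ × ℤ}
    (hx : x ∈ G.rays) (hψ : ψ x ≤ ψ (G.next x)) (hψ0 : 0 < ψ (G.next x))
    (h2 : ∀ r ∈ G.rays, 0 < det x r → r ≠ y → 2 ≤ G.weight r) :
    0 < ψ y ∧ (y = G.next x ∨ 1 < det x y) := by
  have h1 := h.smooth _ _ (isMaxCone_next hx)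
  have := exists_of_walk (R := G.rays) (fun r hr => next_mem hr) (fun r hr => prev_next hr)
    (fun r hr => h.smooth.next_add_prev hr) (detLeft x) ψ hx
    (by simp only [detLeft_apply]; rw [h1, det_self]; exact zero_lt_one)
    (by simp only [detLeft_apply]; rw [h1]; exact zero_lt_one) hψ hψ0 h2
  simpa only [detLeft_apply, h1] using this

theorem IsMarking.walk_prev (h : G.IsMarking a b c) (ψ : ℤ × ℤ →+ ℤ) {x y : ℤ × ℤ}
    (hx : x ∈ G.rays) (hψ : ψ x ≤ ψ (G.prev x)) (hψ0 : 0 < ψ (G.prev x))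
    (h2 : ∀ r ∈ G.rays, 0 < det r x → r ≠ y → 2 ≤ G.weight r) :
    0 < ψ y ∧ (y = G.prev x ∨ 1 < det y x) := by
  have h1 := h.smooth _ _ (isMaxCone_prev hx)
  have := exists_of_walk (R := G.rays) (fun r hr => prev_mem hr) (fun r hr => next_prev hr)
    (fun r hr => h.smooth.prev_add_next hr) (detRight x) ψ hx
    (by simp only [detRight_apply]; rw [h1, det_self]; exact zero_lt_one)
    (by simp only [detRight_apply]; rw [h1]; exact zero_lt_one) hψ hψ0 h2
  simpa only [detRight_apply, h1] using this

theorem ne_of_det_pos {x y : ℤ × ℤ} (h : 0 < det x y) : x ≠ y := by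
  rintro rfl
  rw [det_self] at h
  exact lt_irrefl _ h

/-- Otherwise the walk counterclockwise from `c` passes `a` unhindered and stops only at `b`, still
in the half-plane `det c > 0`. But `b` lies on the other side of `c`. -/
theorem IsMarking.weight_le (h : G.IsMarking a b c) : G.weight a ≤ 1 := by
  by_contra! ha
  have h1 := h.smooth _ _ (isMaxCone_next h.mem₃)
  have := (h.walk_next (detLeft c) (y := b) h.mem₃
    (by simp only [detLeft_apply]; rw [h1, det_self]; exact zero_le_one)
    (by simp only [detLeft_apply]; rw [h1]; exact zero_lt_one) (fun r hr hr0 hrb => by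
      by_cases hra : r = a
      · subst hra; exact ha
      · exact h.two_le r hr hra hrb (ne_of_det_pos hr0).symm)).1
  rw [detLeft_apply, det_swap] at this
  linarith [h.det₂₃]

theorem IsMarking.eq_next_or (h : G.IsMarking a b c) : b = G.next a ∨ 1 < det a b := by
  have h1 := h.smooth _ _ (isMaxCone_next h.mem₁)
  refine (h.walk_next (detLeft a) (y := b) h.mem₁
    (by simp only [detLeft_apply]; rw [h1, det_self]; exact zero_le_one)
    (by simp only [detLeft_apply]; rw [h1]; exact zero_lt_one) (fun r hr hr0 hrb =>
      h.two_le r hr (ne_of_det_pos hr0).symm hrb ?_)).2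
  rintro rfl
  rw [det_swap] at hr0
  linarith [h.det₃₁]

/-- If `b` followed `a`, then `prev a = a - b`, so `det _ b` would take the value one on both `a`
and `prev a`. The clockwise walk from `a` would keep this form positive until it reached `c`, where
`det c b` is negative. The ray `c` is excluded by orientation alone. -/
theorem IsMarking.next_ne (h : G.IsMarking a b c) (ha : G.weight a = 1) :
    G.next a ≠ b ∧ G.next a ≠ c := by
  have hp := h.smooth _ _ (isMaxCone_prev h.mem₁)
  have hn := h.smooth _ _ (isMaxCone_next h.mem₁)
  have hsum := h.smooth.next_add_prev h.mem₁
  rw [ha, one_smul] at hsum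
  have h31 := h.det₃₁
  have h23 := h.det₂₃
  have h12 := h.det₁₂
  constructor
  · intro hb
    rw [hb] at hsum hn
    have hψ : det (G.prev a) b = 1 := by
      have := (detRight b).map_add b (G.prev a)
      rw [hsum] at this
      simp only [detRight_apply, det_self] at this
      linarith
    have := (h.walk_prev (detRight b) (y := c) h.mem₁
      (by simp only [detRight_apply]; rw [hψ, hn])
      (by simp only [detRight_apply]; rw [hψ]; exact zero_lt_one) (fun r hr hr0 hrc =>
        h.two_le r hr (ne_of_det_pos hr0) (by
          rintro rfl
          rw [det_swap] at hr0
          linarith) hrc)).1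
    rw [detRight_apply, det_swap] at this
    linarith
  · intro hc
    rw [hc, det_swap] at hn
    linarith

theorem IsMarking.prev_ne (h : G.IsMarking a b c) (ha : G.weight a = 1) :
    G.prev a ≠ b ∧ G.prev a ≠ c := by
  have hp := h.smooth _ _ (isMaxCone_prev h.mem₁)
  have hn := h.smooth _ _ (isMaxCone_next h.mem₁)
  have hsum := h.smooth.next_add_prev h.mem₁
  rw [ha, one_smul] at hsum
  have h31 := h.det₃₁
  have h23 := h.det₂₃
  have h12 := h.det₁₂
  constructor
  · intro hb
    rw [hb, det_swap] at hp
    linarith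
  · intro hc
    rw [hc] at hsum hp
    -- The mirror image: if `c` preceded `a`, then `next a = a - c`, and the form `det c` stays
    -- positive along the counterclockwise walk to `b`.
    have hψ : det c (G.next a) = 1 := by
      have := (detLeft c).map_add (G.next a) c
      rw [hsum] at this
      simp only [detLeft_apply, det_self] at this
      linarith
    have := (h.walk_next (detLeft c) (y := b) h.mem₁
      (by simp only [detLeft_apply]; rw [hψ, hp])
      (by simp only [detLeft_apply]; rw [hψ]; exact zero_lt_one) (fun r hr hr0 hrb =>
        h.two_le r hr (ne_of_det_pos hr0).symm hrb (by
          rintro rfl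
          rw [det_swap] at hr0
          linarith))).1
    rw [detLeft_apply, det_swap] at this
    linarith

/-- The walk from `a` to `b` raises `det a` beyond its value one on `next a` unless `b` is adjacent
to `a`, which weight one forbids. The pair `c`, `a` is treated by rotating the marking. -/
theorem IsMarking.two_le_det (h : G.IsMarking a b c) (ha : G.weight a = 1) :
    2 ≤ det a b ∧ 2 ≤ det c a := by
  constructor
  · exact h.eq_next_or.resolve_left (h.next_ne ha).1.symm
  · refine h.rotate.rotate.eq_next_or.resolve_left fun hca => (h.prev_ne ha).2 ?_
    rw [hca, prev_next h.mem₃]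

/-! ### Fans with three rays. -/

section ThreeRays

variable {F : CompleteFan}

theorem isMaxCone_of_rays_eq (hF : F.rays = {a, b, c}) (hab : F.IsMaxCone a b) :
    F.IsMaxCone b c ∧ F.IsMaxCone c a := by
  have hb : b ∈ F.rays := by simp [hF]
  have hc : c ∈ F.rays := by simp [hF]
  have h1 : F.next b = c := by
    have h := (isMaxCone_next hb).2.2.1
    have h2 := next_mem hb
    rw [hF] at h2
    simp only [Finset.mem_insert, Finset.mem_singleton] at h2
    rcases h2 with h2 | h2 | h2
    · rw [h2, det_swap] at h
      linarith [hab.2.2.1]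
    · rw [h2, det_self] at h
      exact absurd h (lt_irrefl _)
    · exact h2
  have hbc := isMaxCone_next hb
  rw [h1] at hbc
  have h3 : F.next c = a := by
    have h := (isMaxCone_next hc).2.2.1
    have h2 := next_mem hc
    rw [hF] at h2
    simp only [Finset.mem_insert, Finset.mem_singleton] at h2
    rcases h2 with h2 | h2 | h2
    · exact h2
    · rw [h2, det_swap] at h
      linarith [hbc.2.2.1]
    · rw [h2, det_self] at h
      exact absurd h (lt_irrefl _)
  have hca := isMaxCone_next hc
  rw [h3] at hca
  exact ⟨hbc, hca⟩

/-- In a complete fan with three rays `a`, `b`, `c`, the ray `a` is followed by `b` or by `c`. -/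
theorem isMaxCone_or (hF : F.rays = {a, b, c}) : F.IsMaxCone a b ∨ F.IsMaxCone a c := by
  have ha : a ∈ F.rays := by simp [hF]
  have h := isMaxCone_next ha
  have h2 := next_mem ha
  have h3 := h.2.2.1
  rw [hF] at h2
  simp only [Finset.mem_insert, Finset.mem_singleton] at h2
  rcases h2 with h2 | h2 | h2 <;> rw [h2] at h h3
  · rw [det_self] at h3
    exact absurd h3 (lt_irrefl _)
  · exact Or.inl h
  · exact Or.inr h

theorem exists_rays_eq (hF : F.rays.card = 3) (ha : a ∈ F.rays) :
    ∃ b c, F.rays = {a, b, c} ∧ F.IsMaxCone a b := by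
  have h1 : (F.rays.erase a).card = 2 := by rw [Finset.card_erase_of_mem ha, hF]
  obtain ⟨b, c, -, h2⟩ := Finset.card_eq_two.mp h1
  have h3 : F.rays = {a, b, c} := by rw [← Finset.insert_erase ha, h2]
  rcases isMaxCone_or h3 with h | h
  · exact ⟨b, c, h3, h⟩
  · exact ⟨c, b, by rw [h3]; congr 1; exact Finset.pair_comm b c, h⟩

/-- The number of singular maximal cones. -/
def singularCount (F : CompleteFan) : ℕ := (F.rays.filter fun u => det u (F.next u) ≠ 1).card

theorem singularCount_eq (hF : F.rays = {a, b, c}) (hab : F.IsMaxCone a b) (h1 : 2 ≤ det a b)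
    (h2 : 2 ≤ det c a) : F.singularCount = if det b c = 1 then 2 else 3 := by
  obtain ⟨hbc, hca⟩ := isMaxCone_of_rays_eq hF hab
  have ha := hab.next_eq
  have hb := hbc.next_eq
  have hc := hca.next_eq
  have h12 := ne_of_det_pos hab.2.2.1
  have h23 := ne_of_det_pos hbc.2.2.1
  have h31 := ne_of_det_pos hca.2.2.1
  have h4 : det a b ≠ 1 := by lia
  have h5 : det c a ≠ 1 := by lia
  rw [singularCount, hF, Finset.filter_insert, Finset.filter_insert, Finset.filter_singleton, ha,
    hb, hc, if_pos h4, if_pos h5]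
  by_cases h : det b c = 1
  · rw [if_neg (not_not.mpr h), if_pos h]
    exact Finset.card_pair h31.symm
  · rw [if_pos h, if_neg h, Finset.card_eq_three]
    exact ⟨a, b, c, h12, h31.symm, h23, rfl⟩

theorem isMarking_of_rays_eq (hG : G.IsSmooth) (hle : F.rays ⊆ G.rays)
    (h2 : ∀ r ∈ G.rays, r ∉ F.rays → 2 ≤ G.weight r) (hF : F.rays = {a, b, c})
    (hab : F.IsMaxCone a b) : G.IsMarking a b c := by
  obtain ⟨hbc, hca⟩ := isMaxCone_of_rays_eq hF hab
  exact ⟨hG, hle hab.1, hle hab.2.1, hle hca.1, hab.2.2.1, hbc.2.2.1, hca.2.2.1,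
    fun r hr h3 h4 h5 => h2 r hr (by simp [hF, h3, h4, h5])⟩

end ThreeRays

/-! ### Omitting a ray of weight one. -/

section BlowDown

variable {H : CompleteFan} {e : ℤ × ℤ}

/-- Omitting a ray `e` of weight one from a smooth fan. -/
theorem isMaxCone_of_erase (hG : G.IsSmooth) (he : e ∈ G.rays) (hH : H.rays = G.rays.erase e)
    (hw : G.weight e = 1) : H.IsMaxCone (G.prev e) (G.next e) := by
  have hp := isMaxCone_prev he
  have hn := isMaxCone_next he
  have hp1 := hG _ _ hp
  have hn1 := hG _ _ hn
  refine ⟨?_, ?_, ?_, fun x hx hx' => ?_⟩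
  · rw [hH]; exact Finset.mem_erase.mpr ⟨ne_of_det_pos hp.2.2.1, hp.1⟩
  · rw [hH]; exact Finset.mem_erase.mpr ⟨(ne_of_det_pos hn.2.2.1).symm, hn.2.1⟩
  · change 0 < G.weight e
    rw [hw]; exact zero_lt_one
  · rw [hH] at hx
    obtain ⟨hxe, hxG⟩ := Finset.mem_erase.mp hx
    rcases le_total 0 (det e x) with h | h
    · rcases hn.eq_or_eq hxG h hx'.2.le with h1 | h1
      · exact hxe h1
      · rw [h1, det_self] at hx'
        exact lt_irrefl _ hx'.2
    · rcases hp.eq_or_eq hxG hx'.1.le (by rw [det_swap]; linarith) with h1 | h1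
      · rw [h1, det_self] at hx'
        exact lt_irrefl _ hx'.1
      · exact hxe h1

theorem next_of_erase (hH : H.rays = G.rays.erase e) {r : ℤ × ℤ} (hr : r ∈ H.rays)
    (hre : r ≠ G.prev e) : H.next r = G.next r := by
  rw [hH] at hr
  obtain ⟨h1, hrG⟩ := Finset.mem_erase.mp hr
  have h := isMaxCone_next hrG
  refine IsMaxCone.next_eq ⟨by rw [hH]; exact hr, ?_, h.2.2.1, fun x hx => ?_⟩
  · rw [hH]
    refine Finset.mem_erase.mpr ⟨?_, h.2.1⟩
    intro h2
    apply hre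
    rw [← h2, prev_next hrG]
  · rw [hH] at hx
    exact h.2.2.2 x (Finset.mem_of_mem_erase hx)

theorem prev_of_erase (hH : H.rays = G.rays.erase e) {r : ℤ × ℤ} (hr : r ∈ H.rays)
    (hre : r ≠ G.next e) : H.prev r = G.prev r := by
  rw [hH] at hr
  obtain ⟨h1, hrG⟩ := Finset.mem_erase.mp hr
  have h := isMaxCone_prev hrG
  refine IsMaxCone.prev_eq ⟨?_, by rw [hH]; exact hr, h.2.2.1, fun x hx => ?_⟩
  · rw [hH]
    refine Finset.mem_erase.mpr ⟨?_, h.1⟩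
    intro h2
    apply hre
    rw [← h2, next_prev hrG]
  · rw [hH] at hx
    exact h.2.2.2 x (Finset.mem_of_mem_erase hx)

theorem weight_of_erase (hH : H.rays = G.rays.erase e) {r : ℤ × ℤ} (hr : r ∈ H.rays)
    (hp : r ≠ G.prev e) (hn : r ≠ G.next e) : H.weight r = G.weight r := by
  rw [weight, weight, next_of_erase hH hr hp, prev_of_erase hH hr hn]

theorem prev_ne_next (hw : G.weight e = 1) :
    G.prev e ≠ G.next e := by
  refine ne_of_det_pos ?_
  change 0 < G.weight e
  rw [hw]; exact zero_lt_one

/-- The successor of `prev e` changes from `e` to `next e = e - prev e`, which lowers the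
determinant with `prev (prev e)` by one. -/
theorem weight_prev_of_erase (hG : G.IsSmooth) (he : e ∈ G.rays) (hH : H.rays = G.rays.erase e)
    (hw : G.weight e = 1) : H.weight (G.prev e) = G.weight (G.prev e) - 1 := by
  have h1 := isMaxCone_of_erase hG he hH hw
  have hsum := hG.next_add_prev he
  have hp := prev_mem he
  rw [hw, one_smul] at hsum
  rw [weight, weight, h1.next_eq, prev_of_erase hH h1.1 (prev_ne_next hw), next_prev he]
  have h2 := hG _ _ (isMaxCone_prev hp)
  have h3 := (detLeft (G.prev (G.prev e))).map_add (G.next e) (G.prev e)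
  rw [hsum] at h3
  simp only [detLeft_apply, h2] at h3
  linarith

theorem weight_next_of_erase (hG : G.IsSmooth) (he : e ∈ G.rays) (hH : H.rays = G.rays.erase e)
    (hw : G.weight e = 1) : H.weight (G.next e) = G.weight (G.next e) - 1 := by
  have h1 := isMaxCone_of_erase hG he hH hw
  have hsum := hG.next_add_prev he
  have hp := next_mem he
  rw [hw, one_smul] at hsum
  rw [weight, weight, h1.prev_eq, next_of_erase hH h1.2.1 (prev_ne_next hw).symm,
    prev_next he]
  have h2 := hG _ _ (isMaxCone_next hp)
  have h3 := (detRight (G.next (G.next e))).map_add (G.next e) (G.prev e)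
  rw [hsum] at h3
  simp only [detRight_apply, h2] at h3
  linarith

/-- After omitting a marked ray of weight one, one of its neighbours is marked instead. -/
theorem exists_marking_of_erase {F₁ F₂ : CompleteFan} (hG : G.IsSmooth) (hHs : H.IsSmooth)
    (he : e ∈ G.rays) (hH : H.rays = G.rays.erase e) (hw : G.weight e = 1)
    (h₁ : F₁.rays ⊆ G.rays) (h₂ : F₂.rays ⊆ H.rays) (hc₁ : F₁.rays.card = 3)
    (hc₂ : F₂.rays.card = 3) (hG2 : ∀ r ∈ G.rays, r ∉ F₁.rays → 2 ≤ G.weight r)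
    (hH2 : ∀ r ∈ H.rays, r ∉ F₂.rays → 2 ≤ H.weight r) :
    ∃ a b c, F₁.rays = {e, a, b} ∧ F₁.IsMaxCone e a ∧ G.IsMarking e a b ∧
      F₂.rays = {c, a, b} ∧ F₂.IsMaxCone c a ∧ H.IsMarking c a b ∧
      (c = G.prev e ∨ c = G.next e) ∧ a ≠ G.prev e ∧ b ≠ G.prev e ∧ a ≠ G.next e ∧
      b ≠ G.next e := by
  have heF : e ∈ F₁.rays := by
    by_contra h
    linarith [hG2 e he h]
  obtain ⟨a, b, hF₁, hea⟩ := exists_rays_eq hc₁ heF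
  obtain ⟨hab, hbe⟩ := isMaxCone_of_rays_eq hF₁ hea
  have hM := isMarking_of_rays_eq hG h₁ hG2 hF₁ hea
  -- The other two marked rays are not adjacent to `e`, so omitting `e` leaves their weights
  -- unchanged.
  obtain ⟨hna, hnb⟩ := hM.next_ne hw
  obtain ⟨hpa, hpb⟩ := hM.prev_ne hw
  have hae := (ne_of_det_pos hea.2.2.1).symm
  have hbe' := ne_of_det_pos hbe.2.2.1
  have hab' := ne_of_det_pos hab.2.2.1
  have haH : a ∈ H.rays := by rw [hH]; exact Finset.mem_erase.mpr ⟨hae, hM.mem₂⟩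
  have hbH : b ∈ H.rays := by rw [hH]; exact Finset.mem_erase.mpr ⟨hbe', hM.mem₃⟩
  -- A marked ray has weight at most one, and this persists in `H`, where unmarked rays have weight
  -- at least two.
  have haF : a ∈ F₂.rays := by
    by_contra h
    have h3 := hH2 a haH h
    rw [weight_of_erase hH haH hpa.symm hna.symm] at h3
    linarith [hM.rotate.weight_le]
  have hbF : b ∈ F₂.rays := by
    by_contra h
    have h3 := hH2 b hbH h
    rw [weight_of_erase hH hbH hpb.symm hnb.symm] at h3
    linarith [hM.rotate.rotate.weight_le]
  obtain ⟨c, hc⟩ : ∃ c, (F₂.rays.erase a).erase b = {c} := by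
    rw [← Finset.card_eq_one, Finset.card_erase_of_mem (Finset.mem_erase.mpr ⟨hab'.symm, hbF⟩),
      Finset.card_erase_of_mem haF, hc₂]
  have hF₂ : F₂.rays = {a, b, c} := by
    rw [← hc, Finset.insert_erase (Finset.mem_erase.mpr ⟨hab'.symm, hbF⟩),
      Finset.insert_erase haF]
  have hab₂ : F₂.IsMaxCone a b := by
    rcases isMaxCone_or hF₂ with h | h
    · exact h
    · have h3 : F₂.rays = {a, c, b} := by rw [hF₂, Finset.pair_comm b c]
      have h4 := (isMaxCone_of_rays_eq h3 h).2.2.2.1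
      rw [det_swap] at h4
      linarith [hab.2.2.1]
  have hM₂ := (isMarking_of_rays_eq hHs h₂ hH2 hF₂ hab₂).rotate.rotate
  have hca := (isMaxCone_of_rays_eq hF₂ hab₂).2
  have hcH := hM₂.mem₁
  have hca' := ne_of_det_pos hM₂.det₁₂
  have hbc' := ne_of_det_pos hM₂.det₃₁
  have hcG : c ∈ G.rays ∧ c ≠ e := by
    rw [hH, Finset.mem_erase] at hcH
    exact hcH.symm
  refine ⟨a, b, c, hF₁, hea, hM, ?_, hca, hM₂, ?_, hpa.symm, hpb.symm, hna.symm, hnb.symm⟩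
  · rw [hF₂]
    ext x
    simp only [Finset.mem_insert, Finset.mem_singleton]
    tauto
  -- In `H` the marked ray `c` has weight at most one, in `G` it is unmarked and has weight at least
  -- two. Its weight changes, so `c` is adjacent to `e`.
  · by_contra! h
    have h3 := hM₂.weight_le
    rw [weight_of_erase hH hcH h.1 h.2] at h3
    linarith [hM.two_le c hcG.1 hcG.2 hca' hbc'.symm]

/-- The marked ray `c` replacing `e` has weight two before and one after. Both triples thus have a
weight-one vertex with two singular cones and the same opposite cone. The summand `2 - 3` of `c`
compensates the weight lost by the other neighbour of `e`. -/
theorem comparison_of_erase {F₁ F₂ : CompleteFan} (hG : G.IsSmooth) (hHs : H.IsSmooth)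
    (he : e ∈ G.rays) (hH : H.rays = G.rays.erase e) (hw : G.weight e = 1)
    (h₁ : F₁.rays ⊆ G.rays) (h₂ : F₂.rays ⊆ H.rays) (hc₁ : F₁.rays.card = 3)
    (hc₂ : F₂.rays.card = 3) (hG2 : ∀ r ∈ G.rays, r ∉ F₁.rays → 2 ≤ G.weight r)
    (hH2 : ∀ r ∈ H.rays, r ∉ F₂.rays → 2 ≤ H.weight r) :
    F₁.singularCount = F₂.singularCount ∧
      ∑ r ∈ G.rays \ F₁.rays, (G.weight r - 3) = ∑ r ∈ H.rays \ F₂.rays, (H.weight r - 3) := by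
  obtain ⟨a, b, c, hF₁, hea, hM, hF₂, hca, hM₂, hc, hpa, hpb, hna, hnb⟩ :=
    exists_marking_of_erase hG hHs he hH hw h₁ h₂ hc₁ hc₂ hG2 hH2
  have hp := (isMaxCone_of_erase hG he hH hw).1
  have hn := (isMaxCone_of_erase hG he hH hw).2.1
  have hpw := weight_prev_of_erase hG he hH hw
  have hnw := weight_next_of_erase hG he hH hw
  have hpn := prev_ne_next hw
  have hcH := hM₂.mem₁
  have hG2' : ∀ r ∈ H.rays, r ≠ a → r ≠ b → 2 ≤ G.weight r := fun r hr h3 h4 => by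
    rw [hH, Finset.mem_erase] at hr
    exact hM.two_le r hr.2 hr.1 h3 h4
  have hcw : H.weight c = 1 ∧ G.weight c = 2 := by
    have h3 := hM₂.weight_le
    have h4 := hG2' c hcH (ne_of_det_pos hM₂.det₁₂) (ne_of_det_pos hM₂.det₃₁).symm
    rcases hc with hc | hc <;> rw [hc] at h3 h4 ⊢ <;> constructor <;> lia
  constructor
  · obtain ⟨h3, h4⟩ := hM.two_le_det hw
    obtain ⟨h5, h6⟩ := hM₂.two_le_det hcw.1
    rw [singularCount_eq hF₁ hea h3 h4, singularCount_eq hF₂ hca h5 h6]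
  · have hset : G.rays \ F₁.rays = insert c (H.rays \ F₂.rays) := by
      have hce := ne_of_det_pos hM₂.det₁₂
      have hbc := ne_of_det_pos hM₂.det₃₁
      rw [hH, Finset.mem_erase] at hcH
      ext x
      rw [hF₁, hF₂, hH]
      simp only [Finset.mem_sdiff, Finset.mem_insert, Finset.mem_singleton, Finset.mem_erase]
      by_cases hxc : x = c
      · subst hxc
        simp [hcH, hce, hbc.symm]
      · tauto
    have hcn : c ∉ H.rays \ F₂.rays := by simp [hF₂]
    rw [hset, Finset.sum_insert hcn, hcw.2]
    -- Here `d` is the neighbour of `e` other than `c`: the only exceptional ray common to both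
    -- sides whose weight changes.
    obtain ⟨d, hd, hdw, hrest⟩ : ∃ d ∈ H.rays \ F₂.rays, G.weight d = H.weight d + 1 ∧
        ∀ r ∈ H.rays \ F₂.rays, r ≠ d → H.weight r = G.weight r := by
      rcases hc with hc | hc
      · refine ⟨G.next e, ?_, by rw [hnw]; ring, fun r hr hrd => ?_⟩
        · rw [Finset.mem_sdiff, hF₂, hc]
          refine ⟨hn, ?_⟩
          simp [hpn.symm, hna.symm, hnb.symm]
        · rw [Finset.mem_sdiff, hF₂] at hr
          exact weight_of_erase hH hr.1 (fun h => hr.2 (by simp [h, hc])) hrd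
      · refine ⟨G.prev e, ?_, by rw [hpw]; ring, fun r hr hrd => ?_⟩
        · rw [Finset.mem_sdiff, hF₂, hc]
          refine ⟨hp, ?_⟩
          simp [hpn, hpa.symm, hpb.symm]
        · rw [Finset.mem_sdiff, hF₂] at hr
          exact weight_of_erase hH hr.1 hrd (fun h => hr.2 (by simp [h, hc]))
    rw [← Finset.add_sum_erase _ _ hd, ← Finset.add_sum_erase _ _ hd, hdw,
      Finset.sum_congr rfl fun r hr => by
        rw [← hrest r (Finset.mem_of_mem_erase hr) (Finset.ne_of_mem_erase hr)]]
    ring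

end BlowDown

end CompleteFan

end ToricSurface

end

noncomputable section

namespace ToricSurface

open IsLocalRing

/-! ### Positivity of the weights of exceptional rays. -/

namespace CompleteFan

/-- An exceptional ray lies in the interior of a strongly convex cone of `F`, and its neighbours
stay in that closed cone. A multiple `weight r • r` equal to their sum must then be positive.
Minimality excludes weight one, which leaves weight at least two. -/
theorem IsSmooth.weight_pos {F G : CompleteFan} (hG : G.IsSmooth) (hle : F.rays ⊆ G.rays)
    {r : ℤ × ℤ} (hr : r ∈ G.rays) (hrF : r ∉ F.rays) : 0 < G.weight r := by
  obtain ⟨u, v, huv, h1, h2⟩ := F.exists_isMaxCone_mem r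
  have hru : ∀ s ∈ F.rays, det u s = 0 → 0 < det s v → s = u := fun s hs h h' =>
    (huv.eq_or_eq hs h.ge h'.le).resolve_right fun h3 => by
      rw [h3, det_self] at h'
      exact lt_irrefl _ h'
  have hp := isMaxCone_prev hr
  have hn := isMaxCone_next hr
  have hu := hle huv.1
  have hv := hle huv.2.1
  have hD := huv.2.2.1
  have h1' : 0 < det u r := by
    refine lt_of_le_of_ne h1 fun h => ?_
    rcases eq_or_eq_neg_of_det_eq_zero (F.primitive u huv.1) (G.primitive r hr) h.symm with h3 | h3
    · exact hrF (h3 ▸ huv.1)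
    · have h4 : det r v = -det u v := by rw [h3]; simp [det]; ring
      lia
  have h2' : 0 < det r v := by
    refine lt_of_le_of_ne h2 fun h => ?_
    rcases eq_or_eq_neg_of_det_eq_zero (G.primitive r hr) (F.primitive v huv.2.1) h.symm
      with h3 | h3
    · exact hrF (h3 ▸ huv.2.1)
    · have h4 : det u v = -det u r := by rw [h3]; simp [det]; ring
      lia
  have h3 : 0 ≤ det u (G.prev r) := by
    by_contra! h
    exact hp.2.2.2 u hu ⟨by rw [det_swap]; linarith, h1'⟩
  have h4 : 0 ≤ det (G.next r) v := by
    by_contra! h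
    exact hn.2.2.2 v hv ⟨h2', by rw [det_swap]; linarith⟩
  by_contra! hw
  have hsum := congrArg (detRight v) (hG.next_add_prev hr)
  rw [map_add, map_zsmul, smul_eq_mul, detRight_apply, detRight_apply, detRight_apply] at hsum
  have h5 : det (G.prev r) v ≤ 0 := by nlinarith
  -- The Plücker relation writes `det u r * det (prev r) v` as a nonnegative term plus `det u v`, so
  -- it is positive, although `det (prev r) v ≤ 0`.
  have h6 := det_plucker u (G.prev r) r v
  have h7 := hG _ _ hp
  rw [h7, mul_one] at h6
  nlinarith

end CompleteFan

/-! ### The toric model of a fan: prime divisors, exceptional curves and singular points. -/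

variable {k K : Type*} [Field k] [Field K] [Algebra k K] [Algebra (MvPolynomial (Fin 2) k) K]
  [IsScalarTower k (MvPolynomial (Fin 2) k) K] [IsFractionRing (MvPolynomial (Fin 2) k) K]

local notation "χ" => laurentMonomial k K

/-- The toric surface of a complete fan, over an arbitrary model of the function field. -/
def fanModel (k K : Type*) [Field k] [Field K] [Algebra k K]
    [Algebra (MvPolynomial (Fin 2) k) K] [IsScalarTower k (MvPolynomial (Fin 2) k) K]
    [IsFractionRing (MvPolynomial (Fin 2) k) K] (F : CompleteFan) : Set (LocalSubring K) :=
  {R | ∃ u v, F.IsMaxCone u v ∧ R ∈ specModel (chartSubring k K u v)}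

variable {F G : CompleteFan}

theorem fixedPoint_mem_fanModel {u v : ℤ × ℤ} (h : F.IsMaxCone u v) :
    fixedPoint k K u v ∈ fanModel k K F := ⟨u, v, h, fixedPoint_mem_specModel u v⟩

theorem isPrimeDivisor_weightRing {r : ℤ × ℤ} (hr : r ∈ F.rays) :
    IsPrimeDivisor (fanModel k K F) (weightRing k r) :=
  ⟨⟨r, _, CompleteFan.isMaxCone_next hr,
    weightRing_left_mem_specModel (CompleteFan.isMaxCone_next hr).2.2.1 (F.primitive r hr)⟩,
    weightRing_isDiscreteValuationRing (F.primitive r hr)⟩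

theorem hasFractions_of_mem_fanModel {P : LocalSubring K} (hP : P ∈ fanModel k K F) :
    HasFractions P := by
  obtain ⟨u, v, huv, hP⟩ := hP
  exact hasFractions_of_mem_specModel huv.2.2.1 hP

theorem eq_weightRing_of_le {P : LocalSubring K} (hP : P ∈ fanModel k K F)
    [IsDiscreteValuationRing P.toSubring] {w : ℤ × ℤ} (hw : IsCoprime w.1 w.2)
    (h : P.toSubring ≤ (weightRing k w : LocalSubring K).toSubring) : P = weightRing k w := by
  have := weightRing_isDiscreteValuationRing (k := k) (K := K) hw
  exact eq_of_dvr_le (hasFractions_of_mem_fanModel hP) h dvr_ne_top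

/-- The prime divisors of a toric surface which meet the torus contain all characters as units;
the others belong to the rays. -/
theorem IsPrimeDivisor.weightRing_or {P : LocalSubring K}
    (hP : IsPrimeDivisor (fanModel k K F) P) :
    (∃ r ∈ F.rays, P = weightRing k r) ∨ ∀ m, χ m ∈ P.toSubring := by
  obtain ⟨hPF, hdvr⟩ := hP
  obtain ⟨u, v, huv, hP⟩ := id hPF
  have hu := F.primitive u huv.1
  have hv := F.primitive v huv.2.1
  rcases point_trichotomy huv.2.2.1 hP with h | h | h
  · left
    refine ⟨u, huv.1, eq_weightRing_of_le hPF hu ?_⟩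
    rw [h]
    exact fixedPoint_le_weightRing huv.2.2.1 pairing_left_nonneg
  · rcases torus_or_le_weightRing hu pairing_left_nonneg hP h with h | h
    · exact Or.inr h
    · exact Or.inl ⟨u, huv.1, eq_weightRing_of_le hPF hu h⟩
  · rcases torus_or_le_weightRing hv pairing_right_nonneg hP h with h | h
    · exact Or.inr h
    · exact Or.inl ⟨v, huv.2.1, eq_weightRing_of_le hPF hv h⟩

theorem not_forall_laurentMonomial_mem {w : ℤ × ℤ} (hw : IsCoprime w.1 w.2) :
    ¬ ∀ m, χ m ∈ (weightRing k w : LocalSubring K).toSubring := by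
  intro h
  obtain ⟨m, hm⟩ := exists_pairing_eq_one hw
  have := laurentMonomial_mem_weightRing.mp (h (-m))
  rw [pairing_neg_left, hm] at this
  lia

theorem isPrimeDivisor_weightRing_iff {w : ℤ × ℤ} (hw : IsCoprime w.1 w.2) :
    IsPrimeDivisor (fanModel k K F) (weightRing k w) ↔ w ∈ F.rays := by
  refine ⟨fun h => ?_, isPrimeDivisor_weightRing⟩
  rcases h.weightRing_or with ⟨r, hr, h⟩ | h
  · rw [← weightRing_injective hw (F.primitive r hr) h]
    exact hr
  · exact absurd h (not_forall_laurentMonomial_mem hw)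

theorem det_nonneg_of_le_weightRing {u v w : ℤ × ℤ} (huv : 0 < det u v) {P : LocalSubring K}
    (hP : P ∈ specModel (chartSubring k K u v))
    (h : P.toSubring ≤ (weightRing k w : LocalSubring K).toSubring) :
    0 ≤ det u w ∧ 0 ≤ det w v :=
  det_nonneg_of_chartSubring_le huv ((mem_specModel_iff.mp hP).1.trans h)

/-- The fixed point of a cone of `G` lies over a point of a chart of `F`, so each cone of `G` is
contained in a cone of `F`. A ray of `F` interior to a cone of `G` would be an edge of the larger
cone and interior to the smaller one. -/
theorem rays_subset_of_dominates (h : Dominates (fanModel k K G) (fanModel k K F)) :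
    F.rays ⊆ G.rays := by
  intro r hr
  obtain ⟨u, v, huv, h1, h2⟩ := G.exists_isMaxCone_mem r
  obtain ⟨P, ⟨s, t, hst, hP⟩, hPQ⟩ := h _ (fixedPoint_mem_fanModel huv)
  have hu := det_nonneg_of_le_weightRing hst.2.2.1 hP
    (hPQ.1.trans (fixedPoint_le_weightRing huv.2.2.1 pairing_left_nonneg))
  have hv := det_nonneg_of_le_weightRing hst.2.2.1 hP
    (hPQ.1.trans (fixedPoint_le_weightRing huv.2.2.1 pairing_right_nonneg))
  have hD := huv.2.2.1
  by_contra hrG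
  have h1' : 0 < det u r := by
    refine lt_of_le_of_ne h1 fun h => ?_
    rcases eq_or_eq_neg_of_det_eq_zero (G.primitive u huv.1) (F.primitive r hr) h.symm with h3 | h3
    · exact hrG (h3 ▸ huv.1)
    · have h4 : det r v = -det u v := by rw [h3]; simp [det]; ring
      lia
  have h2' : 0 < det r v := by
    refine lt_of_le_of_ne h2 fun h => ?_
    rcases eq_or_eq_neg_of_det_eq_zero (F.primitive r hr) (G.primitive v huv.2.1) h.symm
      with h3 | h3
    · exact hrG (h3 ▸ huv.2.1)
    · have h4 : det u v = -det u r := by rw [h3]; simp [det]; ring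
      lia
  have hs := congrArg (detLeft s) (det_smul_eq r u v)
  have ht := congrArg (detRight t) (det_smul_eq r u v)
  simp only [map_add, map_zsmul, smul_eq_mul, detLeft_apply, detRight_apply] at hs ht
  have hst0 := hst.2.2.1
  have hpl := det_plucker s u v t
  -- Being a ray of `F` in the cone of `s` and `t`, `r` is one of its edges. It is also a positive
  -- combination of `u` and `v`, so both of these lie on the line of that edge, contradicting their
  -- independence.
  have hzero : (det s u = 0 ∧ det s v = 0) ∨ (det u t = 0 ∧ det v t = 0) := by
    have hr1 : 0 ≤ det s r := by
      have := add_nonneg (mul_nonneg h2'.le hu.1) (mul_nonneg h1'.le hv.1)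
      exact nonneg_of_mul_nonneg_right (by rwa [hs]) hD
    have hr2 : 0 ≤ det r t := by
      have := add_nonneg (mul_nonneg h2'.le hu.2) (mul_nonneg h1'.le hv.2)
      exact nonneg_of_mul_nonneg_right (by rwa [ht]) hD
    rcases hst.eq_or_eq hr hr1 hr2 with h3 | h3
    · left
      rw [show det s r = 0 by rw [h3, det_self], mul_zero] at hs
      constructor <;> nlinarith [mul_nonneg h2'.le hu.1, mul_nonneg h1'.le hv.1]
    · right
      rw [show det r t = 0 by rw [h3, det_self], mul_zero] at ht
      constructor <;> nlinarith [mul_nonneg h2'.le hu.2, mul_nonneg h1'.le hv.2]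
  rcases hzero with ⟨h3, h4⟩ | ⟨h3, h4⟩ <;> rw [h3, h4] at hpl <;>
  · have : 0 < det s t * det u v := mul_pos hst0 hD
    lia

/-- All toric models contain the same torus. Curves meeting it are therefore mapped to themselves
and are never exceptional. -/
theorem mem_fanModel_of_torus {P : LocalSubring K} (hP : P ∈ fanModel k K G)
    (h : ∀ m, χ m ∈ P.toSubring) (F : CompleteFan) : P ∈ fanModel k K F := by
  obtain ⟨u, v, -, hP⟩ := hP
  obtain ⟨u', v', huv', -, -⟩ := F.exists_isMaxCone_mem 0
  exact ⟨u', v', huv', mem_specModel_of_torus huv'.2.2.1 hP h⟩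

theorem exceptionalCurves_fanModel (F G : CompleteFan) :
    exceptionalCurves (fanModel k K G) (fanModel k K F) =
      weightRing k '' ((G.rays \ F.rays : Finset (ℤ × ℤ)) : Set (ℤ × ℤ)) := by
  ext E
  constructor
  · rintro ⟨hE, hex⟩
    rcases hE.weightRing_or with ⟨r, hr, rfl⟩ | h
    · refine ⟨r, ?_, rfl⟩
      rw [Finset.mem_coe, Finset.mem_sdiff]
      exact ⟨hr, fun hrF => hex _ (isPrimeDivisor_weightRing hrF).1 le_rfl
        (isPrimeDivisor_weightRing hrF)⟩
    · exact absurd ⟨mem_fanModel_of_torus hE.1 h F, hE.2⟩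
        (hex E (mem_fanModel_of_torus hE.1 h F) le_rfl)
  · rintro ⟨r, hr, rfl⟩
    rw [Finset.mem_coe, Finset.mem_sdiff] at hr
    refine ⟨isPrimeDivisor_weightRing hr.1, fun P hP hPE hPd => hr.2 ?_⟩
    have := hPd.2
    have hr1 := G.primitive r hr.1
    rw [eq_weightRing_of_le hP hr1 hPE.1] at hPd
    exact (isPrimeDivisor_weightRing_iff hr1).mp hPd

theorem weightRing_injOn : Set.InjOn (weightRing k : _ → LocalSubring K) (F.rays : Set (ℤ × ℤ)) :=
  fun _ hu _ hv h => (weightRing_injective (F.primitive _ hu) (F.primitive _ hv) h).symm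

theorem isSmooth_of_isRegularModel (h : IsRegularModel (fanModel k K F)) : F.IsSmooth := by
  intro u v huv
  by_contra hne
  have := huv.2.2.1
  exact fixedPoint_not_regular (by lia) (F.primitive u huv.1) (F.primitive v huv.2.1)
    (h _ (fixedPoint_mem_fanModel huv))

/-- The rays whose curves pass through the fixed point of a cone are exactly its two edges, and
their orientation tells which one comes first. -/
theorem fixedPoint_next_injOn :
    Set.InjOn (fun u => fixedPoint k K u (F.next u)) (F.rays : Set (ℤ × ℤ)) := by
  intro u hu u' hu' h
  have hc := CompleteFan.isMaxCone_next (Finset.mem_coe.mp hu)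
  have hc' := CompleteFan.isMaxCone_next (Finset.mem_coe.mp hu')
  change fixedPoint k K u _ = fixedPoint k K u' _ at h
  have h1 := det_nonneg_of_le_weightRing hc.2.2.1 (fixedPoint_mem_specModel _ _)
    (h ▸ fixedPoint_le_weightRing (k := k) (K := K) hc'.2.2.1 pairing_left_nonneg)
  have h2 := det_nonneg_of_le_weightRing hc.2.2.1 (fixedPoint_mem_specModel _ _)
    (h ▸ fixedPoint_le_weightRing (k := k) (K := K) hc'.2.2.1 pairing_right_nonneg)
  have h3 := hc'.2.2.1
  rcases hc.eq_or_eq hc'.1 h1.1 h1.2 with h4 | h4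
  · exact h4.symm
  · rcases hc.eq_or_eq hc'.2.1 h2.1 h2.2 with h5 | h5
    · rw [h5, h4, det_swap] at h3
      linarith [hc.2.2.1]
    · rw [h5, ← h4, det_self] at h3
      exact absurd h3 (lt_irrefl _)

theorem singularPoints_fanModel (F : CompleteFan) :
    singularPoints (fanModel k K F) = (fun u => fixedPoint k K u (F.next u)) ''
      ((F.rays.filter fun u => det u (F.next u) ≠ 1 : Finset (ℤ × ℤ)) : Set (ℤ × ℤ)) := by
  ext P
  constructor
  · rintro ⟨⟨u, v, huv, hP⟩, hreg⟩
    have hu := F.primitive u huv.1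
    have hv := F.primitive v huv.2.1
    have hPe : P = fixedPoint k K u v := by
      by_contra hne
      exact hreg (isRegularLocalRing_of_ne_fixedPoint huv.2.2.1 hu hv hP hne)
    refine ⟨u, ?_, ?_⟩
    · rw [Finset.mem_coe, Finset.mem_filter, huv.next_eq]
      exact ⟨huv.1, fun h => hreg (isRegularLocalRing_of_det_eq_one h hP)⟩
    · change fixedPoint k K u (F.next u) = P
      rw [huv.next_eq, hPe]
  · rintro ⟨u, hu, rfl⟩
    rw [Finset.mem_coe, Finset.mem_filter] at hu
    have hc := CompleteFan.isMaxCone_next hu.1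
    have h1 := hc.2.2.1
    have h2 := hu.2
    exact ⟨fixedPoint_mem_fanModel hc, fixedPoint_not_regular (by lia) (F.primitive u hc.1)
      (F.primitive _ hc.2.1)⟩

theorem singularPoints_finite (F : CompleteFan) : (singularPoints (fanModel k K F)).Finite := by
  rw [singularPoints_fanModel]
  exact (Finset.finite_toSet _).image _

theorem ncard_singularPoints (F : CompleteFan) :
    (singularPoints (fanModel k K F)).ncard = F.singularCount := by
  rw [singularPoints_fanModel, Set.InjOn.ncard_image, Set.ncard_coe_finset]
  · rfl
  · exact fixedPoint_next_injOn.mono (Finset.coe_subset.mpr (Finset.filter_subset _ _))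

/-- Two distinct invariant curves can only meet in the fixed point of a maximal cone. -/
theorem eq_fixedPoint_of_le {r s : ℤ × ℤ} (hr : r ∈ F.rays) (hs : s ∈ F.rays) (hrs : r ≠ s)
    {P : LocalSubring K} (hP : P ∈ fanModel k K F)
    (hPr : P.toSubring ≤ (weightRing k r : LocalSubring K).toSubring)
    (hPs : P.toSubring ≤ (weightRing k s : LocalSubring K).toSubring) :
    (F.IsMaxCone r s ∧ P = fixedPoint k K r s) ∨ (F.IsMaxCone s r ∧ P = fixedPoint k K s r) := by
  obtain ⟨u, v, huv, hP⟩ := hP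
  have hr1 := det_nonneg_of_le_weightRing huv.2.2.1 hP hPr
  have hs1 := det_nonneg_of_le_weightRing huv.2.2.1 hP hPs
  have hr2 := F.primitive r hr
  have hs2 := F.primitive s hs
  have hle : ∀ a b, IsCoprime a.1 a.2 → IsCoprime b.1 b.2 →
      P.toSubring ≤ (weightRing k b : LocalSubring K).toSubring →
      (∀ m, 0 ≤ pairing m a → χ m ∈ P.toSubring) → b = a := fun a b ha hb h h' =>
    eq_of_weightRing_le ha hb fun m hm => laurentMonomial_mem_weightRing.mp (h (h' m hm))
  rcases huv.eq_or_eq hr hr1.1 hr1.2 with rfl | rfl <;>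
    rcases huv.eq_or_eq hs hs1.1 hs1.2 with rfl | rfl
  · exact absurd rfl hrs
  · refine Or.inl ⟨huv, ?_⟩
    rcases point_trichotomy huv.2.2.1 hP with h | h | h
    · exact h
    · exact absurd (hle _ _ hr2 hs2 hPs h).symm hrs
    · exact absurd (hle _ _ hs2 hr2 hPr h) hrs
  · refine Or.inr ⟨huv, ?_⟩
    rcases point_trichotomy huv.2.2.1 hP with h | h | h
    · exact h
    · exact absurd (hle _ _ hs2 hr2 hPr h) hrs
    · exact absurd (hle _ _ hr2 hs2 hPs h).symm hrs
  · exact absurd rfl hrs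

/-- Every nontrivial monomial of the chart is positive on `u` or on `v`, so it vanishes on one of
the two curves; these monomials generate the maximal ideal. The two curves thus meet with
multiplicity one. -/
theorem curveIdeal_sup_eq {u v : ℤ × ℤ} (huv : 0 < det u v)
    (hu : (fixedPoint k K u v).toSubring ≤ (weightRing k u : LocalSubring K).toSubring)
    (hv : (fixedPoint k K u v).toSubring ≤ (weightRing k v : LocalSubring K).toSubring) :
    curveIdeal hu ⊔ curveIdeal hv = maximalIdeal (fixedPoint k K u v).toSubring := by
  apply le_antisymm
  · apply sup_le <;> exact le_maximalIdeal (Ideal.IsPrime.ne_top (Ideal.IsPrime.comap _))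
  · refine maximalIdeal_fixedPoint_le huv fun m hm hmP => ?_
    have hpos : ∀ w (hw : (fixedPoint k K u v).toSubring ≤
        (weightRing k w : LocalSubring K).toSubring), 0 < pairing m w →
        (⟨χ m, hmP⟩ : (fixedPoint k K u v).toSubring) ∈ curveIdeal hw := by
      intro w hw h
      rw [curveIdeal, Ideal.mem_comap, mem_maximalIdeal_iff]
      right
      change (χ m)⁻¹ ∉ _
      rw [← laurentMonomial_neg, laurentMonomial_mem_weightRing, pairing_neg_left]
      lia
    have h1 := pairing_add_pos huv hm.1 hm.2
    rw [pairing_add_right] at h1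
    rcases (show 0 < pairing m u ∨ 0 < pairing m v by lia) with h | h
    · exact Ideal.mem_sup_left (hpos u hu h)
    · exact Ideal.mem_sup_right (hpos v hv h)

theorem length_quotient_maximalIdeal (R : Type*) [CommRing R] [IsLocalRing R] {I : Ideal R}
    (hI : I = maximalIdeal R) : Module.length R (R ⧸ I) = 1 := by
  subst hI
  rw [Module.length_eq_one_iff]
  exact (isSimpleModule_iff_isCoatom).mpr (Ideal.isMaximal_def.mp inferInstance)

/-! ### Intersection and self-intersection numbers of invariant curves. -/

theorem intersectionNumber_comm_fixedPoint {r s : ℤ × ℤ} (hr : r ∈ F.rays) (hs : s ∈ F.rays)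
    (hrs : F.IsMaxCone r s) :
    intersectionNumber (fanModel k K F) (weightRing k r) (weightRing k s) = 1 ∧
      intersectionNumber (fanModel k K F) (weightRing k s) (weightRing k r) = 1 := by
  have hne := CompleteFan.ne_of_det_pos hrs.2.2.1
  have hno : ¬ F.IsMaxCone s r := fun h => by
    have := h.2.2.1
    rw [det_swap] at this
    linarith [hrs.2.2.1]
  have hr1 := fixedPoint_le_weightRing (k := k) (K := K) hrs.2.2.1 pairing_left_nonneg
  have hs1 := fixedPoint_le_weightRing (k := k) (K := K) hrs.2.2.1 pairing_right_nonneg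
  have hP := fixedPoint_mem_fanModel (k := k) (K := K) hrs
  constructor
  · classical
    rw [intersectionNumber, finsum_eq_single _ (fixedPoint k K r s), finsum_eq_dif,
      dif_pos ⟨hP, hr1, hs1⟩,
      length_quotient_maximalIdeal _ (curveIdeal_sup_eq hrs.2.2.1 hr1 hs1)]
    · rfl
    · intro P hPne
      rw [finsum_eq_dif, dif_neg]
      rintro ⟨h1, h2, h3⟩
      rcases eq_fixedPoint_of_le hr hs hne h1 h2 h3 with h | h
      · exact hPne h.2
      · exact hno h.1
  · classical
    rw [intersectionNumber, finsum_eq_single _ (fixedPoint k K r s), finsum_eq_dif,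
      dif_pos ⟨hP, hs1, hr1⟩,
      length_quotient_maximalIdeal _ ((sup_comm _ _).trans (curveIdeal_sup_eq hrs.2.2.1 hr1 hs1))]
    · rfl
    · intro P hPne
      rw [finsum_eq_dif, dif_neg]
      rintro ⟨h1, h2, h3⟩
      rcases eq_fixedPoint_of_le hs hr hne.symm h1 h2 h3 with h | h
      · exact hno h.1
      · exact hPne h.2

theorem intersectionNumber_eq_zero {r s : ℤ × ℤ} (hr : r ∈ F.rays) (hs : s ∈ F.rays)
    (hne : r ≠ s) (h1 : ¬ F.IsMaxCone r s) (h2 : ¬ F.IsMaxCone s r) :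
    intersectionNumber (fanModel k K F) (weightRing k r) (weightRing k s) = 0 := by
  classical
  rw [intersectionNumber, finsum_eq_zero_of_forall_eq_zero]
  intro P
  rw [finsum_eq_dif, dif_neg]
  rintro ⟨h3, h4, h5⟩
  rcases eq_fixedPoint_of_le hr hs hne h3 h4 h5 with h | h
  · exact h1 h.1
  · exact h2 h.1

theorem ordAt_weightRing {w : ℤ × ℤ} (hw : IsCoprime w.1 w.2) (m : ℤ × ℤ) :
    ordAt (weightRing k w : LocalSubring K) (χ m) = pairing m w := by
  have := weightRing_isDiscreteValuationRing (k := k) (K := K) hw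
  exact (hasOrd_weightRing_laurentMonomial hw m).ordAt_eq

theorem ordAt_eq_zero_of_torus {P : LocalSubring K} [IsDiscreteValuationRing P.toSubring]
    (h : ∀ m, χ m ∈ P.toSubring) (m : ℤ × ℤ) : ordAt P (χ m) = 0 := by
  refine (hasOrd_zero_of_unit (laurentMonomial_ne_zero m) (h m) ?_).ordAt_eq
  rw [← laurentMonomial_neg]
  exact h (-m)

/-- A character has order zero along curves meeting the torus, and only the two neighbouring
invariant curves meet the curve of `r`, each once. The sum is `pairing m (prev r + next r)`, which
equals `weight r * pairing m r`. -/
theorem sum_ordAt_mul_intersectionNumber (hF : F.IsSmooth) {r : ℤ × ℤ} (hr : r ∈ F.rays)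
    {m : ℤ × ℤ} (hm : pairing m r = 1) :
    ∑ᶠ (D : LocalSubring K) (_ : IsPrimeDivisor (fanModel k K F) D ∧ D ≠ weightRing k r),
      ordAt D (χ m) * (intersectionNumber (fanModel k K F) D (weightRing k r) : ℤ) =
      F.weight r := by
  classical
  have hn := CompleteFan.isMaxCone_next hr
  have hp := CompleteFan.isMaxCone_prev hr
  have hnr := (CompleteFan.ne_of_det_pos hn.2.2.1).symm
  have hpr := CompleteFan.ne_of_det_pos hp.2.2.1
  have hpn : F.prev r ≠ F.next r := by
    intro h
    have h1 := hn.2.2.1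
    rw [← h, det_swap] at h1
    linarith [hp.2.2.1]
  have hwr : ∀ s ∈ F.rays, s ≠ r → (weightRing k s : LocalSubring K) ≠ weightRing k r :=
    fun s hs hsr h => hsr (weightRing_injOn (F := F) hs hr h)
  refine (finsum_mem_eq_sum_of_inter_support_eq (s := {D | IsPrimeDivisor (fanModel k K F) D ∧
      D ≠ weightRing k r}) (t := {weightRing k (F.prev r), weightRing k (F.next r)})
      (fun D => ordAt D (χ m) * (intersectionNumber (fanModel k K F) D (weightRing k r) : ℤ))
      ?_).trans ?_
  · ext D
    simp only [Set.mem_inter_iff, Function.mem_support, Finset.coe_insert, Finset.coe_singleton,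
      Set.mem_insert_iff, Set.mem_singleton_iff, Set.mem_ofPred_eq]
    constructor
    · rintro ⟨⟨hD, hDr⟩, h0⟩
      refine ⟨?_, h0⟩
      rcases hD.weightRing_or with ⟨s, hs, rfl⟩ | h
      · have hsr : s ≠ r := fun h => hDr (by rw [h])
        by_contra! hc
        apply h0
        rw [intersectionNumber_eq_zero hs hr hsr, Nat.cast_zero, mul_zero]
        · exact fun h => hc.1 (by rw [h.prev_eq])
        · exact fun h => hc.2 (by rw [h.next_eq])
      · have := hD.2
        rw [ordAt_eq_zero_of_torus h, zero_mul] at h0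
        exact absurd rfl h0
    · rintro ⟨rfl | rfl, h0⟩
      · exact ⟨⟨isPrimeDivisor_weightRing hp.1, hwr _ hp.1 hpr⟩, h0⟩
      · exact ⟨⟨isPrimeDivisor_weightRing hn.2.1, hwr _ hn.2.1 hnr⟩, h0⟩
  · rw [Finset.sum_pair fun h => hpn (weightRing_injOn (F := F) hp.1 hn.2.1 h),
      ordAt_weightRing (F.primitive _ hp.1), ordAt_weightRing (F.primitive _ hn.2.1),
      (intersectionNumber_comm_fixedPoint hp.1 hr hp).1,
      (intersectionNumber_comm_fixedPoint hr hn.2.1 hn).2]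
    push_cast
    rw [mul_one, mul_one, ← pairing_add_right, hF.prev_add_next hr]
    have : pairing m (F.weight r • r) = F.weight r * pairing m r := by
      simp [pairing]; ring
    rw [this, hm, mul_one]

end ToricSurface

end

noncomputable section

namespace ToricSurface

open IsLocalRing

variable {k K : Type*} [Field k] [Field K] [Algebra k K] [Algebra (MvPolynomial (Fin 2) k) K]
  [IsScalarTower k (MvPolynomial (Fin 2) k) K] [IsFractionRing (MvPolynomial (Fin 2) k) K]

local notation "χ" => laurentMonomial k K
local notation "ι" => algebraMap (MvPolynomial (Fin 2) k) K

/-! ### Units on the torus and the Picard number. -/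

theorem algebraMap_ne_zero {g : MvPolynomial (Fin 2) k} (hg : g ≠ 0) : ι g ≠ 0 :=
  (map_ne_zero_iff _ (IsFractionRing.injective _ K)).mpr hg

theorem algebraMap_mem_quadrant (g : MvPolynomial (Fin 2) k) :
    ι g ∈ chartSubring k K (1, 0) (0, 1) := by
  induction g using MvPolynomial.induction_on with
  | C a =>
    rw [← MvPolynomial.algebraMap_eq, ← IsScalarTower.algebraMap_apply]
    exact algebraMap_mem_chartSubring _ _ a
  | add p q hp hq => rw [map_add]; exact add_mem hp hq
  | mul_X p i hp =>
    rw [map_mul]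
    refine mul_mem hp ?_
    fin_cases i
    · have h : χ (1, 0) = ι (MvPolynomial.X 0) := by simp [laurentMonomial]
      exact h ▸ laurentMonomial_mem_chartSubring (by simp [dualCone, pairing])
    · have h : χ (0, 1) = ι (MvPolynomial.X 1) := by simp [laurentMonomial]
      exact h ▸ laurentMonomial_mem_chartSubring (by simp [dualCone, pairing])

theorem exists_of_mem_quadrant {x : K} (hx : x ∈ chartSubring k K (1, 0) (0, 1)) :
    ∃ g, ι g = x := by
  refine monomialSpan_induction (p := fun x => ∃ g, ι g = x) (fun m hm => ?_) ⟨0, map_zero _⟩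
    ?_ ?_ hx
  · have h1 : 0 ≤ m.1 := by simpa [pairing] using hm.1
    have h2 : 0 ≤ m.2 := by simpa [pairing] using hm.2
    obtain ⟨a, ha⟩ := Int.eq_ofNat_of_zero_le h1
    obtain ⟨b, hb⟩ := Int.eq_ofNat_of_zero_le h2
    exact ⟨MvPolynomial.X 0 ^ a * MvPolynomial.X 1 ^ b, by simp [laurentMonomial, ha, hb]⟩
  · rintro _ _ ⟨g, rfl⟩ ⟨h, rfl⟩
    exact ⟨g + h, map_add _ _ _⟩
  · rintro a _ ⟨g, rfl⟩
    refine ⟨MvPolynomial.C a * g, ?_⟩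
    rw [map_mul, ← MvPolynomial.algebraMap_eq, ← IsScalarTower.algebraMap_apply, Algebra.smul_def]

variable (k K) in
/-- The polynomial ring, as the coordinate ring of the chart of the first quadrant. -/
def quadrantHom : MvPolynomial (Fin 2) k →+* chartSubring k K (1, 0) (0, 1) :=
  (ι).codRestrict _ algebraMap_mem_quadrant

theorem quadrantHom_bijective : Function.Bijective (quadrantHom k K) := by
  constructor
  · intro g h hgh
    exact IsFractionRing.injective (MvPolynomial (Fin 2) k) K (congrArg Subtype.val hgh)
  · rintro ⟨x, hx⟩
    obtain ⟨g, hg⟩ := exists_of_mem_quadrant hx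
    exact ⟨g, Subtype.ext hg⟩

variable (k K) in
def quadrantEquiv : MvPolynomial (Fin 2) k ≃+* chartSubring k K (1, 0) (0, 1) :=
  RingEquiv.ofBijective _ quadrantHom_bijective

theorem coe_quadrantEquiv (g : MvPolynomial (Fin 2) k) :
    ((quadrantEquiv k K g : chartSubring k K (1, 0) (0, 1)) : K) = ι g := rfl

section PrimeRing

variable {p : MvPolynomial (Fin 2) k} (hp : Prime p)

variable (K) in
/-- The local ring of the curve with equation `p`. -/
def primeRing (hp : Prime p) : LocalSubring K :=
  have : (Ideal.span {p}).IsPrime := (Ideal.span_singleton_prime hp.ne_zero).mpr hp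
  LocalSubring.ofPrime (chartSubring k K (1, 0) (0, 1))
    ((Ideal.span {p}).comap (quadrantEquiv k K).symm.toRingHom)

theorem mem_primeRing {x : K} :
    x ∈ (primeRing K hp).toSubring ↔ ∃ g h, ¬ p ∣ h ∧ x = ι g / ι h := by
  have : (Ideal.span {p}).IsPrime := (Ideal.span_singleton_prime hp.ne_zero).mpr hp
  rw [primeRing, mem_ofPrime_iff]
  constructor
  · rintro ⟨g, h, hh, rfl⟩
    refine ⟨(quadrantEquiv k K).symm g, (quadrantEquiv k K).symm h, ?_, ?_⟩
    · rwa [← Ideal.mem_span_singleton]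
    · rw [← coe_quadrantEquiv, ← coe_quadrantEquiv, RingEquiv.apply_symm_apply,
        RingEquiv.apply_symm_apply]
  · rintro ⟨g, h, hh, rfl⟩
    refine ⟨quadrantEquiv k K g, quadrantEquiv k K h, ?_, rfl⟩
    intro hmem
    apply hh
    rw [← Ideal.mem_span_singleton]
    have := Ideal.mem_comap.mp hmem
    simpa using this

theorem primeRing_mem_specModel :
    primeRing K hp ∈ specModel (chartSubring k K (1, 0) (0, 1)) :=
  have : (Ideal.span {p}).IsPrime := (Ideal.span_singleton_prime hp.ne_zero).mpr hp
  ⟨_, inferInstance, rfl⟩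

theorem algebraMap_mem_primeRing (g : MvPolynomial (Fin 2) k) :
    ι g ∈ (primeRing K hp).toSubring :=
  (mem_primeRing hp).mpr ⟨g, 1, hp.not_dvd_one, by simp⟩

theorem inv_algebraMap_mem_primeRing {h : MvPolynomial (Fin 2) k} (hh : ¬ p ∣ h) :
    (ι h)⁻¹ ∈ (primeRing K hp).toSubring :=
  (mem_primeRing hp).mpr ⟨1, h, hh, by simp⟩

/-- A fraction with denominator divisible by `p`, but not its numerator, is not defined along the
curve `p = 0`. -/
theorem div_notMem_primeRing {g h : MvPolynomial (Fin 2) k} (h0 : h ≠ 0) (hg : ¬ p ∣ g)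
    (hh : p ∣ h) : ι g / ι h ∉ (primeRing K hp).toSubring := by
  rw [mem_primeRing]
  rintro ⟨a, s, hs, heq⟩
  have hs0 : s ≠ 0 := by rintro rfl; exact hs (dvd_zero p)
  rw [div_eq_div_iff (algebraMap_ne_zero h0) (algebraMap_ne_zero hs0), ← map_mul, ← map_mul] at heq
  have heq' := IsFractionRing.injective _ K heq
  rcases hp.dvd_or_dvd (heq' ▸ dvd_mul_of_dvd_right hh a : p ∣ g * s) with h1 | h1
  · exact hg h1
  · exact hs h1

/-- A nonzero polynomial is a power of `p` times a polynomial not divisible by `p`, and the latter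
is a unit here. -/
theorem primeRing_isDiscreteValuationRing :
    IsDiscreteValuationRing (primeRing K hp).toSubring := by
  have hp0 : ι p ≠ 0 := algebraMap_ne_zero hp.ne_zero
  have hnu : (ι p)⁻¹ ∉ (primeRing K hp).toSubring := by
    have := div_notMem_primeRing (K := K) hp hp.ne_zero hp.not_dvd_one dvd_rfl
    rwa [map_one, one_div] at this
  have hfac : ∀ x : (primeRing K hp).toSubring, x ≠ 0 → ∃ (n : ℕ)
      (u : (primeRing K hp).toSubring), IsUnit u ∧ (x : K) = ι p ^ n * u := by
    intro x hx
    obtain ⟨g, h, hh, hgh⟩ := (mem_primeRing hp).mp x.2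
    have hx0 : (x : K) ≠ 0 := fun h => hx (Subtype.ext h)
    have hg0 : g ≠ 0 := by
      rintro rfl
      rw [map_zero, zero_div] at hgh
      exact hx0 hgh
    obtain ⟨n, c, hc, hgc⟩ := WfDvdMonoid.max_power_factor hg0 hp.irreducible
    have hc0 : ι c ≠ 0 := algebraMap_ne_zero fun h => hc (h ▸ dvd_zero p)
    have hh0 : ι h ≠ 0 := algebraMap_ne_zero fun h' => hh (h' ▸ dvd_zero p)
    refine ⟨n, ⟨ι c / ι h, (mem_primeRing hp).mpr ⟨c, h, hh, rfl⟩⟩,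
      isUnit_iff_inv_mem.mpr ⟨div_ne_zero hc0 hh0, ?_⟩, ?_⟩
    · change (ι c / ι h)⁻¹ ∈ _
      rw [inv_div]
      exact (mem_primeRing hp).mpr ⟨h, c, hc, rfl⟩
    · rw [hgh, hgc, map_mul, map_pow, mul_div_assoc]
  apply IsDiscreteValuationRing.ofHasUnitMulPowIrreducibleFactorization
  refine ⟨⟨ι p, algebraMap_mem_primeRing hp p⟩, ⟨fun h => hnu (isUnit_iff_inv_mem.mp h).2, ?_⟩,
    fun {x} hx => ?_⟩
  · intro a b hab
    have hab' : ι p = a * b := congrArg Subtype.val hab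
    have ha0 : a ≠ 0 := by rintro rfl; exact hp0 (by rw [hab']; simp)
    have hb0 : b ≠ 0 := by rintro rfl; exact hp0 (by rw [hab']; simp)
    obtain ⟨m, u, hu, hau⟩ := hfac a ha0
    obtain ⟨n, v, hv, hbv⟩ := hfac b hb0
    rcases Nat.eq_zero_or_pos m with rfl | hm
    · left
      have : a = u := Subtype.ext (by rw [hau, pow_zero, one_mul])
      exact this ▸ hu
    · rcases Nat.eq_zero_or_pos n with rfl | hn
      · right
        have : b = v := Subtype.ext (by rw [hbv, pow_zero, one_mul])
        exact this ▸ hv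
      · exfalso
        apply hnu
        obtain ⟨i, rfl⟩ := Nat.exists_eq_add_of_lt hm
        obtain ⟨j, rfl⟩ := Nat.exists_eq_add_of_lt hn
        have h1 : (ι p)⁻¹ = ι p ^ (i + j) * u * v := by
          rw [hau, hbv] at hab'
          apply inv_eq_of_mul_eq_one_right
          have h2 : ι p * (ι p * (ι p ^ (i + j) * u * v)) = ι p * 1 := by
            rw [mul_one]
            conv_rhs => rw [hab']
            ring
          exact mul_left_cancel₀ hp0 h2
        rw [h1]
        exact mul_mem (mul_mem (pow_mem (algebraMap_mem_primeRing hp p) _) u.2) v.2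
  · obtain ⟨n, u, hu, hxu⟩ := hfac x hx
    refine ⟨n, hu.unit, Subtype.ext ?_⟩
    rw [hxu]
    rfl

theorem laurentMonomial_mem_primeRing (h0 : ¬ p ∣ MvPolynomial.X 0)
    (h1 : ¬ p ∣ MvPolynomial.X 1) (m : ℤ × ℤ) : χ m ∈ (primeRing K hp).toSubring := by
  have key : ∀ (i : Fin 2), ¬ p ∣ MvPolynomial.X i → ∀ n : ℤ,
      ι (MvPolynomial.X i) ^ n ∈ (primeRing K hp).toSubring := by
    intro i hi n
    cases n with
    | ofNat n =>
      rw [Int.ofNat_eq_natCast, zpow_natCast]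
      exact pow_mem (algebraMap_mem_primeRing hp _) n
    | negSucc n =>
      rw [zpow_negSucc, ← inv_pow]
      exact pow_mem (inv_algebraMap_mem_primeRing hp hi) _
  exact mul_mem (key 0 h0 m.1) (key 1 h1 m.2)

end PrimeRing

/-- Induction on the prime factorization: a prime dividing a coordinate is associated to it, and the
units of the polynomial ring are the constants. -/
theorem eq_const_mul_laurentMonomial_of_dvd {g : MvPolynomial (Fin 2) k} (hg : g ≠ 0)
    (h : ∀ p, Prime p → p ∣ g → p ∣ MvPolynomial.X 0 ∨ p ∣ MvPolynomial.X 1) :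
    ∃ (c : k) (m : ℤ × ℤ), c ≠ 0 ∧ ι g = algebraMap k K c * χ m := by
  have hunit : ∀ u : MvPolynomial (Fin 2) k, IsUnit u → ∃ c : k, c ≠ 0 ∧
      ι u = algebraMap k K c := by
    intro u hu
    obtain ⟨c, hc, rfl⟩ := MvPolynomial.isUnit_iff_eq_C_of_isReduced.mp hu
    exact ⟨c, hc.ne_zero, by
      rw [← MvPolynomial.algebraMap_eq, ← IsScalarTower.algebraMap_apply]⟩
  induction g using UniqueFactorizationMonoid.induction_on_prime with
  | h₁ => exact absurd rfl hg
  | h₂ u hu =>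
    obtain ⟨c, hc, hu⟩ := hunit u hu
    exact ⟨c, 0, hc, by rw [hu, laurentMonomial_zero, mul_one]⟩
  | h₃ a p ha hp ih =>
    obtain ⟨c, m, hc, ham⟩ := ih ha fun q hq hqa => h q hq (dvd_mul_of_dvd_right hqa p)
    have key : ∃ (d : k) (n : ℤ × ℤ), d ≠ 0 ∧ ι p = algebraMap k K d * χ n := by
      have hX : ∀ (i : Fin 2) (n : ℤ × ℤ), ι (MvPolynomial.X i) = χ n → p ∣ MvPolynomial.X i →
          ∃ (d : k) (n : ℤ × ℤ), d ≠ 0 ∧ ι p = algebraMap k K d * χ n := by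
        intro i n hn hpi
        obtain ⟨u, hu⟩ := (hp.irreducible.associated_of_dvd
          (MvPolynomial.X_prime (R := k) (i := i)).irreducible hpi).symm
        obtain ⟨d, hd, hd'⟩ := hunit u u.isUnit
        exact ⟨d, n, hd, by rw [← hu, map_mul, hn, hd', mul_comm]⟩
      rcases h p hp (dvd_mul_right p a) with h1 | h1
      · exact hX 0 (1, 0) (by simp [laurentMonomial]) h1
      · exact hX 1 (0, 1) (by simp [laurentMonomial]) h1
    obtain ⟨d, n, hd, hpn⟩ := key
    refine ⟨d * c, n + m, mul_ne_zero hd hc, ?_⟩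
    rw [map_mul, hpn, ham, map_mul, laurentMonomial_add]
    ring

variable {F : CompleteFan}

/-- A rational function without zeros and poles on the torus is a multiple of a character. -/
theorem eq_const_mul_laurentMonomial {f : K} (hf : f ≠ 0)
    (h : ∀ C, IsPrimeDivisor (fanModel k K F) C → (∀ m, χ m ∈ C.toSubring) → HasOrd C f 0) :
    ∃ (c : k) (m : ℤ × ℤ), c ≠ 0 ∧ f = algebraMap k K c * χ m := by
  obtain ⟨g, ⟨b, hb⟩, hrel, hgb⟩ := IsFractionRing.exists_reduced_fraction
    (A := MvPolynomial (Fin 2) k) f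
  have hb0 : b ≠ 0 := nonZeroDivisors.ne_zero hb
  rw [IsFractionRing.mk'_eq_div] at hgb
  change ι g / ι b = f at hgb
  change IsRelPrime g b at hrel
  have hg0 : g ≠ 0 := by
    rintro rfl
    rw [map_zero, zero_div] at hgb
    exact hf hgb.symm
  -- The curve `p = 0` meets the torus, so its local ring is a prime divisor of every toric model,
  -- and by hypothesis `f` is a unit there.
  have hmem : ∀ p : MvPolynomial (Fin 2) k, (hp : Prime p) → ¬ p ∣ MvPolynomial.X 0 →
      ¬ p ∣ MvPolynomial.X 1 →
      f ∈ (primeRing K hp).toSubring ∧ f⁻¹ ∈ (primeRing K hp).toSubring := by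
    intro p hp h0 h1
    have hall := laurentMonomial_mem_primeRing (K := K) hp h0 h1
    obtain ⟨u, v, huv, -, -⟩ := F.exists_isMaxCone_mem 0
    obtain ⟨ϖ, w, -, hw, hfw⟩ := h (primeRing K hp) ⟨⟨u, v, huv, mem_specModel_of_torus huv.2.2.1
      (primeRing_mem_specModel hp) hall⟩, primeRing_isDiscreteValuationRing hp⟩ hall
    rw [zpow_zero, mul_one] at hfw
    rw [hfw]
    exact ⟨w.2, (isUnit_iff_inv_mem.mp hw).2⟩
  have hdvd : ∀ p : MvPolynomial (Fin 2) k, Prime p → p ∣ g ∨ p ∣ b →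
      p ∣ MvPolynomial.X 0 ∨ p ∣ MvPolynomial.X 1 := by
    intro p hp hpgb
    by_contra! hX
    obtain ⟨h1, h2⟩ := hmem p hp hX.1 hX.2
    rcases hpgb with hpg | hpb
    · rw [← hgb, inv_div] at h2
      exact div_notMem_primeRing hp hg0 (fun hpb => hp.not_isUnit (hrel hpg hpb)) hpg h2
    · rw [← hgb] at h1
      exact div_notMem_primeRing hp hb0 (fun hpg => hp.not_isUnit (hrel hpg hpb)) hpb h1
  obtain ⟨c, m, hc, hgm⟩ := eq_const_mul_laurentMonomial_of_dvd (K := K) hg0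
    fun p hp h => hdvd p hp (Or.inl h)
  obtain ⟨d, n, hd, hbn⟩ := eq_const_mul_laurentMonomial_of_dvd (K := K) hb0
    fun p hp h => hdvd p hp (Or.inr h)
  refine ⟨c / d, m + -n, div_ne_zero hc hd, ?_⟩
  rw [← hgb, hgm, hbn, laurentMonomial_add, laurentMonomial_neg, map_div₀]
  field_simp

/-- A common multiple of the indices of the maximal cones. -/
def CompleteFan.index (F : CompleteFan) : ℤ := ∏ u ∈ F.rays, det u (F.next u)

theorem CompleteFan.index_pos (F : CompleteFan) : 0 < F.index :=
  Finset.prod_pos fun _ hu => (isMaxCone_next hu).2.2.1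

theorem CompleteFan.IsMaxCone.det_dvd_index {u v : ℤ × ℤ} (h : F.IsMaxCone u v) :
    det u v ∣ F.index := by
  rw [← h.next_eq]
  exact Finset.dvd_prod_of_mem _ h.1

/-- A multiple of the invariant curve of the ray `r`. -/
def rayDivisor (k K : Type*) [Field k] [Field K] [Algebra k K]
    [Algebra (MvPolynomial (Fin 2) k) K] [IsScalarTower k (MvPolynomial (Fin 2) k) K]
    [IsFractionRing (MvPolynomial (Fin 2) k) K] {r : ℤ × ℤ} (hr : r ∈ F.rays) :
    WeilDivisor (fanModel k K F) :=
  Finsupp.single ⟨weightRing k r, isPrimeDivisor_weightRing hr⟩ F.index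

theorem rayDivisor_apply_weightRing {r s : ℤ × ℤ} (hr : r ∈ F.rays) (hs : s ∈ F.rays) :
    rayDivisor k K hr ⟨weightRing k s, isPrimeDivisor_weightRing hs⟩ =
      if r = s then F.index else 0 := by
  classical
  rw [rayDivisor, Finsupp.single_apply]
  congr 1
  rw [Subtype.mk.injEq, eq_iff_iff]
  exact ⟨fun h => weightRing_injOn (F := F) hr hs h, fun h => by rw [h]⟩

theorem rayDivisor_apply_torus {r : ℤ × ℤ} (hr : r ∈ F.rays)
    {C : {C : LocalSubring K // IsPrimeDivisor (fanModel k K F) C}}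
    (hC : ∀ m, χ m ∈ C.1.toSubring) : rayDivisor k K hr C = 0 := by
  rw [rayDivisor, Finsupp.single_eq_of_ne]
  rintro rfl
  exact not_forall_laurentMonomial_mem (F.primitive r hr) hC

theorem hasOrd_laurentMonomial_torus {C : LocalSubring K} [IsDiscreteValuationRing C.toSubring]
    (hC : ∀ m, χ m ∈ C.toSubring) (m : ℤ × ℤ) : HasOrd C (χ m) 0 :=
  hasOrd_zero_of_unit (laurentMonomial_ne_zero m) (hC m) (by
    rw [← laurentMonomial_neg]
    exact hC (-m))

/-- On each chart the prescribed values on the two edges are realised by a character, as they are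
divisible by the determinant of the cone. -/
theorem rayDivisor_mem_cartierDivisors {r : ℤ × ℤ} (hr : r ∈ F.rays) :
    rayDivisor k K hr ∈ cartierDivisors (fanModel k K F) := by
  rintro P ⟨u, v, huv, hP⟩
  obtain ⟨q, hq⟩ := huv.det_dvd_index
  -- With `F.index = det u v * q`, the exponent `q • -perp v` has value `F.index` on `u` and `0` on
  -- `v`; `q • perp u` does the reverse.
  let a : ℤ := if r = u then q else 0
  let b : ℤ := if r = v then q else 0
  refine ⟨χ (b • perp u + a • -perp v), fun C hPC => ?_⟩
  obtain ⟨C, hC⟩ := C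
  have hdvr := hC.2
  rcases hC.weightRing_or with ⟨s, hs, rfl⟩ | h
  · change HasOrd (weightRing k s) _ _
    have hs1 := det_nonneg_of_le_weightRing huv.2.2.1 hP hPC
    have hord := hasOrd_weightRing_laurentMonomial (k := k) (K := K) (F.primitive s hs)
      (b • perp u + a • -perp v)
    rw [rayDivisor_apply_weightRing hr hs]
    rw [pairing_add_left, pairing_zsmul_left, pairing_zsmul_left, pairing_perp,
      pairing_neg_perp] at hord
    rcases huv.eq_or_eq hs hs1.1 hs1.2 with rfl | rfl
    · rw [det_self, mul_zero, zero_add] at hord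
      convert hord using 1
      simp only [a]
      split_ifs <;> simp [hq, mul_comm]
    · rw [det_self, mul_zero, add_zero] at hord
      convert hord using 1
      simp only [b]
      split_ifs <;> simp [hq, mul_comm]
  · rw [rayDivisor_apply_torus hr h]
    exact hasOrd_laurentMonomial_torus h _

/-- A relation in the class group between rays off a maximal cone is trivial. -/
theorem eq_zero_of_mem_principalDivisors {u v : ℤ × ℤ} (huv : F.IsMaxCone u v)
    {D : WeilDivisor (fanModel k K F)} (hD : D ∈ principalDivisors (fanModel k K F))
    (htorus : ∀ C : {C : LocalSubring K // IsPrimeDivisor (fanModel k K F) C},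
      (∀ m, χ m ∈ C.1.toSubring) → D C = 0)
    (hu : D ⟨weightRing k u, isPrimeDivisor_weightRing huv.1⟩ = 0)
    (hv : D ⟨weightRing k v, isPrimeDivisor_weightRing huv.2.1⟩ = 0) {r : ℤ × ℤ}
    (hr : r ∈ F.rays) : D ⟨weightRing k r, isPrimeDivisor_weightRing hr⟩ = 0 := by
  obtain ⟨f, hf⟩ := hD
  have hf0 : f ≠ 0 := (hf ⟨weightRing k r, isPrimeDivisor_weightRing hr⟩).ne_zero
  -- A divisor supported on the boundary can only be principal through a character, whose exponent
  -- is determined by its values on `u` and `v`.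
  obtain ⟨c, m, hc, rfl⟩ := eq_const_mul_laurentMonomial hf0 fun C hC hall => by
    have h := hf ⟨C, hC⟩
    rwa [htorus ⟨C, hC⟩ hall] at h
  have key : ∀ s (hs : s ∈ F.rays),
      D ⟨weightRing k s, isPrimeDivisor_weightRing hs⟩ = pairing m s := by
    intro s hs
    have := weightRing_isDiscreteValuationRing (k := k) (K := K) (F.primitive s hs)
    refine (hf ⟨weightRing k s, isPrimeDivisor_weightRing hs⟩).unique
      (hasOrd_weightRing (F.primitive s hs) ?_)
    have h1 : weightVal k s (algebraMap k K c) = ((0 : ℤ) : WithTop ℤ) := weightVal_algebraMap s hc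
    rw [weightVal_mul h1 (weightVal_laurentMonomial s m), zero_add]
  rw [key u huv.1] at hu
  rw [key v huv.2.1] at hv
  rw [key r hr, eq_zero_of_pairing_eq_zero huv.2.2.1.ne' hu hv, pairing_zero_left]

/-- Fix a maximal cone. The Cartier multiples of the curves of the remaining rays are independent in
the Picard group, so Picard number one allows only one such ray; completeness requires at least one.
-/
theorem card_rays_of_picardNumber_eq_one (h : picardNumber (fanModel k K F) = 1) :
    F.rays.card = 3 := by
  classical
  obtain ⟨u, v, huv, -, -⟩ := F.exists_isMaxCone_mem 0
  have huv' := CompleteFan.ne_of_det_pos huv.2.2.1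
  have hcard : ((F.rays.erase u).erase v).card + 2 = F.rays.card := by
    rw [Finset.card_erase_of_mem (Finset.mem_erase.mpr ⟨huv'.symm, huv.2.1⟩),
      Finset.card_erase_of_mem huv.1]
    have : ({u, v} : Finset (ℤ × ℤ)).card ≤ F.rays.card :=
      Finset.card_le_card (by
        rw [Finset.insert_subset_iff, Finset.singleton_subset_iff]
        exact ⟨huv.1, huv.2.1⟩)
    rw [Finset.card_pair huv'] at this
    lia
  have hpos : 0 < ((F.rays.erase u).erase v).card := by
    have hn := CompleteFan.isMaxCone_next huv.2.1
    refine Finset.card_pos.mpr ⟨F.next v, Finset.mem_erase.mpr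
      ⟨(CompleteFan.ne_of_det_pos hn.2.2.1).symm, Finset.mem_erase.mpr ⟨fun h => ?_, hn.2.1⟩⟩⟩
    have h1 := hn.2.2.1
    rw [h, det_swap] at h1
    linarith [huv.2.2.1]
  by_contra hne
  obtain ⟨r, hr, s, hs, hrs⟩ := Finset.one_lt_card.mp
    (by lia : 1 < ((F.rays.erase u).erase v).card)
  simp only [Finset.mem_erase] at hr hs
  obtain ⟨hrv, hru, hr⟩ := hr
  obtain ⟨hsv, hsu, hs⟩ := hs
  let x : cartierDivisors (fanModel k K F) := ⟨_, rayDivisor_mem_cartierDivisors (k := k) hr⟩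
  let y : cartierDivisors (fanModel k K F) := ⟨_, rayDivisor_mem_cartierDivisors (k := k) hs⟩
  have hli : LinearIndependent ℤ
      ![(QuotientAddGroup.mk x : PicardGroup (fanModel k K F)), QuotientAddGroup.mk y] := by
    rw [LinearIndependent.pair_iff]
    intro a b hab
    have hD : a • rayDivisor k K hr + b • rayDivisor k K hs ∈
        principalDivisors (fanModel k K F) := by
      have h1 : (QuotientAddGroup.mk (a • x + b • y) : PicardGroup (fanModel k K F)) = 0 := hab
      rw [QuotientAddGroup.eq_zero_iff] at h1
      exact h1
    have key := fun w (hw : w ∈ F.rays) => eq_zero_of_mem_principalDivisors huv hD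
      (fun C hC => by
        rw [Finsupp.add_apply, Finsupp.smul_apply, Finsupp.smul_apply,
          rayDivisor_apply_torus hr hC, rayDivisor_apply_torus hs hC, smul_zero, smul_zero,
          add_zero])
      (by simp [rayDivisor_apply_weightRing, huv.1, hru, hsu])
      (by simp [rayDivisor_apply_weightRing, huv.2.1, hrv, hsv]) hw
    have h0 := F.index_pos.ne'
    have h1 := key r hr
    have h2 := key s hs
    simp only [Finsupp.add_apply, Finsupp.smul_apply, rayDivisor_apply_weightRing, hr, hs,
      if_neg hrs, if_neg hrs.symm, if_true, smul_eq_mul, mul_zero, add_zero, zero_add,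
      mul_eq_zero, h0, or_false] at h1 h2
    exact ⟨h1, h2⟩
  have hrank : Module.rank ℤ (PicardGroup (fanModel k K F)) = 1 :=
    Module.rank_eq_one_iff_finrank_eq_one.mpr h
  have h2 := hli.cardinal_lift_le_rank
  rw [hrank, Cardinal.mk_fin, Cardinal.lift_natCast, Cardinal.lift_one] at h2
  exact absurd h2 (by norm_num)

end ToricSurface

end

noncomputable section

namespace ToricSurface

variable {k : Type*} [Field k]

/-! ### Transfer to toric surfaces over `k(x, y)`, and the invariants of cascades. -/

theorem character_eq (m : ℤ × ℤ) : character k m = laurentMonomial k (FunField k) m := rfl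

theorem chartRing_toSubring (u v : ℤ × ℤ) :
    (chartRing k u v).toSubring = chartSubring k (FunField k) u v := by
  ext x
  constructor
  · intro hx
    change x ∈ chartRing k u v at hx
    induction hx using Algebra.adjoin_induction with
    | mem x hx =>
      obtain ⟨m, h1, h2, rfl⟩ := hx
      exact laurentMonomial_mem_chartSubring ⟨h1, h2⟩
    | algebraMap c => exact algebraMap_mem_chartSubring u v c
    | add x y _ _ hx hy => exact add_mem hx hy
    | mul x y _ _ hx hy => exact mul_mem hx hy
  · intro hx
    change x ∈ chartRing k u v
    refine monomialSpan_induction (p := fun x => x ∈ chartRing k u v) (fun m hm => ?_)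
      (zero_mem _) (fun _ _ => add_mem) (fun c y hy => Subalgebra.smul_mem _ hy c) hx
    exact Algebra.subset_adjoin ⟨m, hm.1, hm.2, rfl⟩

theorem toricModel_eq (F : CompleteFan) : toricModel k F = fanModel k (FunField k) F := by
  simp only [toricModel, fanModel, chartRing_toSubring]

variable {F G : CompleteFan}

theorem selfIntersection_weightRing (hF : F.IsSmooth) {r : ℤ × ℤ} (hr : r ∈ F.rays) :
    selfIntersection (toricModel k F) (weightRing k r) = -F.weight r := by
  have hcop := F.primitive r hr
  have hex : ∃ m, ordAt (weightRing k r) (character k m) = 1 := by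
    obtain ⟨m, hm⟩ := exists_pairing_eq_one hcop
    exact ⟨m, (ordAt_weightRing hcop m).trans hm⟩
  rw [selfIntersection, dif_pos hex, toricModel_eq]
  congr 1
  refine sum_ordAt_mul_intersectionNumber hF hr ?_
  rw [← ordAt_weightRing (k := k) (K := FunField k) hcop]
  exact hex.choose_spec

theorem isInvariantCurve_weightRing {r : ℤ × ℤ} (hr : r ∈ F.rays) :
    IsInvariantCurve (toricModel k F) (weightRing k r) := by
  rw [toricModel_eq]
  obtain ⟨m, hm⟩ := exists_pairing_eq_one (F.primitive r hr)
  refine ⟨isPrimeDivisor_weightRing hr, m, ?_⟩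
  rw [character_eq, ordAt_weightRing (F.primitive r hr), hm]
  exact one_ne_zero

theorem isMinusOneCurve_weightRing_iff (hF : F.IsSmooth) {r : ℤ × ℤ} (hr : r ∈ F.rays) :
    IsMinusOneCurve (toricModel k F) (weightRing k r) ↔ F.weight r = 1 := by
  rw [IsMinusOneCurve, selfIntersection_weightRing hF hr, neg_inj,
    and_iff_right (isInvariantCurve_weightRing hr)]

theorem exceptionalCurves_toricModel (F G : CompleteFan) :
    exceptionalCurves (toricModel k G) (toricModel k F) =
      weightRing k '' ((G.rays \ F.rays : Finset (ℤ × ℤ)) : Set (ℤ × ℤ)) := by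
  rw [toricModel_eq, toricModel_eq, exceptionalCurves_fanModel]

theorem weightRing_injOn_sdiff (F G : CompleteFan) :
    Set.InjOn (weightRing k : _ → LocalSubring (FunField k))
      ((G.rays \ F.rays : Finset (ℤ × ℤ)) : Set (ℤ × ℤ)) :=
  (weightRing_injOn (F := G)).mono (Finset.coe_subset.mpr Finset.sdiff_subset)

theorem exceptionalCurves_finite {Y X : Model k} (hY : IsToricSurface Y) (hX : IsToricSurface X) :
    (exceptionalCurves Y X).Finite := by
  obtain ⟨G, rfl⟩ := hY
  obtain ⟨F, rfl⟩ := hX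
  rw [exceptionalCurves_toricModel]
  exact (Finset.finite_toSet _).image _

theorem IsToricSurface.singularPoints_finite {X : Model k} (hX : IsToricSurface X) :
    (singularPoints X).Finite := by
  obtain ⟨F, rfl⟩ := hX
  rw [toricModel_eq]
  exact ToricSurface.singularPoints_finite F

theorem trace_sub_count (hG : G.IsSmooth) :
    trace (toricModel k G) (toricModel k F) -
        3 * (exceptionalCount (toricModel k G) (toricModel k F) : ℤ) =
      ∑ r ∈ G.rays \ F.rays, (G.weight r - 3) := by
  have h1 : trace (toricModel k G) (toricModel k F) = ∑ r ∈ G.rays \ F.rays, G.weight r := by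
    rw [trace, exceptionalCurves_toricModel, finsum_mem_image (weightRing_injOn_sdiff F G),
      finsum_mem_coe_finset, ← Finset.sum_neg_distrib]
    refine Finset.sum_congr rfl fun r hr => ?_
    rw [selfIntersection_weightRing hG (Finset.mem_sdiff.mp hr).1, neg_neg]
  have h2 : exceptionalCount (toricModel k G) (toricModel k F) = (G.rays \ F.rays).card := by
    rw [exceptionalCount, exceptionalCurves_toricModel,
      (weightRing_injOn_sdiff F G).ncard_image, Set.ncard_coe_finset]
  rw [h1, h2, Finset.sum_sub_distrib, Finset.sum_const, nsmul_eq_mul, mul_comm]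

theorem isSmooth_of_isRegularModel_toricModel (h : IsRegularModel (toricModel k G)) :
    G.IsSmooth := by
  rw [toricModel_eq] at h
  exact isSmooth_of_isRegularModel h

/-- The combinatorial description of minimal resolutions. -/
theorem IsMinimalResolution.rays (h : IsMinimalResolution (toricModel k G) (toricModel k F)) :
    G.IsSmooth ∧ F.rays ⊆ G.rays ∧ ∀ r ∈ G.rays, r ∉ F.rays → 2 ≤ G.weight r := by
  obtain ⟨-, hreg, hdom, hmin⟩ := h
  have hG := isSmooth_of_isRegularModel_toricModel hreg
  have hle : F.rays ⊆ G.rays := by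
    rw [toricModel_eq, toricModel_eq] at hdom
    exact rays_subset_of_dominates hdom
  refine ⟨hG, hle, fun r hr hrF => ?_⟩
  -- An exceptional curve has positive weight, and weight one would make it a `(-1)`-curve.
  have h1 := hG.weight_pos hle hr hrF
  have h2 : G.weight r ≠ 1 := by
    rw [Ne, ← isMinusOneCurve_weightRing_iff (k := k) hG hr]
    apply hmin
    rw [exceptionalCurves_toricModel]
    exact ⟨r, by rw [Finset.mem_coe, Finset.mem_sdiff]; exact ⟨hr, hrF⟩, rfl⟩
  lia

/-- The combinatorial description of toric blow-downs. -/
theorem IsBlowDown.rays {H : CompleteFan} (h : IsBlowDown (toricModel k G) (toricModel k H)) :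
    ∃ e ∈ G.rays, H.rays = G.rays.erase e ∧ G.weight e = 1 := by
  obtain ⟨-, hreg, -, -, hdom, E, hE, hex⟩ := h
  have hG := isSmooth_of_isRegularModel_toricModel hreg
  have hle : H.rays ⊆ G.rays := by
    rw [toricModel_eq, toricModel_eq] at hdom
    exact rays_subset_of_dominates hdom
  rw [exceptionalCurves_toricModel] at hex
  obtain ⟨e, he, rfl⟩ : E ∈ weightRing k '' ((G.rays \ H.rays : Finset (ℤ × ℤ)) : Set (ℤ × ℤ)) :=
    hex ▸ Set.mem_singleton _
  rw [Finset.mem_coe, Finset.mem_sdiff] at he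
  refine ⟨e, he.1, ?_, (isMinusOneCurve_weightRing_iff hG he.1).mp hE⟩
  ext r
  rw [Finset.mem_erase]
  refine ⟨fun hr => ⟨fun h => he.2 (h ▸ hr), hle hr⟩, fun ⟨hre, hr⟩ => ?_⟩
  by_contra hrH
  have h1 : weightRing k r ∈ ({weightRing k e} : Set (LocalSubring (FunField k))) := by
    rw [← hex]
    exact ⟨r, by rw [Finset.mem_coe, Finset.mem_sdiff]; exact ⟨hr, hrH⟩, rfl⟩
  exact hre (weightRing_injOn (F := G) hr he.1 h1)

theorem IsToricLogDelPezzoOne.card_rays (h : IsToricLogDelPezzoOne (toricModel k F)) :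
    F.rays.card = 3 := by
  have h1 := h.2
  rw [toricModel_eq] at h1
  exact card_rays_of_picardNumber_eq_one h1

theorem IsOneStepCascade.invariants {S' S T' T : Model k} (h : IsOneStepCascade S' S T' T) :
    (singularPoints S).ncard = (singularPoints T).ncard ∧
      trace S' S - 3 * (exceptionalCount S' S : ℤ) =
        trace T' T - 3 * (exceptionalCount T' T : ℤ) := by
  obtain ⟨hS, hT, hS', hT', hb⟩ := h
  obtain ⟨F₁, rfl⟩ := hS.1.1
  obtain ⟨F₂, rfl⟩ := hT.1.1
  obtain ⟨G, rfl⟩ := hS'.1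
  obtain ⟨H, rfl⟩ := hT'.1
  obtain ⟨hG, hle₁, hG2⟩ := hS'.rays
  obtain ⟨hH, hle₂, hH2⟩ := hT'.rays
  obtain ⟨e, he, hHe, hw⟩ := hb.rays
  obtain ⟨h1, h2⟩ := CompleteFan.comparison_of_erase hG hH he hHe hw hle₁ hle₂ hS.card_rays
    hT.card_rays hG2 hH2
  refine ⟨?_, ?_⟩
  · rw [toricModel_eq, toricModel_eq, ncard_singularPoints, ncard_singularPoints, h1]
  · rw [trace_sub_count hG, trace_sub_count hH, h2]

theorem IsCascade.isOneStepCascade {t : ℕ} {S' S : ℕ → Model k} (h : IsCascade t S' S) {i : ℕ}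
    (hi : i < t) : IsOneStepCascade (S' (i + 1)) (S (i + 1)) (S' i) (S i) :=
  ⟨h.logDelPezzo _ hi, h.logDelPezzo _ hi.le, h.minimalResolution _ hi,
    h.minimalResolution _ hi.le, h.blowDown _ hi⟩

theorem IsCascade.invariants {t : ℕ} {S' S : ℕ → Model k} (h : IsCascade t S' S) {i : ℕ}
    (hi : i ≤ t) : (singularPoints (S i)).ncard = (singularPoints (S t)).ncard ∧
      trace (S' i) (S i) - 3 * (exceptionalCount (S' i) (S i) : ℤ) =
        trace (S' t) (S t) - 3 * (exceptionalCount (S' t) (S t) : ℤ) := by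
  induction hi using Nat.decreasingInduction with
  | of_succ j hj ih =>
    obtain ⟨h1, h2⟩ := (h.isOneStepCascade hj).invariants
    exact ⟨h1.symm.trans ih.1, h2.symm.trans ih.2⟩
  | self => exact ⟨rfl, rfl⟩

end ToricSurface

end

theorem mainTheorem6 (k : Type*) [Field k] [IsAlgClosed k] [CharZero k] :
    (∀ S' S T' T : Model k, IsOneStepCascade S' S T' T →
      ((singularPoints S).Finite ∧ (singularPoints T).Finite ∧
        (singularPoints S).ncard = (singularPoints T).ncard) ∧
      ((exceptionalCurves S' S).Finite ∧ (exceptionalCurves T' T).Finite ∧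
        trace S' S - 3 * (exceptionalCount S' S : ℤ) =
          trace T' T - 3 * (exceptionalCount T' T : ℤ))) ∧
    (∀ (t : ℕ) (S' S : ℕ → Model k), IsCascade t S' S → ∀ i ≤ t,
      ((singularPoints (S i)).Finite ∧
        (singularPoints (S i)).ncard = (singularPoints (S t)).ncard) ∧
      ((exceptionalCurves (S' i) (S i)).Finite ∧
        trace (S' i) (S i) - 3 * (exceptionalCount (S' i) (S i) : ℤ) =
          trace (S' t) (S t) - 3 * (exceptionalCount (S' t) (S t) : ℤ))) := by
  refine ⟨fun S' S T' T h => ?_, fun t S' S h i hi => ?_⟩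
  · have hS := h.logDelPezzo_source.1.1
    have hT := h.logDelPezzo_target.1.1
    exact ⟨⟨hS.singularPoints_finite, hT.singularPoints_finite, h.invariants.1⟩,
      exceptionalCurves_finite h.minimalResolution_source.1 hS,
      exceptionalCurves_finite h.minimalResolution_target.1 hT, h.invariants.2⟩
  · have hS := (h.logDelPezzo i hi).1.1
    exact ⟨⟨hS.singularPoints_finite, (h.invariants hi).1⟩,
      exceptionalCurves_finite (h.minimalResolution i hi).1 hS, (h.invariants hi).2⟩
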